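/- Let $\delta\in(0,1)$, $M>0$, $K>0$ and $\kappa>1$. There are constants $c, C_1, C_2, \varepsilon_0>0$, depending only on $\delta, M, K, \kappa$, such that the following holds for all $n,p\ge 1$ with $p/n\le 1-\delta$ and $(\log p)/n\le\varepsilon_0$. Let the rows of $X\in\mathbf R^{n\times p}$ be i.i.d. samples from a mean-zero distribution on $\mathbf R^p$ with covariance matrix $\Sigma^\star$, invertible with inverse $\Omega^\star$ (the precision matrix), and let $Z$ have this distribution. Assume: * $\sup_{\|z\|_2=1}\|\langle z,Z\rangle\|_{\psi_2}\le K$, where $\|Y\|_{\psi_2}=\inf\{t>0:\mathbb E\exp(Y^2/t^2)\le 2\}$; * all eigenvalues of $\Omega^\star$ lie in $[1/\kappa,\kappa]$; * $d\sqrt{(\log p)/n}\le M$, where $d=\max_j\#\{k\ne j:\Omega^\star_{jk}\ne 0\}$. Put $s=\#\{(j,k):j>k,\ \Omega^\star_{jk}\ne 0\}$, $\tau_j^2=\Sigma^\star_{jj}-\Sigma^\star_{j,\setminus j}(\Sigma^\star_{\setminus j,\setminus j})^{-1}\Sigma^\star_{\setminus j,j}$, $T=\mathrm{diag}(\tau_1,\dots,\tau_p)$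 and $Q^\star=-T\Omega^\star T$ (the partial correlation matrix). Joint partial regression with parameter $\lambda=c\sqrt{(\log p)/n}$ is the following procedure. For each $j$ take a lasso solution $\hat\theta_j\in\arg\min_{\theta\in\mathbf R^{p-1}}\{\frac1{2n}\|X_j-X_{\setminus j}\theta\|_2^2+\lambda\|\theta\|_1\}$ and put $\hat\tau_j^2=\frac1n\|X_j-X_{\setminus j}\hat\theta_j\|_2^2$, where $X_j$ is the $j$-th column of $X$ and $X_{\setminus j}$ consists of the other columns; these variances are required to be positive. Then let $\widehat\Omega$ be the matrix part of a solution of $$\text{minimize } \sum_{j=1}^p\Big(\tfrac1{2n}\|X_j-X_{\setminus j}\theta_j\|_2^2+\lambda\|\theta_j\|_1\Big)\ \text{ subject to } \Omega_{jj}=1/\hat\tau_j^2,\ \ \Omega_{\setminus j,j}=-\theta_j/\hat\tau_j^2\ (j=1,\dots,p),\ \ \Omega\succeq 0,$$ in the variables $\Omega\in\mathbf R^{p\times p}$ and $\theta_1,\dots,\theta_p\in\mathbf R^{p-1}$, and put $\widehat Q=-\widehat T\widehat\Omega\widehat T$ with $\widehat T=\mathrm{diag}(\hat\tau_1,\dots,\hat\tau_p)$.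 Then, with probability at least $1-6/p$, the procedure has an output, and every output $(\widehat\Omega,\widehat Q)$ satisfies $$\|\widehat Q-Q^\star\|_{\mathrm F}\le C_1\sqrt{\frac{s\log p}{n}}\qquad\text{and}\qquad \|\widehat\Omega-\Omega^\star\|_{\mathrm F}\le C_2\sqrt{\frac{(s+p)\log p}{n}}.$$ -/

import Mathlib

open MeasureTheory ProbabilityTheory
open scoped ENNReal Matrix

/- Throughout, the norm of a matrix is its Frobenius norm. -/
attribute [local instance] Matrix.frobeniusNormedAddCommGroup

namespace JPR

noncomputable section

/-- The sub-Gaussian norm `inf {t > 0 : E exp (Y² / t²) ≤ 2}` of a real random variable `Y`, with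
values in `[0, ∞]` (it is `∞` if there is no such `t`). The expectation is a Lebesgue integral, so
that a non-integrable exponential has expectation `∞`. -/
def psi2Norm {S : Type*} [MeasurableSpace S] (Y : S → ℝ) (μ : Measure S) : ℝ≥0∞ :=
  sInf {r : ℝ≥0∞ | ∃ t : ℝ, 0 < t ∧ r = ENNReal.ofReal t ∧
    ∫⁻ x, ENNReal.ofReal (Real.exp (Y x ^ 2 / t ^ 2)) ∂μ ≤ 2}

/-- The sub-Gaussian norm of a distribution `μ` on `ℝᵖ`: the supremum over unit vectors `z` of the
sub-Gaussian norm of the linear form `⟨z, ·⟩` under `μ`. -/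
def psi2NormVec {p : ℕ} (μ : Measure (EuclideanSpace ℝ (Fin p))) : ℝ≥0∞ :=
  ⨆ z : {z : EuclideanSpace ℝ (Fin p) // ‖z‖ = 1}, psi2Norm (fun x => inner ℝ z.1 x) μ

/-- The covariance matrix of a distribution on `ℝᵖ`. -/
def covMatrix {p : ℕ} (μ : Measure (EuclideanSpace ℝ (Fin p))) : Matrix (Fin p) (Fin p) ℝ :=
  Matrix.of fun j k => cov[fun x => x j, fun x => x k; μ]

/-- The precision matrix of a distribution on `ℝᵖ`: the inverse of its covariance matrix. (If the
covariance matrix is singular this is the zero matrix, all of whose eigenvalues are `0`.) -/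
def precMatrix {p : ℕ} (μ : Measure (EuclideanSpace ℝ (Fin p))) : Matrix (Fin p) (Fin p) ℝ :=
  (covMatrix μ)⁻¹

/-- The population residual variance
`τ_j² = Σ_jj - Σ_{j,∖j} (Σ_{∖j,∖j})⁻¹ Σ_{∖j,j}`
of the linear regression of the `j`-th coordinate on all others. -/
def residVar {p : ℕ} (S : Matrix (Fin p) (Fin p) ℝ) (j : Fin p) : ℝ :=
  S j j - (fun k : {k : Fin p // k ≠ j} => S j k) ⬝ᵥ
    ((S.submatrix (fun k : {k : Fin p // k ≠ j} => k.1) (fun k : {k : Fin p // k ≠ j} => k.1))⁻¹ *ᵥ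
      (fun k : {k : Fin p // k ≠ j} => S k j))

/-- `-T W T` with `T = diag(√v_1, …, √v_p)`: the partial correlation matrix belonging to a
precision matrix `W` and residual variances `v`. -/
def partialCorr {p : ℕ} (v : Fin p → ℝ) (W : Matrix (Fin p) (Fin p) ℝ) :
    Matrix (Fin p) (Fin p) ℝ :=
  -(Matrix.diagonal (fun j => Real.sqrt (v j)) * W * Matrix.diagonal (fun j => Real.sqrt (v j)))

/-- The true partial correlation matrix `Q⋆ = -T Ω⋆ T`, `T = diag(τ_1, …, τ_p)`. -/
def partialCorrMatrix {p : ℕ} (μ : Measure (EuclideanSpace ℝ (Fin p))) :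
    Matrix (Fin p) (Fin p) ℝ :=
  partialCorr (residVar (covMatrix μ)) (precMatrix μ)

/-- The degree `max_j #{k ≠ j : W_jk ≠ 0}`. -/
def degree {p : ℕ} (W : Matrix (Fin p) (Fin p) ℝ) : ℕ :=
  Finset.univ.sup fun j : Fin p => Set.ncard {k : Fin p | k ≠ j ∧ W j k ≠ 0}

/-- The size `#{(j, k) : W_jk ≠ 0, j > k}`. -/
def size {p : ℕ} (W : Matrix (Fin p) (Fin p) ℝ) : ℕ :=
  Set.ncard {jk : Fin p × Fin p | W jk.1 jk.2 ≠ 0 ∧ jk.2 < jk.1}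

/-- The mean squared residual `(1/n) ‖A_j - A_{∖j} θ‖₂²`. -/
def meanSqResid {n p : ℕ} (A : Matrix (Fin n) (Fin p) ℝ) (j : Fin p)
    (θ : {k : Fin p // k ≠ j} → ℝ) : ℝ :=
  (1 / (n : ℝ)) * ∑ i, (A i j - ∑ k, A i k.1 * θ k) ^ 2

/-- The lasso objective `(1/(2n)) ‖A_j - A_{∖j} θ‖₂² + lam ‖θ‖₁`. -/
def lassoObj {n p : ℕ} (A : Matrix (Fin n) (Fin p) ℝ) (lam : ℝ) (j : Fin p)
    (θ : {k : Fin p // k ≠ j} → ℝ) : ℝ :=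
  (1 / (2 * (n : ℝ))) * ∑ i, (A i j - ∑ k, A i k.1 * θ k) ^ 2 + lam * ∑ k, |θ k|

/-- The feasible set of the convex program, for residual variances `v`: pairs of a matrix `W` and
coefficient vectors `θ_1, …, θ_p` with `W_jj = 1 / v_j`, `W_{∖j,j} = -θ_j / v_j` and `W ⪰ 0`
(which includes the symmetry of `W`). -/
def feasible {p : ℕ} (v : Fin p → ℝ) :
    Set (Matrix (Fin p) (Fin p) ℝ × ((j : Fin p) → {k : Fin p // k ≠ j} → ℝ)) :=
  {x | (∀ j, x.1 j j = 1 / v j) ∧ (∀ j, ∀ k : {k : Fin p // k ≠ j}, x.1 k.1 j = -(x.2 j k) / v j) ∧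
    x.1.PosSemidef}

/-- The objective of the convex program: the sum of the lasso objectives. -/
def programObj {n p : ℕ} (A : Matrix (Fin n) (Fin p) ℝ) (lam : ℝ)
    (x : Matrix (Fin p) (Fin p) ℝ × ((j : Fin p) → {k : Fin p // k ≠ j} → ℝ)) : ℝ :=
  ∑ j, lassoObj A lam j (x.2 j)

/-- `(W, Q)` is an output of joint partial regression on the data matrix `A` with regularization
parameter `lam`. Lasso regressions (any minimizers `θ₀ j`) give the residual variances `v j`; these
have to be positive for the convex program, which divides by them, to make sense. Then `W` comes
from a minimizer `(W, θ)` of the convex program, and `Q = -T W T` with `T = diag(√v_1, …, √v_p)`. -/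
def IsOutput {n p : ℕ} (A : Matrix (Fin n) (Fin p) ℝ) (lam : ℝ)
    (W Q : Matrix (Fin p) (Fin p) ℝ) : Prop :=
  ∃ (θ₀ θ : (j : Fin p) → {k : Fin p // k ≠ j} → ℝ) (v : Fin p → ℝ),
    (∀ j, IsMinOn (lassoObj A lam j) Set.univ (θ₀ j)) ∧
    (∀ j, v j = meanSqResid A j (θ₀ j)) ∧ (∀ j, 0 < v j) ∧
    (W, θ) ∈ feasible v ∧ IsMinOn (programObj A lam) (feasible v) (W, θ) ∧
    Q = partialCorr v W

end

end JPR

/-!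
Write `H = XᵀX / n`, `r = √(log p / n)`, and let `u_j = e_j - θ_j` be the vector of the
coefficients of the residual of column `j`. The constraints say `Ω e_j = u_j / v_j` with `v_j` the
variance from the lasso regression, and the objective is the sum of the column objectives
`u_jᵀ H u_j / 2 + lam ‖u_j‖₁` (up to the constant entry `1` of `u_j`). The assumption
`p / n ≤ 1 - δ` is used only through `p ≤ n`.

*The good event* (`exists_good_event`). With probability at least `1 - 6 / p` four things hold: the
operator norm of `H` is bounded, restricted strong convexity
`uᵀ H u ≥ a ‖u‖₂² - b r² ‖u‖₁²` holds for all `u`, and the noise and the variances of the population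
regressions are within `O(r)` of their expectations (`SampleBounds`). All of them come from
Bernstein's inequality and a union bound. For the operator norm the union is over the integer points
of a ball of radius `2√p` (`form_le_of_grid`), at most `48 ^ p` many, and `p ≤ n` is what makes this
affordable. For restricted strong convexity it is over the sums of `m ≈ 1 / r²` signed basis
vectors, and Maurey's empirical method passes from these to all vectors (`form_ge_of_sparse`).

*The column errors.* Restricted strong convexity and `d r ≤ M` make the lasso variances consistent,
`|v_j - τ_j²| = O(r)` (`variance_bound`). Hence rescaling `Ω⋆` on both sides by the ratios of the
true and the estimated standard deviations gives a feasible point whose residual vectors differ from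
the true ones only on the edges of `Ω⋆`, by `O(r)`. Comparison with it bounds the *total* gap
between the column objectives at the solution and at the truth by `O(r² s)` (`program_le`). A column
with gap `g_j ≥ 0` has squared error `O(r² d_j + g_j + g_j²)` (`lasso_error`); the quadratic term
arises because a point with a positive gap may leave the lasso cone.

*Removing the quadratic term* (`sum_error_le`). It is harmless in the columns with `g_j ≤ 1`. The
set `B` of the other columns has at most `∑ g_j = O(r² s)` elements. Since `Q̂ - Q⋆` is symmetric,
the entries of the columns in `B` that lie outside the rows in `B` are, up to constants and edge
terms, entries of good columns. The remaining part of such a column has at most `|B|` nonzero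
entries, so restricted strong convexity controls it without any cone condition, provided that
`r² |B|` is small; and `r² · r² s ≤ M r³ p = O(√r)` because `d r ≤ M` and `p ≤ n`
(`rate_cube_le`). This gives both bounds (`deterministic_bounds`); for the precision matrix the
diagonal adds the error `O(r²)` of each of the `p` variances.

*Existence* of an output (`exists_isOutput`): the objectives are continuous and coercive, and the
feasible set is closed and contains a diagonal matrix.
-/

namespace JPR

/-! ### Quadratic forms -/

theorem form_add {ι : Type*} [Fintype ι] (D : Matrix ι ι ℝ) (x y : ι → ℝ) :
    (x + y) ⬝ᵥ (D *ᵥ (x + y)) =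
      x ⬝ᵥ (D *ᵥ x) + (x ⬝ᵥ (D *ᵥ y) + y ⬝ᵥ (D *ᵥ x)) + y ⬝ᵥ (D *ᵥ y) := by
  simp only [Matrix.mulVec_add, add_dotProduct, dotProduct_add]; ring

theorem form_smul {ι : Type*} [Fintype ι] (D : Matrix ι ι ℝ) (c : ℝ) (x : ι → ℝ) :
    (c • x) ⬝ᵥ (D *ᵥ (c • x)) = c ^ 2 * (x ⬝ᵥ (D *ᵥ x)) := by
  simp only [Matrix.mulVec_smul, smul_dotProduct, dotProduct_smul, smul_eq_mul]; ring

theorem dot_self_eq {ι : Type*} [Fintype ι] (x : ι → ℝ) : x ⬝ᵥ x = ∑ k, x k ^ 2 := by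
  simp [dotProduct, sq]

theorem dot_self_nonneg {ι : Type*} [Fintype ι] (x : ι → ℝ) : 0 ≤ x ⬝ᵥ x := by
  rw [dot_self_eq]; positivity

theorem form_symm {ι : Type*} [Fintype ι] {D : Matrix ι ι ℝ} (hD : Dᵀ = D) (x y : ι → ℝ) :
    x ⬝ᵥ (D *ᵥ y) = y ⬝ᵥ (D *ᵥ x) := by
  rw [Matrix.dotProduct_mulVec, ← Matrix.mulVec_transpose, hD, dotProduct_comm]

theorem form_nonneg {ι : Type*} [Fintype ι] {D : Matrix ι ι ℝ} (hD : D.PosSemidef) (x : ι → ℝ) :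
    0 ≤ x ⬝ᵥ (D *ᵥ x) := by
  simpa using hD.dotProduct_mulVec_nonneg x

theorem transpose_eq_of_posSemidef {ι : Type*} [Fintype ι] {D : Matrix ι ι ℝ}
    (hD : D.PosSemidef) : Dᵀ = D := by
  rw [← Matrix.conjTranspose_eq_transpose_of_trivial, hD.isHermitian.eq]

theorem form_add_le {ι : Type*} [Fintype ι] {D : Matrix ι ι ℝ} (hD : D.PosSemidef)
    (x y : ι → ℝ) :
    (x + y) ⬝ᵥ (D *ᵥ (x + y)) ≤ 2 * (x ⬝ᵥ (D *ᵥ x)) + 2 * (y ⬝ᵥ (D *ᵥ y)) := by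
  have h := form_nonneg hD (x - y)
  rw [sub_eq_add_neg, form_add] at h
  rw [form_add]
  simp only [Matrix.mulVec_neg, neg_dotProduct, dotProduct_neg] at h
  linarith

theorem convexOn_form {ι : Type*} [Fintype ι] {D : Matrix ι ι ℝ} (hD : D.PosSemidef) :
    ConvexOn ℝ Set.univ (fun x : ι → ℝ => x ⬝ᵥ (D *ᵥ x)) := by
  refine ⟨convex_univ, fun x _ y _ s t hs ht hst => ?_⟩
  have h := form_nonneg hD (x - y)
  rw [sub_eq_add_neg, form_add] at h
  simp only [Matrix.mulVec_neg, neg_dotProduct, dotProduct_neg] at h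
  obtain rfl : t = 1 - s := by linarith
  simp only [form_add, form_smul, smul_eq_mul]
  simp only [Matrix.mulVec_smul, smul_dotProduct, dotProduct_smul, smul_eq_mul]
  nlinarith [mul_nonneg (mul_nonneg hs ht) h]

/-- The expectation of a quadratic form at `u + Y₁ + … + Y_m`, with independent `Y_i` that take
the value `y a` with probability `w a`, is the right-hand side; it is nonnegative if the form is
nonnegative at all values of `u + Y₁ + … + Y_m`. -/
theorem expected_form_nonneg {ι κ : Type*} [Fintype ι] [Fintype κ] (D : Matrix ι ι ℝ)
    (y : κ → ι → ℝ) (w : κ → ℝ) (v : ι → ℝ) (hw : ∀ a, 0 ≤ w a) (hw1 : ∑ a, w a = 1)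
    (hv : ∑ a, w a • y a = v) (m : ℕ) :
    ∀ u : ι → ℝ,
      (∀ f : Fin m → κ, 0 ≤ (u + ∑ i, y (f i)) ⬝ᵥ (D *ᵥ (u + ∑ i, y (f i)))) →
      0 ≤ u ⬝ᵥ (D *ᵥ u) + m * (u ⬝ᵥ (D *ᵥ v) + v ⬝ᵥ (D *ᵥ u)) +
        m * ∑ a, w a * (y a ⬝ᵥ (D *ᵥ y a)) + m * (m - 1) * (v ⬝ᵥ (D *ᵥ v)) := by
  induction m with
  | zero => intro u h; simpa using h
  | succ m ih =>
    intro u h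
    have key : ∀ a, 0 ≤ w a * ((u + y a) ⬝ᵥ (D *ᵥ (u + y a)) +
        m * ((u + y a) ⬝ᵥ (D *ᵥ v) + v ⬝ᵥ (D *ᵥ (u + y a))) +
        m * ∑ a, w a * (y a ⬝ᵥ (D *ᵥ y a)) + m * (m - 1) * (v ⬝ᵥ (D *ᵥ v))) := by
      intro a
      refine mul_nonneg (hw a) (ih (u + y a) fun f => ?_)
      have := h (Fin.cons a f)
      simpa [Fin.sum_univ_succ, add_assoc] using this
    have hsum := Finset.sum_nonneg (s := Finset.univ) fun a _ => key a
    have e1 : ∀ z : ι → ℝ, ∑ a, w a * (z ⬝ᵥ (D *ᵥ y a)) = z ⬝ᵥ (D *ᵥ v) := by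
      intro z
      rw [← hv, Matrix.mulVec_sum, dotProduct_sum]
      simp [Matrix.mulVec_smul, dotProduct_smul]
    have e2 : ∀ z : ι → ℝ, ∑ a, w a * (y a ⬝ᵥ (D *ᵥ z)) = v ⬝ᵥ (D *ᵥ z) := by
      intro z
      rw [← hv, sum_dotProduct]
      simp [smul_dotProduct]
    set Ey := ∑ a, w a * (y a ⬝ᵥ (D *ᵥ y a)) with hEy
    have : ∑ a, w a * ((u + y a) ⬝ᵥ (D *ᵥ (u + y a)) +
        m * ((u + y a) ⬝ᵥ (D *ᵥ v) + v ⬝ᵥ (D *ᵥ (u + y a))) +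
        m * Ey + m * (m - 1) * (v ⬝ᵥ (D *ᵥ v))) =
      (∑ a, w a) * (u ⬝ᵥ (D *ᵥ u) + m * (u ⬝ᵥ (D *ᵥ v) + v ⬝ᵥ (D *ᵥ u)) + m * Ey
        + m * (m - 1) * (v ⬝ᵥ (D *ᵥ v))) + ∑ a, w a * (u ⬝ᵥ (D *ᵥ y a)) +
        ∑ a, w a * (y a ⬝ᵥ (D *ᵥ u)) + Ey +
        m * (∑ a, w a * (y a ⬝ᵥ (D *ᵥ v)) + ∑ a, w a * (v ⬝ᵥ (D *ᵥ y a))) := by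
      have hEy' : Ey = ∑ a, w a * (y a ⬝ᵥ (D *ᵥ y a)) := hEy
      clear_value Ey
      nth_rw 3 [hEy']
      rw [Finset.sum_mul, mul_add (m : ℝ) (∑ a, w a * (y a ⬝ᵥ (D *ᵥ v))), Finset.mul_sum,
        Finset.mul_sum]
      simp only [← Finset.sum_add_distrib]
      refine Finset.sum_congr rfl fun a _ => ?_
      simp only [Matrix.mulVec_add, add_dotProduct, dotProduct_add]
      ring
    rw [this, hw1, e1, e2, e2, e1] at hsum
    push_cast
    linarith

/-- The basis vector `e_k` or `-e_k`. -/
def signedBasis {ι : Type*} [DecidableEq ι] (a : ι × Bool) : ι → ℝ :=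
  Pi.single a.1 (if a.2 then 1 else -1)

/-- Maurey's empirical method: a quadratic form that is nonnegative at all sums of `m` signed basis
vectors is nonnegative everywhere up to a multiple of `‖v‖₁² / (m - 1)`. -/
theorem form_ge_of_sparse {ι : Type*} [Fintype ι] [DecidableEq ι] (D : Matrix ι ι ℝ) {m : ℕ}
    (hm : 1 ≤ m) {A : ℝ}
    (hD : ∀ f : Fin m → ι × Bool, 0 ≤ (∑ i, signedBasis (f i)) ⬝ᵥ (D *ᵥ ∑ i, signedBasis (f i)))
    (hA : ∀ k, D k k ≤ A) (v : ι → ℝ) :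
    0 ≤ (m - 1) * (v ⬝ᵥ (D *ᵥ v)) + A * (∑ k, |v k|) ^ 2 := by
  set R := ∑ k, |v k| with hR
  have hR0 : 0 ≤ R := Finset.sum_nonneg fun k _ => abs_nonneg _
  rcases hR0.eq_or_lt with h0 | hpos
  · have : v = 0 := by
      ext k
      have := (Finset.sum_eq_zero_iff_of_nonneg (fun k _ => abs_nonneg (v k))).1 h0.symm k
        (Finset.mem_univ _)
      simpa using this
    simp [this, ← h0]
  set y : ι → ι → ℝ := fun k => signedBasis (k, decide (0 ≤ v k)) with hy
  have hvy : ∑ a, (|v a| / R) • y a = R⁻¹ • v := by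
    ext k
    simp only [Finset.sum_apply, Pi.smul_apply, hy, signedBasis, Pi.single_apply, smul_eq_mul]
    rw [Finset.sum_eq_single k]
    · by_cases h : 0 ≤ v k
      · simp [h, abs_of_nonneg h]; ring
      · simp [h, abs_of_neg (not_le.1 h)]; ring
    · intro b _ hb; simp [Ne.symm hb]
    · simp
  have h := expected_form_nonneg D y (fun a => |v a| / R) (R⁻¹ • v)
    (fun a => by positivity) (by rw [← Finset.sum_div, div_self hpos.ne']) hvy m 0
    (fun f => by simpa [hy] using hD fun i => (f i, decide (0 ≤ v (f i))))
  have hyD : ∀ a, y a ⬝ᵥ (D *ᵥ y a) = D a a := by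
    intro a
    by_cases h : 0 ≤ v a <;> simp [hy, signedBasis, h, dotProduct, Pi.single_apply]
  have hE : ∑ a, |v a| / R * (y a ⬝ᵥ (D *ᵥ y a)) ≤ A := by
    calc _ ≤ ∑ a, |v a| / R * A := Finset.sum_le_sum fun a _ => by
            rw [hyD]; exact mul_le_mul_of_nonneg_left (hA a) (by positivity)
      _ = A := by rw [← Finset.sum_mul, ← Finset.sum_div, div_self hpos.ne', one_mul]
  rw [form_smul] at h
  simp only [zero_dotProduct, Matrix.mulVec_zero, dotProduct_zero, add_zero, mul_zero,
    zero_add] at h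
  have hm' : (0 : ℝ) < m := by exact_mod_cast hm
  have h2 : 0 ≤ m * (A + (m - 1) * (R⁻¹ ^ 2 * (v ⬝ᵥ (D *ᵥ v)))) := by
    nlinarith [mul_le_mul_of_nonneg_left hE hm'.le]
  have h3 := nonneg_of_mul_nonneg_right h2 hm'
  have h4 := mul_nonneg h3 (sq_nonneg R)
  have : (A + (m - 1) * (R⁻¹ ^ 2 * (v ⬝ᵥ (D *ᵥ v)))) * R ^ 2 =
      (m - 1) * (v ⬝ᵥ (D *ᵥ v)) + A * R ^ 2 := by
    field_simp; ring
  linarith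

/-- A positive semidefinite form is largest at the vertices of the unit cell of the integer grid
that contains `√p v`, so it suffices to bound it on the grid. -/
theorem form_le_of_grid {p : ℕ} (hp : 1 ≤ p) {D : Matrix (Fin p) (Fin p) ℝ} (hD : D.PosSemidef)
    {A : ℝ} (hA : 0 ≤ A)
    (hz : ∀ z : Fin p → ℤ, ∑ k, z k ^ 2 ≤ 4 * p →
      (fun k => (z k : ℝ)) ⬝ᵥ (D *ᵥ fun k => (z k : ℝ)) ≤ A * ∑ k, (z k : ℝ) ^ 2)
    (v : Fin p → ℝ) : v ⬝ᵥ (D *ᵥ v) ≤ 4 * A * (v ⬝ᵥ v) := by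
  have main : ∀ v : Fin p → ℝ, v ⬝ᵥ v = p → v ⬝ᵥ (D *ᵥ v) ≤ 4 * A * (v ⬝ᵥ v) := by
    intro v hv
    set t : Set (Fin p → ℝ) := Set.univ.pi fun k => {(⌊v k⌋ : ℝ), (⌊v k⌋ : ℝ) + 1} with ht
    have hmem : v ∈ convexHull ℝ t := by
      rw [ht, convexHull_pi]
      intro k _
      simp only [convexHull_pair]
      rw [segment_eq_Icc (by linarith)]
      exact ⟨Int.floor_le _, (Int.lt_floor_add_one _).le⟩
    obtain ⟨x, hxt, hx⟩ := (convexOn_form hD).exists_ge_of_mem_convexHull (Set.subset_univ t) hmem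
    have hex : ∀ k, ∃ z : ℤ, x k = z ∧ (z : ℝ) ^ 2 ≤ 2 * v k ^ 2 + 2 := by
      intro k
      have h1 := Int.floor_le (v k)
      have h2 := Int.lt_floor_add_one (v k)
      have hk := hxt k (Set.mem_univ k)
      simp only [Set.mem_insert_iff, Set.mem_singleton_iff] at hk
      rcases hk with hk | hk
      · refine ⟨⌊v k⌋, hk, ?_⟩
        nlinarith [sq_nonneg (v k + (v k - ⌊v k⌋))]
      · refine ⟨⌊v k⌋ + 1, by push_cast; exact hk, ?_⟩
        push_cast
        nlinarith [sq_nonneg (v k + (v k - (⌊v k⌋ + 1)))]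
    choose z hz1 hz2 using hex
    have hxz : x = fun k => (z k : ℝ) := funext hz1
    rw [dot_self_eq] at hv ⊢
    have hzs : ∑ k, (z k : ℝ) ^ 2 ≤ 4 * p := by
      calc _ ≤ ∑ k, (2 * v k ^ 2 + 2) := Finset.sum_le_sum fun k _ => hz2 k
        _ = 4 * p := by
          rw [Finset.sum_add_distrib, ← Finset.mul_sum, hv]; simp; ring
    calc v ⬝ᵥ (D *ᵥ v) ≤ x ⬝ᵥ (D *ᵥ x) := hx
      _ ≤ A * ∑ k, (z k : ℝ) ^ 2 := by rw [hxz]; exact hz z (by exact_mod_cast hzs)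
      _ ≤ A * (4 * p) := mul_le_mul_of_nonneg_left hzs hA
      _ = _ := by rw [hv]; ring
  rcases (dot_self_nonneg v).eq_or_lt with h0 | hpos
  · have : v = 0 := dotProduct_self_eq_zero.1 h0.symm
    simp [this]
  have hp' : (0 : ℝ) < p := by exact_mod_cast hp
  set c := Real.sqrt (p / (v ⬝ᵥ v)) with hc
  have hc2 : c ^ 2 = p / (v ⬝ᵥ v) := Real.sq_sqrt (by positivity)
  have hc0 : 0 < c ^ 2 := by rw [hc2]; positivity
  have hcc : (c • v) ⬝ᵥ (c • v) = c ^ 2 * (v ⬝ᵥ v) := by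
    simp only [smul_dotProduct, dotProduct_smul, smul_eq_mul]; ring
  have h := main (c • v) (by rw [hcc, hc2]; field_simp)
  rw [form_smul, hcc] at h
  nlinarith

theorem sum_half_pow_natAbs_le (N : ℕ) :
    ∑ z ∈ Finset.Icc (-(N : ℤ)) N, (1 / 2 : ℝ) ^ z.natAbs ≤ 3 - 2 * (1 / 2) ^ N := by
  induction N with
  | zero => simp; norm_num
  | succ N ih =>
    have : Finset.Icc (-((N + 1 : ℕ) : ℤ)) ((N + 1 : ℕ) : ℤ) =
        insert (-((N + 1 : ℕ) : ℤ)) (insert ((N + 1 : ℕ) : ℤ) (Finset.Icc (-(N : ℤ)) N)) := by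
      ext x; simp only [Finset.mem_Icc, Finset.mem_insert]; push_cast; omega
    rw [this, Finset.sum_insert, Finset.sum_insert]
    · rw [Int.natAbs_neg, Int.natAbs_natCast, pow_succ]
      have : (0 : ℝ) ≤ (1 / 2) ^ N := by positivity
      linarith
    · simp
    · simp only [Finset.mem_insert, Finset.mem_Icc, not_or]; push_cast; omega

/-- The integer points of the ball of radius `2√p`. -/
noncomputable def gridBall (p : ℕ) : Finset (Fin p → ℤ) :=
  (Fintype.piFinset fun _ => Finset.Icc (-((4 * p : ℕ) : ℤ)) ((4 * p : ℕ) : ℤ)).filter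
    fun z => ∑ k, z k ^ 2 ≤ 4 * p

theorem mem_gridBall {p : ℕ} {z : Fin p → ℤ} : z ∈ gridBall p ↔ ∑ k, z k ^ 2 ≤ 4 * p := by
  simp only [gridBall, Finset.mem_filter, Fintype.mem_piFinset, Finset.mem_Icc,
    and_iff_right_iff_imp]
  intro h k
  have h1 : z k ^ 2 ≤ 4 * p :=
    (Finset.single_le_sum (f := fun k => z k ^ 2) (fun k _ => sq_nonneg _)
      (Finset.mem_univ k)).trans h
  push_cast
  constructor <;> nlinarith [Int.natCast_nonneg p]

/-- The points of the grid are counted with the weights `2 ^ (4p - ‖z‖₁) ≥ 1`, whose sum over all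
grid points factorizes. -/
theorem card_gridBall_le (p : ℕ) : ((gridBall p).card : ℝ) ≤ 48 ^ p := by
  calc ((gridBall p).card : ℝ) = ∑ z ∈ gridBall p, 1 := by simp
    _ ≤ ∑ z ∈ gridBall p, (2 : ℝ) ^ (4 * p) * ∏ k, (1 / 2 : ℝ) ^ (z k).natAbs := by
        refine Finset.sum_le_sum fun z hz => ?_
        rw [mem_gridBall] at hz
        have h1 : ∑ k, (z k).natAbs ≤ 4 * p := by
          zify
          refine (Finset.sum_le_sum fun k _ => ?_).trans hz
          rw [← sq_abs]
          have := abs_nonneg (z k)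
          rcases this.eq_or_lt with h | h
          · simp [← h]
          · nlinarith [Int.add_one_le_iff.2 h]
        rw [Finset.prod_pow_eq_pow_sum, one_div, inv_pow, ← div_eq_mul_inv,
          one_le_div (by positivity)]
        exact pow_le_pow_right₀ (by norm_num) h1
    _ ≤ ∑ z ∈ Fintype.piFinset fun _ : Fin p =>
          Finset.Icc (-((4 * p : ℕ) : ℤ)) ((4 * p : ℕ) : ℤ),
          (2 : ℝ) ^ (4 * p) * ∏ k, (1 / 2 : ℝ) ^ (z k).natAbs :=
        Finset.sum_le_sum_of_subset_of_nonneg (Finset.filter_subset _ _)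
          fun _ _ _ => by positivity
    _ = 2 ^ (4 * p) * ∏ _k : Fin p, ∑ z ∈ Finset.Icc (-((4 * p : ℕ) : ℤ)) ((4 * p : ℕ) : ℤ),
          (1 / 2 : ℝ) ^ z.natAbs := by
        rw [Finset.prod_univ_sum, Finset.mul_sum]
    _ ≤ 2 ^ (4 * p) * ∏ _k : Fin p, (3 : ℝ) := by
        gcongr with k
        exact (sum_half_pow_natAbs_le _).trans (by
          linarith [pow_pos (one_half_pos (α := ℝ)) (4 * p)])
    _ = 48 ^ p := by
        rw [Finset.prod_const, Finset.card_univ, Fintype.card_fin, pow_mul, ← mul_pow]; norm_num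

/-! ### The lasso in terms of the Gram matrix -/

/-- The sample covariance matrix `(1/n) AᵀA`. -/
noncomputable def gram {n p : ℕ} (A : Matrix (Fin n) (Fin p) ℝ) : Matrix (Fin p) (Fin p) ℝ :=
  (1 / (n : ℝ)) • (Aᵀ * A)

/-- The vector `e_j - θ` of the coefficients of the residual `A_j - A_{∖j} θ` in the columns
of `A`. -/
noncomputable def regVec {p : ℕ} (j : Fin p) (θ : {k : Fin p // k ≠ j} → ℝ) : Fin p → ℝ :=
  fun k => if h : k = j then 1 else -θ ⟨k, h⟩

/-- The lasso objective of column `j` as a function of the residual vector `u = e_j - θ`, for the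
sample covariance matrix `H`. The entry `u_j = 1` is not penalized. -/
noncomputable def penObj {p : ℕ} (H : Matrix (Fin p) (Fin p) ℝ) (lam : ℝ) (j : Fin p)
    (u : Fin p → ℝ) : ℝ :=
  1 / 2 * (u ⬝ᵥ (H *ᵥ u)) + lam * ∑ k ∈ Finset.univ.erase j, |u k|

theorem regVec_self {p : ℕ} (j : Fin p) (θ : {k : Fin p // k ≠ j} → ℝ) : regVec j θ j = 1 := by
  simp [regVec]

theorem regVec_of_ne {p : ℕ} {j k : Fin p} (h : k ≠ j) (θ : {k : Fin p // k ≠ j} → ℝ) :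
    regVec j θ k = -θ ⟨k, h⟩ := by
  simp [regVec, h]

theorem sum_mul_regVec {p : ℕ} (x : Fin p → ℝ) (j : Fin p) (θ : {k : Fin p // k ≠ j} → ℝ) :
    ∑ k, x k * regVec j θ k = x j - ∑ k, x k.1 * θ k := by
  rw [Fintype.sum_eq_add_sum_subtype_ne _ j, regVec_self, mul_one, sub_eq_add_neg,
    ← Finset.sum_neg_distrib]
  congr 1
  refine Finset.sum_congr rfl fun k _ => ?_
  rw [regVec_of_ne k.2]; ring

theorem gram_posSemidef {n p : ℕ} (A : Matrix (Fin n) (Fin p) ℝ) : (gram A).PosSemidef := by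
  have h := Matrix.posSemidef_conjTranspose_mul_self A
  rw [Matrix.conjTranspose_eq_transpose_of_trivial] at h
  exact h.smul (by positivity)

theorem form_gram₂ {n p : ℕ} (A : Matrix (Fin n) (Fin p) ℝ) (u w : Fin p → ℝ) :
    u ⬝ᵥ (gram A *ᵥ w) = (1 / (n : ℝ)) * ∑ i, (∑ k, A i k * u k) * (∑ k, A i k * w k) := by
  rw [gram, Matrix.smul_mulVec, dotProduct_smul, smul_eq_mul, ← Matrix.mulVec_mulVec,
    Matrix.dotProduct_mulVec, Matrix.vecMul_transpose]
  rfl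

theorem form_gram {n p : ℕ} (A : Matrix (Fin n) (Fin p) ℝ) (u : Fin p → ℝ) :
    u ⬝ᵥ (gram A *ᵥ u) = (1 / (n : ℝ)) * ∑ i, (∑ k, A i k * u k) ^ 2 := by
  rw [form_gram₂]; simp only [sq]

theorem meanSqResid_eq {n p : ℕ} (A : Matrix (Fin n) (Fin p) ℝ) (j : Fin p)
    (θ : {k : Fin p // k ≠ j} → ℝ) :
    meanSqResid A j θ = regVec j θ ⬝ᵥ (gram A *ᵥ regVec j θ) := by
  simp only [meanSqResid, form_gram, sum_mul_regVec]

theorem lassoObj_eq {n p : ℕ} (A : Matrix (Fin n) (Fin p) ℝ) (lam : ℝ) (j : Fin p)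
    (θ : {k : Fin p // k ≠ j} → ℝ) :
    lassoObj A lam j θ = penObj (gram A) lam j (regVec j θ) := by
  rw [lassoObj, penObj, form_gram]
  simp only [sum_mul_regVec]
  congr 1
  · rw [← mul_assoc]; congr 1; ring
  · congr 1
    rw [Finset.sum_subtype (Finset.univ.erase j) (p := fun k => k ≠ j) (by simp)]
    refine Finset.sum_congr rfl fun k _ => ?_
    rw [regVec_of_ne k.2, abs_neg]

/-- Every vector with entry `1` at `j` is the residual vector of some coefficients. -/
theorem exists_regVec_eq {p : ℕ} {j : Fin p} {u : Fin p → ℝ} (hu : u j = 1) :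
    regVec j (fun k => -u k.1) = u := by
  ext k
  by_cases h : k = j
  · subst h; rw [regVec_self, hu]
  · rw [regVec_of_ne h]; simp

/-! ### Deterministic lasso bounds -/

/-- The basic inequality of the lasso: the objective grows quadratically and, if the noise `H w` is
at most half the penalty level, by the `ℓ¹` norm of the step, except for the steps on the support
`S` of `w`. -/
theorem penObj_sub_ge {p : ℕ} {H : Matrix (Fin p) (Fin p) ℝ} (hH : H.PosSemidef) {lam : ℝ}
    (hlam : 0 ≤ lam) {j : Fin p} {w u : Fin p → ℝ} (hj : u j = w j) {S : Finset (Fin p)}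
    (hS : ∀ k, k ≠ j → k ∉ S → w k = 0) (hnoise : ∀ k, k ≠ j → |(H *ᵥ w) k| ≤ lam / 2) :
    1 / 2 * ((u - w) ⬝ᵥ (H *ᵥ (u - w))) + lam / 2 * ∑ k, |(u - w) k| -
      2 * lam * ∑ k ∈ S, |(u - w) k| ≤ penObj H lam j u - penObj H lam j w := by
  obtain ⟨h, rfl⟩ : ∃ h, u = w + h := ⟨u - w, by simp⟩
  have hj0 : h j = 0 := by simpa using hj
  rw [add_sub_cancel_left]
  have e1 : ∀ f : Fin p → ℝ, f j = 0 → ∑ k, f k = ∑ k ∈ Finset.univ.erase j, f k := by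
    intro f hf
    rw [← Finset.add_sum_erase _ _ (Finset.mem_univ j), hf, zero_add]
  have e2 : ∑ k ∈ S, |h k| = ∑ k ∈ Finset.univ.erase j, if k ∈ S then |h k| else 0 := by
    rw [← e1 _ (by simp [hj0]), Finset.sum_ite_mem, Finset.univ_inter]
  have e3 : h ⬝ᵥ (H *ᵥ w) = ∑ k ∈ Finset.univ.erase j, h k * (H *ᵥ w) k := by
    rw [← e1 (fun k => h k * (H *ᵥ w) k) (by simp [hj0])]; rfl
  have e4 : ∑ k, |h k| = ∑ k ∈ Finset.univ.erase j, |h k| := e1 _ (by simp [hj0])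
  have key : lam / 2 * ∑ k, |h k| - 2 * lam * ∑ k ∈ S, |h k| ≤
      h ⬝ᵥ (H *ᵥ w) + (lam * ∑ k ∈ Finset.univ.erase j, |(w + h) k| -
        lam * ∑ k ∈ Finset.univ.erase j, |w k|) := by
    rw [e2, e3, e4]
    simp only [Finset.mul_sum, ← Finset.sum_sub_distrib, ← Finset.sum_add_distrib]
    refine Finset.sum_le_sum fun k hk => ?_
    have hkj : k ≠ j := Finset.ne_of_mem_erase hk
    have h1 : -(lam / 2 * |h k|) ≤ h k * (H *ᵥ w) k := by
      have := neg_abs_le (h k * (H *ᵥ w) k)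
      rw [abs_mul] at this
      nlinarith [mul_le_mul_of_nonneg_left (hnoise k hkj) (abs_nonneg (h k))]
    by_cases hkS : k ∈ S
    · simp only [hkS, if_true, Pi.add_apply]
      have h2 : |w k| ≤ |w k + h k| + |h k| := by
        have := abs_sub (w k + h k) (h k)
        simpa using this
      nlinarith [mul_le_mul_of_nonneg_left h2 hlam]
    · simp only [hkS, if_false, Pi.add_apply, hS k hkj hkS, zero_add, abs_zero]
      nlinarith
  rw [penObj, penObj, form_add, form_symm (transpose_eq_of_posSemidef hH) w h]
  linarith

/-- Moving away from `w` raises the lasso objective at most by the quadratic term, and by the noise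
and the penalty, which are linear in the `ℓ¹` norm of the step. -/
theorem penObj_sub_le {p : ℕ} {H : Matrix (Fin p) (Fin p) ℝ} (hH : H.PosSemidef) {lam A : ℝ}
    (hlam : 0 ≤ lam) (hA : ∀ u : Fin p → ℝ, u ⬝ᵥ (H *ᵥ u) ≤ A * (u ⬝ᵥ u)) {j : Fin p}
    {w e : Fin p → ℝ} (hj : e j = 0) (hnoise : ∀ k, k ≠ j → |(H *ᵥ w) k| ≤ lam / 2) :
    penObj H lam j (w + e) - penObj H lam j w ≤
      A / 2 * (e ⬝ᵥ e) + 3 / 2 * lam * ∑ k, |e k| := by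
  have h1 : e ⬝ᵥ (H *ᵥ w) ≤ lam / 2 * ∑ k, |e k| := by
    rw [dotProduct, Finset.mul_sum]
    refine Finset.sum_le_sum fun k _ => ?_
    by_cases hk : k = j
    · subst hk; simp [hj]
    · refine (le_abs_self _).trans ?_
      rw [abs_mul, mul_comm]
      exact mul_le_mul_of_nonneg_right (hnoise k hk) (abs_nonneg _)
  have h2 : ∑ k ∈ Finset.univ.erase j, |(w + e) k| ≤
      ∑ k ∈ Finset.univ.erase j, |w k| + ∑ k, |e k| := by
    calc _ ≤ ∑ k ∈ Finset.univ.erase j, (|w k| + |e k|) :=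
          Finset.sum_le_sum fun k _ => abs_add_le _ _
      _ ≤ _ := by
        rw [Finset.sum_add_distrib]
        gcongr
        exact Finset.erase_subset _ _
  rw [penObj, penObj, form_add, form_symm (transpose_eq_of_posSemidef hH) w e]
  nlinarith [hA e, mul_le_mul_of_nonneg_left h2 hlam]

theorem four_mul_le_of_sq_le {x y d lam ε : ℝ} (hε : 0 < ε) (hd : 0 ≤ d) (hy : 0 ≤ y)
    (h : x ^ 2 ≤ d * y) : 4 * lam * x ≤ ε * y + 4 * lam ^ 2 * d / ε := by
  refine le_trans (le_abs_self _) (abs_le_of_sq_le_sq ?_ (by positivity))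
  have e : (ε * y) * (4 * lam ^ 2 * d / ε) = 4 * lam ^ 2 * d * y := by field_simp
  nlinarith [sq_nonneg (ε * y - 4 * lam ^ 2 * d / ε), mul_le_mul_of_nonneg_left h (sq_nonneg lam)]

/-- The error of a point whose lasso objective exceeds that of the truth by at most `g`, under
restricted strong convexity. The term `g ^ 2` is the price of leaving the cone. -/
theorem lasso_error {p : ℕ} {H : Matrix (Fin p) (Fin p) ℝ} (hH : H.PosSemidef) {lam a ρ g : ℝ}
    (hlam : 0 < lam) (ha : 0 < a) (hρ : 0 ≤ ρ)
    (hrsc : ∀ u : Fin p → ℝ, a * (u ⬝ᵥ u) ≤ u ⬝ᵥ (H *ᵥ u) + ρ * (∑ k, |u k|) ^ 2)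
    {j : Fin p} {w u : Fin p → ℝ} (hj : u j = w j) {S : Finset (Fin p)}
    (hS : ∀ k, k ≠ j → k ∉ S → w k = 0) (hnoise : ∀ k, k ≠ j → |(H *ᵥ w) k| ≤ lam / 2)
    (hcard : 32 * ρ * S.card ≤ a / 2) (hobj : penObj H lam j u ≤ penObj H lam j w + g) :
    (∀ ε > 0, (u - w) ⬝ᵥ (H *ᵥ (u - w)) + lam * ∑ k, |(u - w) k| ≤
      ε * ((u - w) ⬝ᵥ (u - w)) + 4 * lam ^ 2 * S.card / ε + 2 * g) ∧
    a / 4 * ((u - w) ⬝ᵥ (u - w)) ≤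
      16 * lam ^ 2 * S.card / a + 2 * g + 8 * (ρ / lam ^ 2) * g ^ 2 := by
  have hb := penObj_sub_ge hH hlam.le hj hS hnoise
  set h := u - w
  set x := ∑ k ∈ S, |h k| with hx
  set y := h ⬝ᵥ h with hy
  set N := ∑ k, |h k| with hN
  have hx0 : 0 ≤ x := Finset.sum_nonneg fun _ _ => abs_nonneg _
  have hN0 : 0 ≤ N := Finset.sum_nonneg fun _ _ => abs_nonneg _
  have hy0 : 0 ≤ y := dot_self_nonneg h
  have hxy : x ^ 2 ≤ S.card * y := by
    calc x ^ 2 ≤ S.card * ∑ k ∈ S, |h k| ^ 2 := sq_sum_le_card_mul_sum_sq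
      _ ≤ S.card * y := by
        rw [hy, dot_self_eq]
        simp only [sq_abs]
        gcongr
        exact Finset.subset_univ S
  have hq0 := form_nonneg hH h
  have h1 : h ⬝ᵥ (H *ᵥ h) + lam * N ≤ 4 * lam * x + 2 * g := by linarith
  have hyoung : ∀ ε > 0, 4 * lam * x ≤ ε * y + 4 * lam ^ 2 * S.card / ε := fun ε hε =>
    four_mul_le_of_sq_le hε (by positivity) hy0 hxy
  refine ⟨fun ε hε => by linarith [hyoung ε hε], ?_⟩
  have h2 : N ≤ 4 * x + 2 * (g / lam) := by
    have : lam * N ≤ lam * (4 * x + 2 * (g / lam)) := by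
      have : lam * (4 * x + 2 * (g / lam)) = 4 * lam * x + 2 * g := by field_simp
      linarith
    exact le_of_mul_le_mul_left this hlam
  have h3 : N ^ 2 ≤ 32 * x ^ 2 + 8 * (g / lam) ^ 2 := by
    have : N ^ 2 ≤ (4 * x + 2 * (g / lam)) ^ 2 := pow_le_pow_left₀ hN0 h2 2
    nlinarith [sq_nonneg (4 * x - 2 * (g / lam))]
  have h4 : ρ * N ^ 2 ≤ a / 2 * y + 8 * (ρ / lam ^ 2) * g ^ 2 := by
    calc ρ * N ^ 2 ≤ ρ * (32 * (S.card * y) + 8 * (g / lam) ^ 2) := by gcongr; linarith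
      _ = (32 * ρ * S.card) * y + 8 * (ρ / lam ^ 2) * g ^ 2 := by field_simp
      _ ≤ _ := by gcongr
  have h5 := hyoung (a / 4) (by positivity)
  have e : 4 * lam ^ 2 * S.card / (a / 4) = 16 * lam ^ 2 * S.card / a := by field_simp; ring
  rw [e] at h5
  nlinarith [hrsc h, mul_nonneg hlam.le hN0]

/-- A lasso solution: its residual variance and its objective are close to those of the truth. -/
theorem lasso_solution {p : ℕ} {H : Matrix (Fin p) (Fin p) ℝ} (hH : H.PosSemidef) {lam a ρ : ℝ}
    (hlam : 0 < lam) (ha : 0 < a) (hρ : 0 ≤ ρ)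
    (hrsc : ∀ u : Fin p → ℝ, a * (u ⬝ᵥ u) ≤ u ⬝ᵥ (H *ᵥ u) + ρ * (∑ k, |u k|) ^ 2)
    {j : Fin p} {w u : Fin p → ℝ} (hj : u j = w j) {S : Finset (Fin p)}
    (hS : ∀ k, k ≠ j → k ∉ S → w k = 0) (hnoise : ∀ k, k ≠ j → |(H *ᵥ w) k| ≤ lam / 2)
    (hcard : 32 * ρ * S.card ≤ a / 2) (hobj : penObj H lam j u ≤ penObj H lam j w) :
    |u ⬝ᵥ (H *ᵥ u) - w ⬝ᵥ (H *ᵥ w)| ≤ 32 * lam ^ 2 * S.card / a ∧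
    penObj H lam j w - 16 * lam ^ 2 * S.card / a ≤ penObj H lam j u := by
  have hb := penObj_sub_ge hH hlam.le hj hS hnoise
  obtain ⟨h1, h2⟩ := lasso_error hH hlam ha hρ hrsc hj hS hnoise hcard (g := 0) (by simpa)
  have h3 := h1 (a / 4) (by positivity)
  have e : 4 * lam ^ 2 * S.card / (a / 4) = 16 * lam ^ 2 * S.card / a := by field_simp; ring
  have e' : 32 * lam ^ 2 * S.card / a = 2 * (16 * lam ^ 2 * S.card / a) := by ring
  rw [e] at h3
  rw [e']
  have hform : u ⬝ᵥ (H *ᵥ u) - w ⬝ᵥ (H *ᵥ w) =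
      2 * ((u - w) ⬝ᵥ (H *ᵥ w)) + (u - w) ⬝ᵥ (H *ᵥ (u - w)) := by
    have := form_add H w (u - w)
    rw [add_sub_cancel] at this
    rw [this, form_symm (transpose_eq_of_posSemidef hH) w (u - w)]; ring
  have hq0 := form_nonneg hH (u - w)
  have hcross : |(u - w) ⬝ᵥ (H *ᵥ w)| ≤ lam / 2 * ∑ k, |(u - w) k| := by
    rw [dotProduct, Finset.mul_sum]
    refine (Finset.abs_sum_le_sum_abs _ _).trans (Finset.sum_le_sum fun k _ => ?_)
    by_cases hk : k = j
    · subst hk; rw [Pi.sub_apply, hj, sub_self]; simp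
    · rw [abs_mul, mul_comm]
      exact mul_le_mul_of_nonneg_right (hnoise k hk) (abs_nonneg _)
  have hSN : ∑ k ∈ S, |(u - w) k| ≤ ∑ k, |(u - w) k| :=
    Finset.sum_le_sum_of_subset_of_nonneg (Finset.subset_univ S) fun _ _ _ => abs_nonneg _
  constructor
  · rw [hform, abs_le]
    obtain ⟨h4, h5⟩ := abs_le.1 hcross
    constructor <;> linarith
  · have hx0 : 0 ≤ ∑ k ∈ S, |(u - w) k| := Finset.sum_nonneg fun _ _ => abs_nonneg _
    have hxy : (∑ k ∈ S, |(u - w) k|) ^ 2 ≤ S.card * ((u - w) ⬝ᵥ (u - w)) := by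
      calc _ ≤ S.card * ∑ k ∈ S, |(u - w) k| ^ 2 := sq_sum_le_card_mul_sum_sq
        _ ≤ _ := by
          rw [dot_self_eq]
          simp only [sq_abs]
          gcongr
          exact Finset.subset_univ S
    have h5 := four_mul_le_of_sq_le (lam := lam) (ε := a / 4) (by positivity) (by positivity)
      (dot_self_nonneg _) hxy
    rw [e] at h5
    have h6 : 0 ≤ lam / 2 * ∑ k, |(u - w) k| :=
      mul_nonneg (by positivity) (Finset.sum_nonneg fun _ _ => abs_nonneg _)
    linarith

/-- Summation of the column errors when symmetry relates the entries `(j, k)` and `(k, j)`. The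
columns with gap `g j ≤ 1` are controlled directly by their gaps. There are few other columns; their
entries in the good rows are controlled by symmetry, and those in the bad rows by restricted strong
convexity for vectors with few nonzero entries. -/
theorem sum_error_le {p : ℕ} {H : Matrix (Fin p) (Fin p) ℝ} (hH : H.PosSemidef) {a A ρ C W : ℝ}
    (ha : 0 < a) (hA0 : 0 ≤ A) (hρ : 0 ≤ ρ) (hC : 0 ≤ C)
    (hA : ∀ u : Fin p → ℝ, u ⬝ᵥ (H *ᵥ u) ≤ A * (u ⬝ᵥ u))
    (hrsc : ∀ u : Fin p → ℝ, a * (u ⬝ᵥ u) ≤ u ⬝ᵥ (H *ᵥ u) + ρ * (∑ k, |u k|) ^ 2)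
    (h : Fin p → Fin p → ℝ) (g w : Fin p → ℝ) (z : Fin p → Fin p → ℝ)
    (hg : ∀ j, 0 ≤ g j) (hw : ∀ j, 0 ≤ w j) (hz : ∀ j k, 0 ≤ z j k)
    (hgW : ∑ j, g j ≤ W) (hwW : ∑ j, w j ≤ W) (hzW : ∑ j, ∑ k, z j k ≤ W)
    (h1 : ∀ j, h j ⬝ᵥ h j ≤ C * (w j + g j + g j ^ 2))
    (h2 : ∀ j, h j ⬝ᵥ (H *ᵥ h j) ≤ a / 8 * (h j ⬝ᵥ h j) + C * (w j + g j))
    (h3 : ∀ j k, h j k ^ 2 ≤ C * (h k j ^ 2 + z j k)) (hρW : ρ * W ≤ a / 2) :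
    ∑ j, h j ⬝ᵥ h j ≤
      (3 * C + (C * (3 * C + 1)) * (2 + 8 * A / a) + 16 * C / a) * W := by
  classical
  have hW : 0 ≤ W := (Finset.sum_nonneg fun j _ => hg j).trans hgW
  set B := Finset.univ.filter fun j => 1 < g j with hB
  have hcard : (B.card : ℝ) ≤ W := by
    calc (B.card : ℝ) = ∑ j ∈ B, 1 := by simp
      _ ≤ ∑ j ∈ B, g j := Finset.sum_le_sum fun j hj => (Finset.mem_filter.1 hj).2.le
      _ ≤ ∑ j, g j := Finset.sum_le_sum_of_subset_of_nonneg (Finset.subset_univ _)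
          fun j _ _ => hg j
      _ ≤ W := hgW
  have sub_le : ∀ (T : Finset (Fin p)) (f : Fin p → ℝ), (∀ j, 0 ≤ f j) →
      ∑ j ∈ T, f j ≤ ∑ j, f j := fun T f hf =>
    Finset.sum_le_sum_of_subset_of_nonneg (Finset.subset_univ _) fun j _ _ => hf j
  have hgood : ∑ j ∈ Bᶜ, h j ⬝ᵥ h j ≤ 3 * C * W := by
    calc ∑ j ∈ Bᶜ, h j ⬝ᵥ h j ≤ ∑ j ∈ Bᶜ, C * (w j + 2 * g j) := by
          refine Finset.sum_le_sum fun j hj => (h1 j).trans ?_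
          have : g j ≤ 1 := by simpa [hB] using hj
          exact mul_le_mul_of_nonneg_left (by nlinarith [hg j]) hC
      _ ≤ ∑ j, C * (w j + 2 * g j) := sub_le _ _ fun j =>
          mul_nonneg hC (by linarith [hw j, hg j])
      _ ≤ 3 * C * W := by
          rw [← Finset.mul_sum, Finset.sum_add_distrib, ← Finset.mul_sum]
          nlinarith
  set hb : Fin p → Fin p → ℝ := fun j k => if k ∈ B then h j k else 0 with hhb
  set hc : Fin p → Fin p → ℝ := fun j k => if k ∈ B then 0 else h j k with hhc
  have hsplit : ∀ j, h j = hb j + hc j := by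
    intro j; ext k; by_cases hk : k ∈ B <;> simp [hhb, hhc, hk]
  have hpyth : ∀ j, h j ⬝ᵥ h j = hb j ⬝ᵥ hb j + hc j ⬝ᵥ hc j := by
    intro j
    simp only [dot_self_eq, ← Finset.sum_add_distrib]
    refine Finset.sum_congr rfl fun k _ => ?_
    by_cases hk : k ∈ B <;> simp [hhb, hhc, hk]
  have hmix : ∑ j ∈ B, hc j ⬝ᵥ hc j ≤ C * (3 * C + 1) * W := by
    calc ∑ j ∈ B, hc j ⬝ᵥ hc j ≤ ∑ j, hc j ⬝ᵥ hc j := sub_le _ _ fun j => dot_self_nonneg _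
      _ = ∑ j, ∑ k ∈ Bᶜ, h j k ^ 2 := by
          refine Finset.sum_congr rfl fun j _ => ?_
          rw [dot_self_eq, ← Finset.sum_filter_add_sum_filter_not Finset.univ (· ∈ B),
            Finset.sum_eq_zero, zero_add]
          · refine Finset.sum_congr (by ext; simp) fun k hk => ?_
            have : k ∉ B := by simpa using hk
            simp [hhc, this]
          · intro k hk
            have : k ∈ B := by simpa using hk
            simp [hhc, this]
      _ ≤ ∑ j, ∑ k ∈ Bᶜ, C * (h k j ^ 2 + z j k) :=
          Finset.sum_le_sum fun j _ => Finset.sum_le_sum fun k _ => h3 j k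
      _ = C * (∑ k ∈ Bᶜ, h k ⬝ᵥ h k + ∑ j, ∑ k ∈ Bᶜ, z j k) := by
          simp only [← Finset.mul_sum, Finset.sum_add_distrib, dot_self_eq]
          rw [Finset.sum_comm]
      _ ≤ C * (3 * C * W + W) := by
          gcongr
          exact (Finset.sum_le_sum fun j _ => sub_le _ _ fun k => hz j k).trans hzW
      _ = _ := by ring
  have hbad : ∀ j, hb j ⬝ᵥ hb j ≤ (1 + 8 * A / a) * (hc j ⬝ᵥ hc j) + 8 * C / a * (w j + g j) := by
    intro j
    have hl1 : (∑ k, |hb j k|) ^ 2 ≤ B.card * (hb j ⬝ᵥ hb j) := by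
      have e : ∑ k, |hb j k| = ∑ k ∈ B, |h j k| := by
        rw [← Finset.univ_inter B, ← Finset.sum_ite_mem]
        refine Finset.sum_congr rfl fun k _ => ?_
        by_cases hk : k ∈ B <;> simp [hhb, hk]
      have e' : hb j ⬝ᵥ hb j = ∑ k ∈ B, |h j k| ^ 2 := by
        rw [← Finset.univ_inter B, ← Finset.sum_ite_mem, dot_self_eq]
        refine Finset.sum_congr rfl fun k _ => ?_
        by_cases hk : k ∈ B <;> simp [hhb, hk]
      rw [e, e']
      exact sq_sum_le_card_mul_sum_sq
    have hy0 := dot_self_nonneg (hb j)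
    have hl2 : ρ * (∑ k, |hb j k|) ^ 2 ≤ a / 2 * (hb j ⬝ᵥ hb j) := by
      calc _ ≤ ρ * (W * (hb j ⬝ᵥ hb j)) := by
            gcongr
            exact hl1.trans (by gcongr)
        _ = (ρ * W) * (hb j ⬝ᵥ hb j) := by ring
        _ ≤ _ := by gcongr
    have hq : hb j ⬝ᵥ (H *ᵥ hb j) ≤
        2 * (h j ⬝ᵥ (H *ᵥ h j)) + 2 * (hc j ⬝ᵥ (H *ᵥ hc j)) := by
      have e : hb j = h j + (-hc j) := by rw [hsplit j]; simp
      have := form_add_le hH (h j) (-hc j)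
      rw [← e] at this
      simpa [Matrix.mulVec_neg] using this
    have h5 := hA (hc j)
    have h6 := hrsc (hb j)
    have h7 := h2 j
    rw [hpyth j] at h7
    have h8 : a / 4 * (hb j ⬝ᵥ hb j) ≤
        (a / 4 + 2 * A) * (hc j ⬝ᵥ hc j) + 2 * C * (w j + g j) := by linarith
    have h9 : (1 + 8 * A / a) * (hc j ⬝ᵥ hc j) + 8 * C / a * (w j + g j) =
        (4 / a) * ((a / 4 + 2 * A) * (hc j ⬝ᵥ hc j) + 2 * C * (w j + g j)) := by
      field_simp; ring
    rw [h9]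
    calc hb j ⬝ᵥ hb j = (4 / a) * (a / 4 * (hb j ⬝ᵥ hb j)) := by field_simp
      _ ≤ _ := by gcongr
  have hbadsum : ∑ j ∈ B, h j ⬝ᵥ h j ≤
      (C * (3 * C + 1) * (2 + 8 * A / a) + 16 * C / a) * W := by
    calc ∑ j ∈ B, h j ⬝ᵥ h j
        ≤ ∑ j ∈ B, ((2 + 8 * A / a) * (hc j ⬝ᵥ hc j) + 8 * C / a * (w j + g j)) := by
          refine Finset.sum_le_sum fun j _ => ?_
          rw [hpyth j]; linarith [hbad j]
      _ = (2 + 8 * A / a) * ∑ j ∈ B, hc j ⬝ᵥ hc j + 8 * C / a * ∑ j ∈ B, (w j + g j) := by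
          rw [Finset.sum_add_distrib, ← Finset.mul_sum, ← Finset.mul_sum]
      _ ≤ (2 + 8 * A / a) * (C * (3 * C + 1) * W) + 8 * C / a * (W + W) := by
          gcongr
          refine (sub_le B (fun j => w j + g j) fun j => add_nonneg (hw j) (hg j)).trans ?_
          rw [Finset.sum_add_distrib]
          exact add_le_add hwW hgW
      _ = _ := by ring
  rw [← Finset.sum_compl_add_sum B]
  calc _ ≤ 3 * C * W + (C * (3 * C + 1) * (2 + 8 * A / a) + 16 * C / a) * W :=
        add_le_add hgood hbadsum
    _ = _ := by ring

/-! ### Deterministic analysis of the convex program -/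

theorem abs_div_sub_div_le {L x y x' y' ε : ℝ} (hL : 0 < L) (hy : 1 / L ≤ y)
    (hx' : |x'| ≤ L) (hy' : 1 / L ≤ y') (hyL' : y' ≤ L) (h1 : |x - x'| ≤ ε) (h2 : |y - y'| ≤ ε) :
    |x / y - x' / y'| ≤ 2 * L ^ 3 * ε := by
  have hL' : 0 < 1 / L := by positivity
  have hy0 : 0 < y := hL'.trans_le hy
  have hy0' : 0 < y' := hL'.trans_le hy'
  have hε : 0 ≤ ε := (abs_nonneg _).trans h1
  have e : x / y - x' / y' = ((x - x') * y' + x' * (y' - y)) * ((1 / y) * (1 / y')) := by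
    field_simp; ring
  have i1 : 1 / y ≤ L := by rw [one_div_le hy0 hL]; exact hy
  have i2 : 1 / y' ≤ L := by rw [one_div_le hy0' hL]; exact hy'
  have i3 : |(x - x') * y' + x' * (y' - y)| ≤ 2 * L * ε := by
    calc _ ≤ |(x - x') * y'| + |x' * (y' - y)| := abs_add_le _ _
      _ = |x - x'| * y' + |x'| * |y - y'| := by
          rw [abs_mul, abs_mul, abs_of_pos hy0', abs_sub_comm y']
      _ ≤ ε * L + L * ε := by gcongr
      _ = _ := by ring
  rw [e, abs_mul, abs_of_pos (a := 1 / y * (1 / y')) (by positivity)]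
  calc _ ≤ (2 * L * ε) * (L * L) := by gcongr
    _ = _ := by ring

theorem abs_sqrt_sub_sqrt_le {κ v t ε : ℝ} (hκ : 0 < κ) (ht : 1 / κ ≤ t) (hv : 0 ≤ v)
    (h : |v - t| ≤ ε) : |√v - √t| ≤ √(2 * κ) * ε := by
  have hκ' : 0 < 1 / κ := by positivity
  have ht0 : 0 < t := hκ'.trans_le ht
  have hs : 0 < √t := Real.sqrt_pos.2 ht0
  have e : (√v - √t) * (√v + √t) = v - t := by
    nlinarith [Real.sq_sqrt hv, Real.sq_sqrt ht0.le]
  have h1 : |√v - √t| * √t ≤ |v - t| := by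
    rw [← e, abs_mul, abs_of_pos (a := √v + √t) (by positivity)]
    gcongr
    linarith [Real.sqrt_nonneg v]
  have h2 : 1 ≤ √(2 * κ) * √t := by
    rw [← Real.sqrt_mul (by positivity)]
    refine Real.one_le_sqrt.2 ?_
    rw [div_le_iff₀ hκ] at ht
    nlinarith
  calc |√v - √t| = |√v - √t| * 1 := by ring
    _ ≤ |√v - √t| * (√(2 * κ) * √t) := by gcongr
    _ = √(2 * κ) * (|√v - √t| * √t) := by ring
    _ ≤ √(2 * κ) * ε := by gcongr; exact h1.trans h

/-- The residual vector `e_j - θ⋆_j = τ_j² Ω e_j` of the population regression of coordinate `j`. -/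
noncomputable def popVec {p : ℕ} (Ω : Matrix (Fin p) (Fin p) ℝ) (j : Fin p) : Fin p → ℝ :=
  fun k => Ω k j / Ω j j

/-- The neighbours of `j` in the graph of `Ω`: the `k ≠ j` with `Ω_jk ≠ 0`. -/
noncomputable def nbhd {p : ℕ} (Ω : Matrix (Fin p) (Fin p) ℝ) (j : Fin p) : Finset (Fin p) :=
  open Classical in Finset.univ.filter fun k => k ≠ j ∧ Ω j k ≠ 0

/-- The consequences of the eigenvalue bounds for the precision matrix that the deterministic part
of the argument uses. -/
structure PopBounds {p : ℕ} (Ω : Matrix (Fin p) (Fin p) ℝ) (κ : ℝ) : Prop where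
  posSemidef : Ω.PosSemidef
  le_diag : ∀ j, 1 / κ ≤ Ω j j
  diag_le : ∀ j, Ω j j ≤ κ
  abs_le : ∀ j k, |Ω j k| ≤ κ

/-- The properties of the sample covariance matrix `H` used in the analysis: bounded operator norm,
restricted strong convexity, and small noise and variance errors for the population regressions.
Here `r` stands for the rate `√(log p / n)`, and `c * r` for the penalty level. -/
structure SampleBounds {p : ℕ} (H Ω : Matrix (Fin p) (Fin p) ℝ) (A a b c C r : ℝ) : Prop where
  upper : ∀ u : Fin p → ℝ, u ⬝ᵥ (H *ᵥ u) ≤ A * (u ⬝ᵥ u)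
  rsc : ∀ u : Fin p → ℝ, a * (u ⬝ᵥ u) ≤ u ⬝ᵥ (H *ᵥ u) + b * r ^ 2 * (∑ k, |u k|) ^ 2
  noise : ∀ j k, k ≠ j → |(H *ᵥ popVec Ω j) k| ≤ c * r / 2
  var : ∀ j, |popVec Ω j ⬝ᵥ (H *ᵥ popVec Ω j) - 1 / Ω j j| ≤ C * r

section

variable {p : ℕ} {Ω : Matrix (Fin p) (Fin p) ℝ} {κ : ℝ}

theorem PopBounds.diag_pos (hΩ : PopBounds Ω κ) (hκ : 0 < κ) (j : Fin p) : 0 < Ω j j :=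
  (by positivity : 0 < 1 / κ).trans_le (hΩ.le_diag j)

theorem PopBounds.symm (hΩ : PopBounds Ω κ) (j k : Fin p) : Ω j k = Ω k j := by
  have := congrFun (congrFun (transpose_eq_of_posSemidef hΩ.posSemidef) k) j
  simpa using this

theorem popVec_self (hΩ : PopBounds Ω κ) (hκ : 0 < κ) (j : Fin p) : popVec Ω j j = 1 :=
  div_self (hΩ.diag_pos hκ j).ne'

theorem eq_zero_of_notMem_nbhd {j k : Fin p} (hk : k ≠ j) (h : k ∉ nbhd Ω j) : Ω j k = 0 := by
  simpa [nbhd, hk] using h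

theorem popVec_eq_zero (hΩ : PopBounds Ω κ) {j k : Fin p} (hk : k ≠ j) (h : k ∉ nbhd Ω j) :
    popVec Ω j k = 0 := by
  rw [popVec, hΩ.symm, eq_zero_of_notMem_nbhd hk h, zero_div]

theorem abs_popVec_le (hΩ : PopBounds Ω κ) (hκ : 0 < κ) (j k : Fin p) :
    |popVec Ω j k| ≤ κ ^ 2 := by
  rw [popVec, abs_div, abs_of_pos (hΩ.diag_pos hκ j), div_le_iff₀ (hΩ.diag_pos hκ j)]
  have h := hΩ.le_diag j
  rw [div_le_iff₀ hκ] at h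
  nlinarith [hΩ.abs_le k j]

theorem mem_nbhd_comm (hΩ : PopBounds Ω κ) {j k : Fin p} : k ∈ nbhd Ω j ↔ j ∈ nbhd Ω k := by
  simp only [nbhd, Finset.mem_filter, Finset.mem_univ, true_and, hΩ.symm j k]
  tauto

end

/-- The indicator of the edges of the graph of `Ω`. -/
noncomputable def edge {p : ℕ} (Ω : Matrix (Fin p) (Fin p) ℝ) (j k : Fin p) : ℝ :=
  open Classical in if k ∈ nbhd Ω j then 1 else 0

theorem edge_nonneg {p : ℕ} (Ω : Matrix (Fin p) (Fin p) ℝ) (j k : Fin p) : 0 ≤ edge Ω j k := by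
  rw [edge]; split_ifs <;> norm_num

theorem edge_sq {p : ℕ} (Ω : Matrix (Fin p) (Fin p) ℝ) (j k : Fin p) :
    edge Ω j k ^ 2 = edge Ω j k := by
  rw [edge]; split_ifs <;> norm_num

theorem edge_comm {p : ℕ} {Ω : Matrix (Fin p) (Fin p) ℝ} {κ : ℝ} (hΩ : PopBounds Ω κ)
    (j k : Fin p) : edge Ω j k = edge Ω k j := by
  simp only [edge, mem_nbhd_comm hΩ (j := j) (k := k)]

theorem sum_edge {p : ℕ} (Ω : Matrix (Fin p) (Fin p) ℝ) (j : Fin p) :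
    ∑ k, edge Ω j k = (nbhd Ω j).card := by
  classical
  simp [edge]

/-- Rescaling `Ω` to the estimated variances `σ_j²` gives a feasible point. Its residual vectors
differ from those of `Ω` by `τ_j τ_k Ω_kj (σ_j / σ_k - τ_j / τ_k)`. -/
theorem program_le {n p : ℕ} {X : Matrix (Fin n) (Fin p) ℝ} {Ω : Matrix (Fin p) (Fin p) ℝ}
    {κ A lam ε : ℝ} (hΩ : PopBounds Ω κ) (hκ : 0 < κ) (hlam : 0 ≤ lam) (hA0 : 0 ≤ A)
    (hA : ∀ u : Fin p → ℝ, u ⬝ᵥ (gram X *ᵥ u) ≤ A * (u ⬝ᵥ u))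
    (hnoise : ∀ j k, k ≠ j → |(gram X *ᵥ popVec Ω j) k| ≤ lam / 2)
    {v : Fin p → ℝ} (hv : ∀ j, 0 < v j)
    (hratio : ∀ j k, |√(v j) / √(v k) - √(1 / Ω j j) / √(1 / Ω k k)| ≤ ε)
    {W : Matrix (Fin p) (Fin p) ℝ} {θ : (j : Fin p) → {k : Fin p // k ≠ j} → ℝ}
    (hmin : IsMinOn (programObj X lam) (feasible v) (W, θ)) :
    ∑ j, penObj (gram X) lam j (regVec j (θ j)) ≤
      ∑ j, (penObj (gram X) lam j (popVec Ω j) +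
        (A / 2 * (κ ^ 2 * ε) ^ 2 + 3 / 2 * lam * (κ ^ 2 * ε)) * (nbhd Ω j).card) := by
  classical
  set σ : Fin p → ℝ := fun j => √(v j)
  set τ : Fin p → ℝ := fun j => √(1 / Ω j j)
  have hσ0 : ∀ j, 0 < σ j := fun j => Real.sqrt_pos.2 (hv j)
  have hσ2 : ∀ j, σ j ^ 2 = v j := fun j => Real.sq_sqrt (hv j).le
  have hd0 : ∀ j, 0 < Ω j j := fun j => hΩ.diag_pos hκ j
  have hτ0 : ∀ j, 0 < τ j := fun j => Real.sqrt_pos.2 (by have := hd0 j; positivity)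
  have hτ2 : ∀ j, τ j ^ 2 = 1 / Ω j j := fun j => Real.sq_sqrt (by have := hd0 j; positivity)
  have hτκ : ∀ j, τ j ^ 2 ≤ κ := fun j => by
    rw [hτ2, one_div_le (hd0 j) hκ]; exact hΩ.le_diag j
  set D : Matrix (Fin p) (Fin p) ℝ := Matrix.diagonal fun j => τ j / σ j with hD
  set W' : Matrix (Fin p) (Fin p) ℝ := D * Ω * D with hW'
  have hW'apply : ∀ k j, W' k j = τ k / σ k * Ω k j * (τ j / σ j) := by
    intro k j
    rw [hW', hD, Matrix.mul_diagonal, Matrix.diagonal_mul]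
  set e : Fin p → Fin p → ℝ := fun j k =>
    τ j * τ k * Ω k j * (σ j / σ k - τ j / τ k) with he
  have hu : ∀ j k, popVec Ω j k + e j k = v j * W' k j := by
    intro j k
    rw [popVec, he, hW'apply, ← hσ2, div_eq_mul_one_div, ← hτ2]
    have := (hσ0 j).ne'; have := (hσ0 k).ne'; have := (hτ0 j).ne'; have := (hτ0 k).ne'
    field_simp; ring
  set θ' : (j : Fin p) → {k : Fin p // k ≠ j} → ℝ :=
    fun j k => -(popVec Ω j + e j) k.1 with hθ'
  have hejj : ∀ j, e j j = 0 := by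
    intro j
    simp only [he]
    rw [div_self (hσ0 j).ne', div_self (hτ0 j).ne']; ring
  have hreg : ∀ j, regVec j (θ' j) = popVec Ω j + e j := fun j =>
    exists_regVec_eq (by rw [Pi.add_apply, popVec_self hΩ hκ, hejj, add_zero])
  have hfeas : (W', θ') ∈ feasible v := by
    refine ⟨fun j => ?_, fun j k => ?_, ?_⟩
    · have h := hu j j
      rw [popVec_self hΩ hκ, hejj, add_zero] at h
      rw [eq_div_iff (hv j).ne', mul_comm]; exact h.symm
    · have h := hu j k.1
      simp only [hθ', neg_neg, Pi.add_apply]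
      rw [h, mul_div_cancel_left₀ _ (hv j).ne']
    · have h := hΩ.posSemidef.conjTranspose_mul_mul_same D
      have hDt : Dᴴ = D := by
        rw [hD, Matrix.diagonal_conjTranspose]; rfl
      rwa [hDt] at h
  have h := hmin hfeas
  simp only [Set.mem_ofPred_eq, programObj, lassoObj_eq, hreg] at h
  refine h.trans (Finset.sum_le_sum fun j _ => ?_)
  have habs : ∀ k, |e j k| ≤ κ ^ 2 * ε * edge Ω j k := by
    intro k
    by_cases hk : k ∈ nbhd Ω j
    · have h1 : |τ j * τ k * Ω k j| ≤ κ ^ 2 := by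
        have hm : τ j * τ k ≤ κ := by nlinarith [hτκ j, hτκ k, sq_nonneg (τ j - τ k)]
        rw [abs_mul, abs_of_pos (mul_pos (hτ0 j) (hτ0 k)), sq]
        exact mul_le_mul hm (hΩ.abs_le k j) (abs_nonneg _) hκ.le
      simp only [edge, hk, if_true, mul_one, he]
      rw [abs_mul]
      exact mul_le_mul h1 (hratio j k) (abs_nonneg _) (by positivity)
    · have : e j k = 0 := by
        by_cases hkj : k = j
        · rw [hkj, hejj]
        · simp only [he]
          rw [hΩ.symm, eq_zero_of_notMem_nbhd hkj hk]; ring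
      simp [edge, hk, this]
  have hε : 0 ≤ ε := (abs_nonneg _).trans (hratio j j)
  have h1 := penObj_sub_le (gram_posSemidef X) hlam hA (hejj j) (hnoise j)
  have h2 : e j ⬝ᵥ e j ≤ (κ ^ 2 * ε) ^ 2 * (nbhd Ω j).card := by
    rw [dot_self_eq, ← sum_edge, Finset.mul_sum]
    refine Finset.sum_le_sum fun k _ => ?_
    rw [← sq_abs, ← edge_sq, ← mul_pow]
    exact pow_le_pow_left₀ (abs_nonneg _) (habs k) 2
  have h3 : ∑ k, |e j k| ≤ κ ^ 2 * ε * (nbhd Ω j).card := by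
    rw [← sum_edge, Finset.mul_sum]
    exact Finset.sum_le_sum fun k _ => habs k
  have h4 : A / 2 * (e j ⬝ᵥ e j) ≤ A / 2 * ((κ ^ 2 * ε) ^ 2 * (nbhd Ω j).card) := by gcongr
  have h5 : 3 / 2 * lam * ∑ k, |e j k| ≤ 3 / 2 * lam * (κ ^ 2 * ε * (nbhd Ω j).card) := by gcongr
  linarith

/-- The residual variances of the lasso regressions are consistent. -/
theorem variance_bound {p : ℕ} {H Ω : Matrix (Fin p) (Fin p) ℝ} {κ A a b c C r M : ℝ}
    (hH : H.PosSemidef) (hΩ : PopBounds Ω κ) (hκ : 0 < κ) (ha : 0 < a) (hb : 0 ≤ b) (hc : 0 < c)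
    (hr : 0 < r) (hS : SampleBounds H Ω A a b c C r)
    (hM : ∀ j, (nbhd Ω j).card * r ≤ M) (hbM : 32 * b * M * r ≤ a / 2) {j : Fin p}
    {u : Fin p → ℝ} (hu : u j = 1)
    (hmin : ∀ w : Fin p → ℝ, w j = 1 → penObj H (c * r) j u ≤ penObj H (c * r) j w) :
    |u ⬝ᵥ (H *ᵥ u) - 1 / Ω j j| ≤ (C + 32 * c ^ 2 * M / a) * r ∧
    ∀ w : Fin p → ℝ, w j = 1 →
      penObj H (c * r) j (popVec Ω j) - 16 * c ^ 2 / a * (r ^ 2 * (nbhd Ω j).card) ≤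
        penObj H (c * r) j w := by
  have hcard : 32 * (b * r ^ 2) * (nbhd Ω j).card ≤ a / 2 := by
    refine le_trans ?_ hbM
    nlinarith [mul_le_mul_of_nonneg_left (hM j) (by positivity : 0 ≤ 32 * b * r)]
  obtain ⟨h1, h2⟩ := lasso_solution hH (mul_pos hc hr) ha (by positivity : 0 ≤ b * r ^ 2) hS.rsc
    (by rw [hu, popVec_self hΩ hκ] : u j = popVec Ω j j)
    (fun k hk hk' => popVec_eq_zero hΩ hk hk') (hS.noise j) hcard
    (hmin _ (popVec_self hΩ hκ j))
  constructor
  · have h3 : 32 * (c * r) ^ 2 * (nbhd Ω j).card / a ≤ 32 * c ^ 2 * M / a * r := by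
      have : 32 * (c * r) ^ 2 * (nbhd Ω j).card / a =
          32 * c ^ 2 * r / a * ((nbhd Ω j).card * r) := by ring
      rw [this]
      calc _ ≤ 32 * c ^ 2 * r / a * M := by gcongr; exact hM j
        _ = _ := by ring
    have := abs_sub_le (u ⬝ᵥ (H *ᵥ u)) (popVec Ω j ⬝ᵥ (H *ᵥ popVec Ω j)) (1 / Ω j j)
    linarith [hS.var j]
  · intro w hw
    refine le_trans (le_of_eq ?_) (h2.trans (hmin w hw))
    ring

theorem sq_add_le {x y x' y' : ℝ} (hx : |x| ≤ x') (hy : |y| ≤ y') :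
    (x + y) ^ 2 ≤ 2 * x' ^ 2 + 2 * y' ^ 2 := by
  have h1 : x ^ 2 ≤ x' ^ 2 := by rw [← sq_abs x]; exact pow_le_pow_left₀ (abs_nonneg _) hx 2
  have h2 : y ^ 2 ≤ y' ^ 2 := by rw [← sq_abs y]; exact pow_le_pow_left₀ (abs_nonneg _) hy 2
  nlinarith [sq_nonneg (x - y)]

/-- Every lasso minimizer has residual variance close to `1 / Ω_jj`. -/
theorem meanSqResid_close {n p : ℕ} {X : Matrix (Fin n) (Fin p) ℝ} {Ω : Matrix (Fin p) (Fin p) ℝ}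
    {κ A a b c C r M : ℝ}
    (hΩ : PopBounds Ω κ) (hκ : 0 < κ) (ha : 0 < a) (hb : 0 ≤ b) (hc : 0 < c)
    (hr : 0 < r) (hS : SampleBounds (gram X) Ω A a b c C r)
    (hM : ∀ j, (nbhd Ω j).card * r ≤ M) (hbM : 32 * b * M * r ≤ a / 2) {j : Fin p}
    {θ : {k : Fin p // k ≠ j} → ℝ} (hθ : IsMinOn (lassoObj X (c * r) j) Set.univ θ) :
    |meanSqResid X j θ - 1 / Ω j j| ≤ (C + 32 * c ^ 2 * M / a) * r ∧
    ∀ w : Fin p → ℝ, w j = 1 →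
      penObj (gram X) (c * r) j (popVec Ω j) - 16 * c ^ 2 / a * (r ^ 2 * (nbhd Ω j).card) ≤
        penObj (gram X) (c * r) j w := by
  rw [meanSqResid_eq]
  refine variance_bound (gram_posSemidef X) hΩ hκ ha hb hc hr hS hM hbM (regVec_self j θ) ?_
  intro w hw
  have := hθ (Set.mem_univ fun k => -w k.1)
  simp only [Set.mem_ofPred_eq, lassoObj_eq] at this
  rwa [exists_regVec_eq hw] at this

theorem var_bounds {κ v t ε : ℝ} (hκ : 1 ≤ κ) (ht : 1 / κ ≤ t) (ht' : t ≤ κ)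
    (h : |v - t| ≤ ε) (hε : ε ≤ 1 / (2 * κ)) : 1 / (2 * κ) ≤ v ∧ v ≤ 2 * κ := by
  have e : 1 / κ = 2 * (1 / (2 * κ)) := by field_simp
  obtain ⟨h1, h2⟩ := abs_le.1 h
  have : 1 / (2 * κ) ≤ 1 := by rw [div_le_one (by positivity)]; linarith
  constructor <;> linarith

/-- The error `x` of an entry of a residual vector, `x = σ₁² y - τ₁² Ω'`, and the error `q` of the
corresponding partial correlation bound each other, up to a multiple of `Ω'`, which vanishes off the
edges. -/
theorem error_relations {x y q Ω' σ₁ σ₂ τ₁ τ₂ K β : ℝ} (hσ₁ : 0 < σ₁) (hσ₂ : 0 < σ₂)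
    (hτ₂ : 0 < τ₂) (h12 : σ₁ / σ₂ ≤ K) (h21 : σ₂ / σ₁ ≤ K)
    (hx : x = σ₁ ^ 2 * y - τ₁ ^ 2 * Ω') (hq : q = σ₁ * σ₂ * y - τ₁ * τ₂ * Ω')
    (hβ : |τ₁ * τ₂ * Ω' * (σ₁ / σ₂ - τ₁ / τ₂)| ≤ β) :
    x ^ 2 ≤ 2 * K ^ 2 * q ^ 2 + 2 * β ^ 2 ∧ q ^ 2 ≤ 2 * K ^ 2 * (x ^ 2 + β ^ 2) := by
  set B := τ₁ * τ₂ * Ω' * (σ₁ / σ₂ - τ₁ / τ₂) with hB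
  have e1 : x = σ₁ / σ₂ * q + B := by
    rw [hx, hq, hB]; field_simp; ring
  have e2 : q = σ₂ / σ₁ * x + (-(σ₂ / σ₁ * B)) := by
    rw [e1]; field_simp; ring
  have hK : 0 ≤ K := (by positivity : 0 ≤ σ₁ / σ₂).trans h12
  constructor
  · have := sq_add_le (x := σ₁ / σ₂ * q) (y := B) (x' := K * |q|) (y' := β) (by
      rw [abs_mul, abs_of_pos (by positivity : 0 < σ₁ / σ₂)]; gcongr) hβ
    rw [← e1, mul_pow, sq_abs] at this
    linarith
  · have := sq_add_le (x := σ₂ / σ₁ * x) (y := -(σ₂ / σ₁ * B)) (x' := K * |x|) (y' := K * β) (by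
      rw [abs_mul, abs_of_pos (by positivity : 0 < σ₂ / σ₁)]; gcongr) (by
      rw [abs_neg, abs_mul, abs_of_pos (by positivity : 0 < σ₂ / σ₁)]; gcongr)
    rw [← e2, mul_pow, mul_pow, sq_abs] at this
    linarith

theorem partialCorr_apply {p : ℕ} (v : Fin p → ℝ) (W : Matrix (Fin p) (Fin p) ℝ) (k j : Fin p) :
    partialCorr v W k j = -(√(v k) * W k j * √(v j)) := by
  rw [partialCorr, Matrix.neg_apply, Matrix.mul_diagonal, Matrix.diagonal_mul]

/-- The two error relations for all entries, with `|τ_j τ_k Ω_kj| ≤ κ²`. -/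
theorem error_relations_all {p : ℕ} {Ω W : Matrix (Fin p) (Fin p) ℝ} {κ ε : ℝ}
    (hΩ : PopBounds Ω κ) (hκ : 0 < κ) {σ τ : Fin p → ℝ} (hσ0 : ∀ j, 0 < σ j) (hτ0 : ∀ j, 0 < τ j)
    (hτ2 : ∀ j, τ j ^ 2 = 1 / Ω j j) (hσσ : ∀ j k, σ j / σ k ≤ 2 * κ)
    (hratio : ∀ j k, |σ j / σ k - τ j / τ k| ≤ ε) (j k : Fin p) :
    (σ j ^ 2 * W k j - popVec Ω j k) ^ 2 ≤
        8 * κ ^ 2 * (σ j * σ k * W k j - τ j * τ k * Ω k j) ^ 2 +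
          2 * (κ ^ 2 * ε) ^ 2 * edge Ω j k ∧
      (σ j * σ k * W k j - τ j * τ k * Ω k j) ^ 2 ≤
        8 * κ ^ 2 * ((σ j ^ 2 * W k j - popVec Ω j k) ^ 2 + (κ ^ 2 * ε) ^ 2 * edge Ω j k) := by
  have hτκ : ∀ j, τ j ^ 2 ≤ κ := fun j => by
    rw [hτ2, one_div_le (hΩ.diag_pos hκ j) hκ]; exact hΩ.le_diag j
  have hβ : |τ j * τ k * Ω k j * (σ j / σ k - τ j / τ k)| ≤ κ ^ 2 * ε * edge Ω j k := by
    by_cases hk : k ∈ nbhd Ω j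
    · have h1 : |τ j * τ k * Ω k j| ≤ κ ^ 2 := by
        have hm : τ j * τ k ≤ κ := by nlinarith [hτκ j, hτκ k, sq_nonneg (τ j - τ k)]
        rw [abs_mul, abs_of_pos (mul_pos (hτ0 j) (hτ0 k)), sq]
        exact mul_le_mul hm (hΩ.abs_le k j) (abs_nonneg _) hκ.le
      simp only [edge, hk, if_true, mul_one]
      rw [abs_mul]
      exact mul_le_mul h1 (hratio j k) (abs_nonneg _) (by positivity)
    · have : τ j * τ k * Ω k j * (σ j / σ k - τ j / τ k) = 0 := by
        by_cases hkj : k = j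
        · subst hkj
          rw [div_self (hσ0 k).ne', div_self (hτ0 k).ne']; ring
        · rw [hΩ.symm, eq_zero_of_notMem_nbhd hkj hk]; ring
      rw [this]; simp [edge, hk]
  obtain ⟨h1, h2⟩ := error_relations (x := σ j ^ 2 * W k j - popVec Ω j k)
    (q := σ j * σ k * W k j - τ j * τ k * Ω k j) (hσ0 j) (hσ0 k) (hτ0 k) (hσσ j k)
    (hσσ k j) (by rw [hτ2, popVec]; ring) rfl hβ
  rw [mul_pow (κ ^ 2 * ε), edge_sq] at h1 h2
  constructor <;> linarith

/-- The error of an entry of the precision matrix: besides the error of the residual vector, that of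
the variance, which matters only on the edges and on the diagonal. -/
theorem precision_entry_error {p : ℕ} {Ω : Matrix (Fin p) (Fin p) ℝ} {κ ε : ℝ}
    (hΩ : PopBounds Ω κ) (hκ : 0 < κ) {j k : Fin p} {v y : ℝ} (hv : 0 < v)
    (hvl : 1 / (2 * κ) ≤ v) (hvt : |v - 1 / Ω j j| ≤ ε) :
    (y - Ω k j) ^ 2 ≤ 8 * κ ^ 2 * (v * y - popVec Ω j k) ^ 2 +
      8 * κ ^ 8 * ε ^ 2 * (edge Ω j k + if k = j then 1 else 0) := by
  have hOj := hΩ.diag_pos hκ j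
  have hε : 0 ≤ ε := (abs_nonneg _).trans hvt
  have e : y - Ω k j = 1 / v * (v * y - popVec Ω j k) + popVec Ω j k * (1 / v - Ω j j) := by
    simp only [popVec]; field_simp; ring
  have hinv : 1 / v ≤ 2 * κ := by
    rw [one_div_le hv (by positivity)]; exact hvl
  have h1 : |1 / v * (v * y - popVec Ω j k)| ≤ 2 * κ * |v * y - popVec Ω j k| := by
    rw [abs_mul, abs_of_pos (by positivity : 0 < 1 / v)]; gcongr
  have h2 : |1 / v - Ω j j| ≤ 2 * κ ^ 2 * ε := by
    have : 1 / v - Ω j j = -(1 / v * Ω j j * (v - 1 / Ω j j)) := by field_simp; ring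
    rw [this, abs_neg, abs_mul, abs_of_pos (by positivity : 0 < 1 / v * Ω j j)]
    calc _ ≤ 2 * κ * κ * ε := by
          gcongr
          exact hΩ.diag_le j
      _ = _ := by ring
  have hind : 0 ≤ edge Ω j k + if k = j then 1 else 0 := by
    have := edge_nonneg Ω j k
    split_ifs <;> linarith
  have h3 : |popVec Ω j k * (1 / v - Ω j j)| ≤ 2 * κ ^ 4 * ε *
      √(edge Ω j k + if k = j then 1 else 0) := by
    by_cases hk : k = j ∨ k ∈ nbhd Ω j
    · have : 1 ≤ √(edge Ω j k + if k = j then 1 else 0) := by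
        refine Real.one_le_sqrt.2 ?_
        rcases hk with hk | hk
        · simp only [hk, if_true]; linarith [edge_nonneg Ω j j]
        · simp only [edge, hk, if_true]; split_ifs <;> norm_num
      rw [abs_mul]
      calc _ ≤ κ ^ 2 * (2 * κ ^ 2 * ε) := by
            gcongr; exact abs_popVec_le hΩ hκ j k
        _ = 2 * κ ^ 4 * ε * 1 := by ring
        _ ≤ _ := by gcongr
    · push Not at hk
      rw [popVec_eq_zero hΩ hk.1 hk.2]; simp only [zero_mul, abs_zero]; positivity
  rw [e]
  refine (sq_add_le h1 h3).trans (le_of_eq ?_)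
  rw [mul_pow (2 * κ), mul_pow (2 * κ ^ 4 * ε), Real.sq_sqrt hind, sq_abs]; ring

/-- The total error of the residual vectors `u_j`, in terms of the gaps `g_j` of their lasso
objectives, for errors that are symmetric up to constants and up to the edges of `Ω`. -/
theorem sum_column_error_le {p : ℕ} {H Ω : Matrix (Fin p) (Fin p) ℝ} {κ A a b c C r M E G : ℝ}
    (hH : H.PosSemidef) (hΩ : PopBounds Ω κ) (hκ : 0 < κ) (hM0 : 0 < M) (hA0 : 0 ≤ A)
    (ha : 0 < a) (hb : 0 ≤ b) (hc : 0 < c) (hr : 0 < r) (hG : 1 ≤ G)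
    (hS : SampleBounds H Ω A a b c C r)
    (hM : ∀ j, (nbhd Ω j).card * r ≤ M) (hbM : 32 * b * M * r ≤ a / 2)
    (hrp : r ^ 3 * p ≤ 8 * √r) (hr3 : √r * (16 * b * G * M) ≤ a)
    (u : Fin p → Fin p → ℝ) (hu : ∀ j, u j j = 1) (g : Fin p → ℝ) (hg0 : ∀ j, 0 ≤ g j)
    (hg : ∀ j, penObj H (c * r) j (u j) ≤ penObj H (c * r) j (popVec Ω j) + g j)
    (hgG : ∑ j, g j ≤ G * (r ^ 2 * ∑ j, ((nbhd Ω j).card : ℝ)))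
    (q : Fin p → Fin p → ℝ) (hq : ∀ j k, q j k = q k j)
    (hrel : ∀ j k, (u j k - popVec Ω j k) ^ 2 ≤
        8 * κ ^ 2 * q j k ^ 2 + 2 * E ^ 2 * (r ^ 2 * edge Ω j k) ∧
      q j k ^ 2 ≤ 8 * κ ^ 2 * ((u j k - popVec Ω j k) ^ 2 + E ^ 2 * (r ^ 2 * edge Ω j k)))
    {C₁ : ℝ} (hC₁ : C₁ = (4 / a * (16 * c ^ 2 / a + 2 + 8 * (b / c ^ 2))) +
      (32 * c ^ 2 / a + 2) + (64 * κ ^ 4 + 64 * κ ^ 4 * E ^ 2 + 2 * E ^ 2)) :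
    ∑ j, ∑ k, (u j k - popVec Ω j k) ^ 2 ≤
      (3 * C₁ + (C₁ * (3 * C₁ + 1)) * (2 + 8 * A / a) + 16 * C₁ / a) * G *
        (r ^ 2 * ∑ j, ((nbhd Ω j).card : ℝ)) := by
  have hC₁0 : 0 ≤ C₁ := by rw [hC₁]; positivity
  obtain ⟨h, hh⟩ : ∃ h : Fin p → Fin p → ℝ, ∀ j, h j = u j - popVec Ω j := ⟨_, fun _ => rfl⟩
  have hhk : ∀ j k, u j k - popVec Ω j k = h j k := fun j k => by rw [hh]; rfl
  simp only [hhk] at hrel ⊢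
  obtain ⟨d, hd⟩ : ∃ d : Fin p → ℝ, ∀ j, ((nbhd Ω j).card : ℝ) = d j := ⟨_, fun _ => rfl⟩
  have hd0 : ∀ j, 0 ≤ d j := fun j => by rw [← hd]; exact Nat.cast_nonneg _
  have hDnn : 0 ≤ ∑ j, d j := Finset.sum_nonneg fun j _ => hd0 j
  simp only [hd] at hgG hM ⊢
  have hsumedge : ∑ j, ∑ k, r ^ 2 * edge Ω j k = r ^ 2 * ∑ j, d j := by
    simp only [← Finset.mul_sum, sum_edge, hd]
  obtain ⟨V, hV⟩ : ∃ x, x = G * (r ^ 2 * ∑ j, d j) := ⟨_, rfl⟩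
  have hrd0 : 0 ≤ r ^ 2 * ∑ j, d j := mul_nonneg (sq_nonneg r) hDnn
  have hrdV : r ^ 2 * ∑ j, d j ≤ V := by rw [hV]; nlinarith
  -- `V` bounds the number of columns with large gap, so this makes restricted strong convexity
  -- effective on vectors supported on these columns.
  have hρV : b * r ^ 2 * V ≤ a / 2 := by
    have h1 : (∑ j, d j) * r ≤ p * M := by
      rw [Finset.sum_mul]
      calc ∑ j, d j * r ≤ ∑ _j : Fin p, M := Finset.sum_le_sum fun j _ => hM j
        _ = p * M := by simp
    calc b * r ^ 2 * V = b * G * r ^ 3 * ((∑ j, d j) * r) := by rw [hV]; ring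
      _ ≤ b * G * r ^ 3 * (p * M) := by gcongr
      _ = b * G * M * (r ^ 3 * p) := by ring
      _ ≤ b * G * M * (8 * √r) := by gcongr
      _ ≤ a / 2 := by linarith
  have hcol : ∀ j, (∀ ε > 0, h j ⬝ᵥ (H *ᵥ h j) + c * r * ∑ k, |h j k| ≤
      ε * (h j ⬝ᵥ h j) + 4 * (c * r) ^ 2 * d j / ε + 2 * g j) ∧
      a / 4 * (h j ⬝ᵥ h j) ≤
        16 * (c * r) ^ 2 * d j / a + 2 * g j + 8 * ((b * r ^ 2) / (c * r) ^ 2) * g j ^ 2 := by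
    intro j
    rw [← hd, hh]
    refine lasso_error hH (mul_pos hc hr) ha (by positivity) hS.rsc
      (by rw [popVec_self hΩ hκ, hu])
      (fun k hk hk' => popVec_eq_zero hΩ hk hk') (hS.noise j) ?_ ?_
    · rw [hd]
      refine le_trans ?_ hbM
      nlinarith [mul_le_mul_of_nonneg_left (hM j) (by positivity : 0 ≤ 32 * b * r)]
    · exact hg j
  simp only [← dot_self_eq]
  have := sum_error_le hH ha hA0 (by positivity : 0 ≤ b * r ^ 2) hC₁0 hS.upper
    hS.rsc h g (fun j => r ^ 2 * d j) (fun j k => r ^ 2 * edge Ω j k) hg0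
    (fun j => mul_nonneg (by positivity) (hd0 j))
    (fun j k => mul_nonneg (by positivity) (edge_nonneg Ω j k)) (hgG.trans_eq hV.symm)
    (by rw [← Finset.mul_sum]; exact hrdV) (by rw [hsumedge]; exact hrdV)
    ?_ ?_ ?_ hρV
  · refine this.trans (le_of_eq ?_)
    rw [hV]; ring
  · intro j
    have h1 := (hcol j).2
    have e1 : 16 * (c * r) ^ 2 * d j / a = 16 * c ^ 2 / a * (r ^ 2 * d j) := by ring
    have e2 : (b * r ^ 2) / (c * r) ^ 2 = b / c ^ 2 := by field_simp
    rw [e1, e2] at h1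
    have hw0 : 0 ≤ r ^ 2 * d j := mul_nonneg (by positivity) (hd0 j)
    have h2 : h j ⬝ᵥ h j ≤ 4 / a * (16 * c ^ 2 / a * (r ^ 2 * d j) + 2 * g j +
        8 * (b / c ^ 2) * g j ^ 2) := by
      calc h j ⬝ᵥ h j = 4 / a * (a / 4 * (h j ⬝ᵥ h j)) := by field_simp
        _ ≤ _ := by gcongr
    refine h2.trans ?_
    have h3 : 16 * c ^ 2 / a * (r ^ 2 * d j) + 2 * g j + 8 * (b / c ^ 2) * g j ^ 2 ≤
        (16 * c ^ 2 / a + 2 + 8 * (b / c ^ 2)) * (r ^ 2 * d j + g j + g j ^ 2) := by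
      have i1 : 0 ≤ 16 * c ^ 2 / a := by positivity
      have i2 : 0 ≤ 8 * (b / c ^ 2) := by positivity
      nlinarith [mul_nonneg i1 (hg0 j), mul_nonneg i1 (sq_nonneg (g j)), mul_nonneg i2 (hg0 j),
        mul_nonneg i2 hw0, sq_nonneg (g j)]
    calc _ ≤ 4 / a * ((16 * c ^ 2 / a + 2 + 8 * (b / c ^ 2)) * (r ^ 2 * d j + g j + g j ^ 2)) := by
          gcongr
      _ = 4 / a * (16 * c ^ 2 / a + 2 + 8 * (b / c ^ 2)) * (r ^ 2 * d j + g j + g j ^ 2) := by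
          ring
      _ ≤ C₁ * (r ^ 2 * d j + g j + g j ^ 2) := by
          refine mul_le_mul_of_nonneg_right ?_ (by have := hg0 j; positivity)
          have i3 : 0 ≤ (32 * c ^ 2 / a + 2) + (64 * κ ^ 4 + 64 * κ ^ 4 * E ^ 2 + 2 * E ^ 2) := by
            positivity
          linarith
  · intro j
    have h1 := (hcol j).1 (a / 8) (by positivity)
    have e1 : 4 * (c * r) ^ 2 * d j / (a / 8) = 32 * c ^ 2 / a * (r ^ 2 * d j) := by
      field_simp; ring
    rw [e1] at h1
    have hw0 : 0 ≤ r ^ 2 * d j := mul_nonneg (by positivity) (hd0 j)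
    have hn : 0 ≤ c * r * ∑ k, |h j k| :=
      mul_nonneg (by positivity) (Finset.sum_nonneg fun _ _ => abs_nonneg _)
    have h3 : 32 * c ^ 2 / a * (r ^ 2 * d j) + 2 * g j ≤
        (32 * c ^ 2 / a + 2) * (r ^ 2 * d j + g j) := by
      have i1 : 0 ≤ 32 * c ^ 2 / a := by positivity
      nlinarith [mul_nonneg i1 (hg0 j)]
    have h4 : (32 * c ^ 2 / a + 2) * (r ^ 2 * d j + g j) ≤ C₁ * (r ^ 2 * d j + g j) := by
      refine mul_le_mul_of_nonneg_right ?_ (add_nonneg hw0 (hg0 j))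
      rw [hC₁]
      have i1 : 0 ≤ 4 / a * (16 * c ^ 2 / a + 2 + 8 * (b / c ^ 2)) := by positivity
      have i2 : 0 ≤ 64 * κ ^ 4 + 64 * κ ^ 4 * E ^ 2 + 2 * E ^ 2 := by positivity
      linarith
    linarith
  · intro j k
    have h1 := (hrel j k).1
    have h2 := (hrel k j).2
    rw [hq j k] at h1
    rw [edge_comm hΩ k j] at h2
    have hz0 : 0 ≤ r ^ 2 * edge Ω j k := mul_nonneg (by positivity) (edge_nonneg Ω j k)
    have h3 : h j k ^ 2 ≤ (64 * κ ^ 4) * h k j ^ 2 +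
        (64 * κ ^ 4 * E ^ 2 + 2 * E ^ 2) * (r ^ 2 * edge Ω j k) := by
      have : 8 * κ ^ 2 * q k j ^ 2 ≤ 8 * κ ^ 2 *
          (8 * κ ^ 2 * (h k j ^ 2 + E ^ 2 * (r ^ 2 * edge Ω j k))) := by gcongr
      refine h1.trans ((add_le_add_left this _).trans (le_of_eq ?_))
      ring
    have i1 : 0 ≤ (4 / a * (16 * c ^ 2 / a + 2 + 8 * (b / c ^ 2))) + (32 * c ^ 2 / a + 2) := by
      positivity
    have i2 : 0 ≤ 64 * κ ^ 4 := by positivity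
    have i3 : 0 ≤ 64 * κ ^ 4 * E ^ 2 + 2 * E ^ 2 := by positivity
    have j1 : 64 * κ ^ 4 ≤ C₁ := by rw [hC₁]; linarith
    have j2 : 64 * κ ^ 4 * E ^ 2 + 2 * E ^ 2 ≤ C₁ := by rw [hC₁]; linarith
    calc _ ≤ _ := h3
      _ ≤ C₁ * h k j ^ 2 + C₁ * (r ^ 2 * edge Ω j k) := by gcongr
      _ = _ := by ring

set_option maxHeartbeats 400000 in
/-- The error bounds for joint partial regression on a sample that satisfies `SampleBounds`. -/
theorem deterministic_bounds {κ M A a b c C : ℝ} (hκ : 1 ≤ κ) (hM0 : 0 < M) (hA0 : 0 ≤ A)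
    (ha : 0 < a) (hb : 0 ≤ b) (hc : 0 < c) (hC : 0 ≤ C) :
    ∃ r₀ > 0, ∃ K > 0, ∀ (n p : ℕ) (X : Matrix (Fin n) (Fin p) ℝ) (Ω : Matrix (Fin p) (Fin p) ℝ)
      (r : ℝ), 0 < r → r ≤ r₀ → PopBounds Ω κ → SampleBounds (gram X) Ω A a b c C r →
      (∀ j, (nbhd Ω j).card * r ≤ M) → r ^ 3 * p ≤ 8 * √r →
      (∀ j θ, IsMinOn (lassoObj X (c * r) j) Set.univ θ → 0 < meanSqResid X j θ) ∧
      ∀ W Q, IsOutput X (c * r) W Q →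
        ∑ j, ∑ k, (Q k j - partialCorr (fun j => 1 / Ω j j) Ω k j) ^ 2 ≤
          K * (r ^ 2 * ∑ j, ((nbhd Ω j).card : ℝ)) ∧
        ∑ j, ∑ k, (W k j - Ω k j) ^ 2 ≤ K * (r ^ 2 * (∑ j, ((nbhd Ω j).card : ℝ) + p)) := by
  have hκ0 : 0 < κ := by linarith
  -- `Cv * r` bounds the errors of the variances and `Cρ * r` those of the ratios of the standard
  -- deviations.
  obtain ⟨Cv, hCv⟩ : ∃ x, x = C + 32 * c ^ 2 * M / a := ⟨_, rfl⟩
  have hCv0 : 0 ≤ Cv := by rw [hCv]; positivity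
  obtain ⟨Cρ, hCρ⟩ : ∃ x, x = 8 * κ ^ 2 * Cv := ⟨_, rfl⟩
  have hCρ0 : 0 ≤ Cρ := by rw [hCρ]; positivity
  -- `E * r` bounds the change of the edge entries when the truth is rescaled to the estimated
  -- variances.
  obtain ⟨E, hE⟩ : ∃ x, x = κ ^ 2 * Cρ := ⟨_, rfl⟩
  have hE0 : 0 ≤ E := by rw [hE]; positivity
  -- `G * (r² * ∑ j, d_j)` bounds the total gap.
  obtain ⟨G, hG⟩ : ∃ x, x = A / 2 * E ^ 2 + 3 / 2 * c * E + 16 * c ^ 2 / a + 1 := ⟨_, rfl⟩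
  have hG1 : 1 ≤ G := by
    rw [hG]
    linarith [show 0 ≤ A / 2 * E ^ 2 + 3 / 2 * c * E + 16 * c ^ 2 / a by positivity]
  obtain ⟨C₁, hC₁⟩ : ∃ x, x = (4 / a * (16 * c ^ 2 / a + 2 + 8 * (b / c ^ 2))) +
    (32 * c ^ 2 / a + 2) + (64 * κ ^ 4 + 64 * κ ^ 4 * E ^ 2 + 2 * E ^ 2) := ⟨_, rfl⟩
  have hC₁0 : 0 ≤ C₁ := by rw [hC₁]; positivity
  obtain ⟨K₁, hK₁⟩ : ∃ x, x =
    (3 * C₁ + (C₁ * (3 * C₁ + 1)) * (2 + 8 * A / a) + 16 * C₁ / a) * G := ⟨_, rfl⟩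
  have hK₁0 : 0 ≤ K₁ := by rw [hK₁]; positivity
  -- The three conditions on `r`: restricted strong convexity absorbs its own error term on the
  -- lasso cone, the variances are consistent, and restricted strong convexity is effective
  -- on vectors supported on the few columns with large gap.
  refine ⟨min (min (a / (64 * b * M + 1)) (1 / (2 * κ * (Cv + 1))))
    ((a / (16 * b * G * M + 1)) ^ 2),
    by positivity, 8 * κ ^ 2 * (K₁ + E ^ 2) + 8 * κ ^ 8 * Cv ^ 2 + 1, by positivity, ?_⟩
  intro n p X Ω r hr hr0 hΩ hS hM hrp
  have hr1 : r * (64 * b * M + 1) ≤ a :=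
    (le_div_iff₀ (by positivity)).1 (hr0.trans ((min_le_left _ _).trans (min_le_left _ _)))
  have hr2 : r * (2 * κ * (Cv + 1)) ≤ 1 :=
    (le_div_iff₀ (by positivity)).1 (hr0.trans ((min_le_left _ _).trans (min_le_right _ _)))
  have hr3 : √r * (16 * b * G * M + 1) ≤ a := by
    refine (le_div_iff₀ (by positivity)).1 ?_
    exact Real.sqrt_le_iff.2 ⟨by positivity, hr0.trans (min_le_right _ _)⟩
  have hbM : 32 * b * M * r ≤ a / 2 := by linarith
  have hCvr : Cv * r ≤ 1 / (2 * κ) := by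
    rw [le_div_iff₀ (by positivity)]; nlinarith [mul_pos hr hκ0]
  have hd0 : ∀ j, 0 < Ω j j := fun j => hΩ.diag_pos hκ0 j
  have ht1 : ∀ j, 1 / κ ≤ 1 / Ω j j := fun j => one_div_le_one_div_of_le (hd0 j) (hΩ.diag_le j)
  have ht2 : ∀ j, 1 / Ω j j ≤ κ := fun j => by
    rw [one_div_le (hd0 j) hκ0]; exact hΩ.le_diag j
  have hv : ∀ j θ, IsMinOn (lassoObj X (c * r) j) Set.univ θ →
      1 / (2 * κ) ≤ meanSqResid X j θ ∧ meanSqResid X j θ ≤ 2 * κ := by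
    intro j θ hθ
    have := (meanSqResid_close hΩ hκ0 ha hb hc hr hS hM hbM hθ).1
    rw [← hCv] at this
    exact var_bounds hκ (ht1 j) (ht2 j) this hCvr
  refine ⟨fun j θ hθ => (by positivity : 0 < 1 / (2 * κ)).trans_le (hv j θ hθ).1, ?_⟩
  rintro W Q ⟨θ₀, θ, v, hθ₀, hvdef, hvpos, hfeas, hmin, rfl⟩
  have hvl : ∀ j, 1 / (2 * κ) ≤ v j := fun j => by rw [hvdef]; exact (hv j _ (hθ₀ j)).1
  have hvu : ∀ j, v j ≤ 2 * κ := fun j => by rw [hvdef]; exact (hv j _ (hθ₀ j)).2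
  have hvt : ∀ j, |v j - 1 / Ω j j| ≤ Cv * r := fun j => by
    rw [hvdef, hCv]; exact (meanSqResid_close hΩ hκ0 ha hb hc hr hS hM hbM (hθ₀ j)).1
  set σ : Fin p → ℝ := fun j => √(v j)
  set τ : Fin p → ℝ := fun j => √(1 / Ω j j)
  have hσ0 : ∀ j, 0 < σ j := fun j => Real.sqrt_pos.2 (hvpos j)
  have hσ2 : ∀ j, σ j ^ 2 = v j := fun j => Real.sq_sqrt (hvpos j).le
  have hτ0 : ∀ j, 0 < τ j := fun j => Real.sqrt_pos.2 (by have := hd0 j; positivity)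
  have hτ2 : ∀ j, τ j ^ 2 = 1 / Ω j j := fun j => Real.sq_sqrt (by have := hd0 j; positivity)
  obtain ⟨L, hL⟩ : ∃ x, x = √(2 * κ) := ⟨_, rfl⟩
  have hL0 : 0 < L := by rw [hL]; positivity
  have hL2 : L ^ 2 = 2 * κ := by rw [hL]; exact Real.sq_sqrt (by positivity)
  have hsl : ∀ t : ℝ, 1 / (2 * κ) ≤ t → 1 / L ≤ √t := by
    intro t ht
    rw [hL, one_div, ← Real.sqrt_inv, ← one_div]
    exact Real.sqrt_le_sqrt ht
  have hsu : ∀ t : ℝ, t ≤ 2 * κ → √t ≤ L := by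
    intro t ht; rw [hL]; exact Real.sqrt_le_sqrt ht
  have hτl : ∀ j, 1 / L ≤ τ j := fun j => hsl _ (le_trans
    (one_div_le_one_div_of_le hκ0 (by linarith)) (ht1 j))
  have hτu : ∀ j, τ j ≤ L := fun j => hsu _ ((ht2 j).trans (by linarith))
  have hτ' : ∀ j, √(1 / Ω j j) = τ j := fun j => rfl
  have hσ' : ∀ j, √(v j) = σ j := fun j => rfl
  have hdiff : ∀ j, |σ j - τ j| ≤ L * (Cv * r) := fun j => by
    rw [hL]; exact abs_sqrt_sub_sqrt_le hκ0 (ht1 j) (hvpos j).le (hvt j)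
  have hratio : ∀ j k, |σ j / σ k - τ j / τ k| ≤ Cρ * r := by
    intro j k
    have := abs_div_sub_div_le hL0 (hsl _ (hvl k)) (by rw [abs_of_pos (hτ0 j)]; exact hτu j)
      (hτl k) (hτu k) (hdiff j) (hdiff k)
    refine this.trans (le_of_eq ?_)
    have : 2 * L ^ 3 * (L * (Cv * r)) = 2 * (L ^ 2) ^ 2 * (Cv * r) := by ring
    rw [this, hL2, hCρ]; ring
  have hσσ : ∀ j k, σ j / σ k ≤ 2 * κ := by
    intro j k
    rw [div_le_iff₀ (hσ0 k), ← hL2]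
    have h1 := hsu _ (hvu j)
    have h2 := hsl _ (hvl k)
    rw [div_le_iff₀ hL0] at h2
    calc σ j ≤ L := h1
      _ = L * 1 := by ring
      _ ≤ L * (σ k * L) := by gcongr
      _ = _ := by ring
  have hgapsum := program_le hΩ hκ0 (by positivity) hA0 hS.upper hS.noise hvpos hratio hmin
  clear_value σ τ
  have hD0 : 0 ≤ ∑ j, ((nbhd Ω j).card : ℝ) := Finset.sum_nonneg fun _ _ => Nat.cast_nonneg _
  have hrD0 : 0 ≤ r ^ 2 * ∑ j, ((nbhd Ω j).card : ℝ) := mul_nonneg (sq_nonneg r) hD0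
  have hUW : ∀ j k, regVec j (θ j) k = σ j ^ 2 * W k j := by
    intro j k
    rw [hσ2]
    by_cases hk : k = j
    · subst hk
      have : W k k = 1 / v k := hfeas.1 k
      rw [regVec_self, this, mul_one_div_cancel (hvpos k).ne']
    · have : W k j = -(θ j ⟨k, hk⟩) / v j := hfeas.2.1 j ⟨k, hk⟩
      rw [regVec_of_ne hk, this, mul_div_cancel₀ _ (hvpos j).ne']
  have hWsymm : ∀ j k, W j k = W k j := by
    intro j k
    have := congrFun (congrFun (transpose_eq_of_posSemidef hfeas.2.2) k) j
    simpa using this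
  have hrel := error_relations_all (W := W) hΩ hκ0 hσ0 hτ0 hτ2 hσσ hratio
  have e0 : (κ ^ 2 * (Cρ * r)) ^ 2 = E ^ 2 * r ^ 2 := by rw [hE]; ring
  simp only [e0, mul_assoc _ (r ^ 2) (edge _ _ _), ← mul_assoc (2 : ℝ) (E ^ 2)] at hrel
  -- A gap may be negative, but only by `O(r² d_j)`, since the truth almost minimizes the column
  -- objective.
  have hlow : ∀ j, 0 ≤ penObj (gram X) (c * r) j (regVec j (θ j)) -
      penObj (gram X) (c * r) j (popVec Ω j) + 16 * c ^ 2 / a * (r ^ 2 * (nbhd Ω j).card) := by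
    intro j
    have := (meanSqResid_close hΩ hκ0 ha hb hc hr hS hM hbM (hθ₀ j)).2 _ (regVec_self j (θ j))
    linarith
  have hmain := sum_column_error_le (gram_posSemidef X) hΩ hκ0 hM0 hA0 ha hb hc hr hG1 hS hM hbM hrp
    (by nlinarith [Real.sqrt_nonneg r]) (fun j => regVec j (θ j)) (fun j => regVec_self j (θ j))
    (fun j => penObj (gram X) (c * r) j (regVec j (θ j)) -
      penObj (gram X) (c * r) j (popVec Ω j) + 16 * c ^ 2 / a * (r ^ 2 * (nbhd Ω j).card)) hlow
    (fun j => by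
      have : 0 ≤ 16 * c ^ 2 / a * (r ^ 2 * (nbhd Ω j).card) :=
        mul_nonneg (by positivity) (mul_nonneg (sq_nonneg r) (Nat.cast_nonneg _))
      linarith)
    (by
      simp only [Finset.sum_add_distrib, Finset.sum_sub_distrib, ← Finset.mul_sum] at hgapsum ⊢
      have e2 : (A / 2 * (κ ^ 2 * (Cρ * r)) ^ 2 + 3 / 2 * (c * r) * (κ ^ 2 * (Cρ * r))) =
        (A / 2 * E ^ 2 + 3 / 2 * c * E) * r ^ 2 := by rw [hE]; ring
      rw [e2] at hgapsum
      rw [hG]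
      linarith)
    (fun j k => σ j * σ k * W k j - τ j * τ k * Ω k j)
    (fun j k => by rw [hWsymm j k, hΩ.symm j k]; ring)
    (fun j k => by simpa only [hUW] using hrel j k) hC₁
  rw [← hK₁] at hmain
  simp only [hUW] at hmain
  constructor
  · calc ∑ j, ∑ k, (partialCorr v W k j - partialCorr (fun j => 1 / Ω j j) Ω k j) ^ 2
        = ∑ j, ∑ k, (σ j * σ k * W k j - τ j * τ k * Ω k j) ^ 2 := by
          refine Finset.sum_congr rfl fun j _ => Finset.sum_congr rfl fun k _ => ?_
          rw [partialCorr_apply, partialCorr_apply]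
          simp only [hσ', hτ']; ring
      _ ≤ ∑ j, ∑ k, 8 * κ ^ 2 * ((σ j ^ 2 * W k j - popVec Ω j k) ^ 2 +
            E ^ 2 * (r ^ 2 * edge Ω j k)) :=
          Finset.sum_le_sum fun j _ => Finset.sum_le_sum fun k _ => (hrel j k).2
      _ = 8 * κ ^ 2 * (∑ j, ∑ k, (σ j ^ 2 * W k j - popVec Ω j k) ^ 2 +
            E ^ 2 * (r ^ 2 * ∑ j, ((nbhd Ω j).card : ℝ))) := by
          simp only [← sum_edge, Finset.mul_sum, mul_add, Finset.sum_add_distrib]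
      _ ≤ 8 * κ ^ 2 * (K₁ * (r ^ 2 * ∑ j, ((nbhd Ω j).card : ℝ)) +
            E ^ 2 * (r ^ 2 * ∑ j, ((nbhd Ω j).card : ℝ))) := by gcongr
      _ = (8 * κ ^ 2 * (K₁ + E ^ 2)) * (r ^ 2 * ∑ j, ((nbhd Ω j).card : ℝ)) := by ring
      _ ≤ _ := mul_le_mul_of_nonneg_right
          (by linarith [show 0 ≤ 8 * κ ^ 8 * Cv ^ 2 by positivity]) hrD0
  · have hentry : ∀ j k, (W k j - Ω k j) ^ 2 ≤ 8 * κ ^ 2 * (σ j ^ 2 * W k j - popVec Ω j k) ^ 2 +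
        8 * κ ^ 8 * (Cv * r) ^ 2 * (edge Ω j k + if k = j then 1 else 0) := by
      intro j k
      rw [hσ2]
      exact precision_entry_error hΩ hκ0 (hvpos j) (hvl j) (hvt j)
    calc ∑ j, ∑ k, (W k j - Ω k j) ^ 2
        ≤ ∑ j, ∑ k, (8 * κ ^ 2 * (σ j ^ 2 * W k j - popVec Ω j k) ^ 2 +
          8 * κ ^ 8 * (Cv * r) ^ 2 * (edge Ω j k + if k = j then 1 else 0)) :=
          Finset.sum_le_sum fun j _ => Finset.sum_le_sum fun k _ => hentry j k
      _ = 8 * κ ^ 2 * ∑ j, ∑ k, (σ j ^ 2 * W k j - popVec Ω j k) ^ 2 +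
          8 * κ ^ 8 * (Cv * r) ^ 2 * (∑ j, ((nbhd Ω j).card : ℝ) + p) := by
          have : ∑ j, ∑ k, (edge Ω j k + if k = j then 1 else 0) =
              ∑ j, ((nbhd Ω j).card : ℝ) + p := by
            simp [Finset.sum_add_distrib, sum_edge]
          rw [← this]
          simp only [Finset.mul_sum, ← Finset.sum_add_distrib]
      _ ≤ 8 * κ ^ 2 * (K₁ * (r ^ 2 * (∑ j, ((nbhd Ω j).card : ℝ) + p))) +
          8 * κ ^ 8 * (Cv * r) ^ 2 * (∑ j, ((nbhd Ω j).card : ℝ) + p) := by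
          gcongr
          refine hmain.trans ?_
          gcongr
          exact le_add_of_nonneg_right (Nat.cast_nonneg p)
      _ = (8 * κ ^ 2 * K₁ + 8 * κ ^ 8 * Cv ^ 2) * (r ^ 2 * (∑ j, ((nbhd Ω j).card : ℝ) + p)) := by
          ring
      _ ≤ _ := mul_le_mul_of_nonneg_right
          (by linarith [show 0 ≤ 8 * κ ^ 2 * E ^ 2 by positivity])
          (mul_nonneg (sq_nonneg r) (add_nonneg hD0 (Nat.cast_nonneg p)))

/-! ### Concentration of the sample covariance matrix -/

/-- The exponential Markov inequality for a sum over an i.i.d. sample. -/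
theorem measure_le_sum_le {E S : Type*} [MeasurableSpace E] [MeasurableSpace S] {μ : Measure E}
    {P : Measure S} [IsProbabilityMeasure P] {n : ℕ} {X : Fin n → S → E} (hX : iIndepFun X P)
    (hlaw : ∀ i, HasLaw (X i) μ P) {f : E → ℝ} (hf : Measurable f) {B : ℝ} (hB : 0 ≤ B)
    (hfB : ∫⁻ x, ENNReal.ofReal (Real.exp (f x)) ∂μ ≤ ENNReal.ofReal B) (t : ℝ) :
    P {ω | t ≤ ∑ i, f (X i ω)} ≤ ENNReal.ofReal (Real.exp (-t) * B ^ n) := by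
  set G : E → ℝ≥0∞ := fun x => ENNReal.ofReal (Real.exp (f x)) with hG
  have hGm : Measurable G := by fun_prop
  have hXm : ∀ i, AEMeasurable (X i) P := fun i => (hlaw i).aemeasurable
  set Y : Fin n → S → E := fun i => (hXm i).mk (X i) with hY
  have hYm : ∀ i, Measurable (Y i) := fun i => (hXm i).measurable_mk
  have hXY : ∀ i, X i =ᵐ[P] Y i := fun i => (hXm i).ae_eq_mk
  have hint : ∫⁻ ω, ∏ i, G (Y i ω) ∂P ≤ ENNReal.ofReal (B ^ n) := by
    have := lintegral_prod_eq_prod_lintegral_of_indepFun Finset.univ (fun i => G ∘ Y i)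
      ((hX.congr hXY).comp (fun _ => G) fun _ => hGm) (fun i => hGm.comp (hYm i))
    simp only [Function.comp] at this
    rw [this, ENNReal.ofReal_pow hB]
    calc ∏ i, ∫⁻ ω, G (Y i ω) ∂P ≤ ∏ _i : Fin n, ENNReal.ofReal B := by
          refine Finset.prod_le_prod' fun i _ => ?_
          have e : ∫⁻ ω, G (Y i ω) ∂P = ∫⁻ ω, G (X i ω) ∂P :=
            lintegral_congr_ae ((hXY i).symm.fun_comp G)
          rw [e, (hlaw i).lintegral_comp hGm.aemeasurable]
          exact hfB
      _ = _ := by simp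
  have hprod : ∀ y : Fin n → E,
      ∏ i, G (y i) = ENNReal.ofReal (Real.exp (∑ i, f (y i))) := by
    intro y
    rw [Real.exp_sum, ENNReal.ofReal_prod_of_nonneg fun i _ => (Real.exp_pos _).le]
  have hmk := mul_meas_ge_le_lintegral₀ (μ := P) (f := fun ω => ∏ i, G (Y i ω))
    (by fun_prop) (ENNReal.ofReal (Real.exp t))
  have hset : P {ω | t ≤ ∑ i, f (X i ω)} ≤
      P {ω | ENNReal.ofReal (Real.exp t) ≤ ∏ i, G (Y i ω)} := by
    refine measure_mono_ae ?_
    filter_upwards [ae_all_iff.2 hXY] with ω hω h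
    change ENNReal.ofReal (Real.exp t) ≤ ∏ i, G (Y i ω)
    rw [hprod]
    refine ENNReal.ofReal_le_ofReal (Real.exp_le_exp.2 ?_)
    have h' : t ≤ ∑ i, f (X i ω) := h
    simpa only [hω] using h'
  refine hset.trans ?_
  have h1 : ENNReal.ofReal (Real.exp t) *
      P {ω | ENNReal.ofReal (Real.exp t) ≤ ∏ i, G (Y i ω)} ≤ ENNReal.ofReal (B ^ n) :=
    hmk.trans hint
  have h2 : ENNReal.ofReal (Real.exp (-t)) * ENNReal.ofReal (Real.exp t) = 1 := by
    rw [← ENNReal.ofReal_mul (Real.exp_pos _).le, ← Real.exp_add]; simp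
  calc P {ω | ENNReal.ofReal (Real.exp t) ≤ ∏ i, G (Y i ω)}
      = ENNReal.ofReal (Real.exp (-t)) * (ENNReal.ofReal (Real.exp t) *
        P {ω | ENNReal.ofReal (Real.exp t) ≤ ∏ i, G (Y i ω)}) := by
        rw [← mul_assoc, h2, one_mul]
    _ ≤ ENNReal.ofReal (Real.exp (-t)) * ENNReal.ofReal (B ^ n) := by gcongr
    _ = _ := by rw [← ENNReal.ofReal_mul (Real.exp_pos _).le]

theorem exp_le_quadratic (x : ℝ) : Real.exp x ≤ 1 + x + x ^ 2 * Real.exp |x| := by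
  have h := Complex.norm_exp_sub_sum_le_norm_mul_exp (x : ℂ) 2
  have e : Complex.exp (x : ℂ) - ∑ m ∈ Finset.range 2, (x : ℂ) ^ m / (m.factorial : ℂ) =
      ((Real.exp x - (1 + x) : ℝ) : ℂ) := by
    simp [Finset.sum_range_succ]
  rw [e, Complex.norm_real, Complex.norm_real, Real.norm_eq_abs, Real.norm_eq_abs, sq_abs] at h
  linarith [le_abs_self (Real.exp x - (1 + x))]

theorem integrable_of_lintegral_exp_le {E : Type*} [MeasurableSpace E] {μ : Measure E}
    {f : E → ℝ} (hf : Measurable f) (h : ∫⁻ x, ENNReal.ofReal (Real.exp (f x)) ∂μ ≤ 2) :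
    Integrable (fun x => Real.exp (f x)) μ ∧ ∫ x, Real.exp (f x) ∂μ ≤ 2 := by
  have hi : Integrable (fun x => Real.exp (f x)) μ :=
    (lintegral_ofReal_ne_top_iff_integrable (by fun_prop)
      (Filter.Eventually.of_forall fun x => (Real.exp_pos _).le)).1 (h.trans_lt (by simp)).ne
  refine ⟨hi, ?_⟩
  rw [← ofReal_integral_eq_lintegral_ofReal hi
    (Filter.Eventually.of_forall fun x => (Real.exp_pos _).le)] at h
  have := (ENNReal.ofReal_le_iff_le_toReal (by simp)).1 h
  simpa using this

/-- The moment generating function of a centred sub-exponential variable. -/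
theorem lintegral_exp_centered_le {E : Type*} [MeasurableSpace E] {μ : Measure E}
    [IsProbabilityMeasure μ] {Y : E → ℝ} (hY : Measurable Y) {L θ : ℝ} (hL : 0 < L)
    (h : ∫⁻ x, ENNReal.ofReal (Real.exp (|Y x| / L)) ∂μ ≤ 2) (hθ : |θ| ≤ 1 / (2 * L)) :
    Integrable Y μ ∧ ∫⁻ x, ENNReal.ofReal (Real.exp (θ * (Y x - ∫ y, Y y ∂μ))) ∂μ ≤
      ENNReal.ofReal (Real.exp (16 * L ^ 2 * θ ^ 2)) := by
  obtain ⟨hi, hi2⟩ := integrable_of_lintegral_exp_le (f := fun x => |Y x| / L) (by fun_prop) h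
  have hYi : Integrable Y μ := by
    refine (hi.const_mul L).mono' hY.aestronglyMeasurable
      (Filter.Eventually.of_forall fun x => ?_)
    have := Real.add_one_le_exp (|Y x| / L)
    rw [Real.norm_eq_abs]
    calc |Y x| = L * (|Y x| / L) := by field_simp
      _ ≤ L * Real.exp (|Y x| / L) := by gcongr; linarith
  refine ⟨hYi, ?_⟩
  set m := ∫ y, Y y ∂μ with hm
  have hpt : ∀ x, Real.exp (θ * (Y x - m)) ≤ Real.exp (-(θ * m)) *
      (1 + θ * Y x + 8 * L ^ 2 * θ ^ 2 * Real.exp (|Y x| / L)) := by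
    intro x
    have e : θ * (Y x - m) = -(θ * m) + θ * Y x := by ring
    rw [e, Real.exp_add]
    refine mul_le_mul_of_nonneg_left ((exp_le_quadratic _).trans ?_) (Real.exp_pos _).le
    obtain ⟨y, hy⟩ : ∃ y, y = |Y x| / L := ⟨_, rfl⟩
    have hy0 : 0 ≤ y := by rw [hy]; positivity
    have hYy : |Y x| = L * y := by rw [hy]; field_simp
    have h1 : |θ * Y x| ≤ y / 2 := by
      rw [abs_mul, hYy]
      calc |θ| * (L * y) ≤ 1 / (2 * L) * (L * y) := by gcongr
        _ = y / 2 := by field_simp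
    have h2 : y ^ 2 ≤ 8 * Real.exp (y / 2) := by
      have := Real.quadratic_le_exp_of_nonneg (by positivity : 0 ≤ y / 2)
      nlinarith
    have h3 : (θ * Y x) ^ 2 = θ ^ 2 * L ^ 2 * y ^ 2 := by
      rw [mul_pow, ← sq_abs (Y x), hYy]; ring
    rw [← hy, h3]
    have h4 : Real.exp y = Real.exp (y / 2) * Real.exp (y / 2) := by
      rw [← Real.exp_add]; ring_nf
    have h5 : θ ^ 2 * L ^ 2 * y ^ 2 * Real.exp |θ * Y x| ≤
        θ ^ 2 * L ^ 2 * (8 * Real.exp (y / 2)) * Real.exp (y / 2) := by gcongr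
    rw [h4]
    linarith
  have hint : Integrable (fun x => Real.exp (-(θ * m)) *
      (1 + θ * Y x + 8 * L ^ 2 * θ ^ 2 * Real.exp (|Y x| / L))) μ :=
    (((integrable_const 1).add (hYi.const_mul θ)).add (hi.const_mul _)).const_mul _
  calc _ ≤ ∫⁻ x, ENNReal.ofReal (Real.exp (-(θ * m)) *
        (1 + θ * Y x + 8 * L ^ 2 * θ ^ 2 * Real.exp (|Y x| / L))) ∂μ :=
        lintegral_mono fun x => ENNReal.ofReal_le_ofReal (hpt x)
    _ = ENNReal.ofReal (∫ x, Real.exp (-(θ * m)) *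
        (1 + θ * Y x + 8 * L ^ 2 * θ ^ 2 * Real.exp (|Y x| / L)) ∂μ) :=
        (ofReal_integral_eq_lintegral_ofReal hint (Filter.Eventually.of_forall fun x =>
          (Real.exp_pos _).le.trans (hpt x))).symm
    _ ≤ _ := by
        refine ENNReal.ofReal_le_ofReal ?_
        have e : ∫ x, Real.exp (-(θ * m)) *
            (1 + θ * Y x + 8 * L ^ 2 * θ ^ 2 * Real.exp (|Y x| / L)) ∂μ =
            Real.exp (-(θ * m)) * (1 + θ * m +
              8 * L ^ 2 * θ ^ 2 * ∫ x, Real.exp (|Y x| / L) ∂μ) := by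
          have i1 : Integrable (fun x => 1 + θ * Y x) μ :=
            (integrable_const 1).add (hYi.const_mul θ)
          rw [integral_const_mul, integral_add i1 (hi.const_mul _),
            integral_add (integrable_const 1) (hYi.const_mul θ), integral_const_mul,
            integral_const_mul]
          simp [hm]
        rw [e]
        have h1 : 1 + θ * m + 8 * L ^ 2 * θ ^ 2 * ∫ x, Real.exp (|Y x| / L) ∂μ ≤
            Real.exp (θ * m + 16 * L ^ 2 * θ ^ 2) := by
          have := Real.add_one_le_exp (θ * m + 16 * L ^ 2 * θ ^ 2)
          have h2 : 8 * L ^ 2 * θ ^ 2 * ∫ x, Real.exp (|Y x| / L) ∂μ ≤ 8 * L ^ 2 * θ ^ 2 * 2 := by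
            gcongr
          linarith
        calc _ ≤ Real.exp (-(θ * m)) * Real.exp (θ * m + 16 * L ^ 2 * θ ^ 2) := by gcongr
          _ = _ := by rw [← Real.exp_add]; ring_nf

/-- Bernstein's inequality for the mean of an i.i.d. sample of a sub-exponential variable. -/
theorem bernstein {E S : Type*} [MeasurableSpace E] [MeasurableSpace S] {μ : Measure E}
    [IsProbabilityMeasure μ] {P : Measure S} [IsProbabilityMeasure P] {n : ℕ} (hn : 1 ≤ n)
    {X : Fin n → S → E} (hX : iIndepFun X P) (hlaw : ∀ i, HasLaw (X i) μ P) {Y : E → ℝ}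
    (hY : Measurable Y) {L x : ℝ} (hL : 0 < L)
    (h : ∫⁻ x, ENNReal.ofReal (Real.exp (|Y x| / L)) ∂μ ≤ 2) (hx : 0 ≤ x) (hxL : x ≤ 16 * L) :
    P {ω | x ≤ |(1 / (n : ℝ)) * ∑ i, Y (X i ω) - ∫ y, Y y ∂μ|} ≤
      ENNReal.ofReal (2 * Real.exp (-(n * x ^ 2 / (64 * L ^ 2)))) := by
  set m := ∫ y, Y y ∂μ with hm
  set θ := x / (32 * L ^ 2) with hθ
  have hθ0 : 0 ≤ θ := by positivity
  have hθL : θ ≤ 1 / (2 * L) := by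
    rw [hθ, div_le_div_iff₀ (by positivity) (by positivity)]; nlinarith
  have hn' : (0 : ℝ) < n := by exact_mod_cast hn
  have tail : ∀ s : ℝ, |s| = θ → P {ω | n * (θ * x) ≤ ∑ i, s * (Y (X i ω) - m)} ≤
      ENNReal.ofReal (Real.exp (-(n * x ^ 2 / (64 * L ^ 2)))) := by
    intro s hs
    have h1 := (lintegral_exp_centered_le hY hL h (θ := s) (by rw [hs]; exact hθL)).2
    refine (measure_le_sum_le hX hlaw (f := fun y => s * (Y y - m)) (by fun_prop)
      (Real.exp_pos _).le h1 (n * (θ * x))).trans (le_of_eq ?_)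
    rw [← Real.exp_nat_mul, ← Real.exp_add, ← sq_abs s, hs, hθ]
    congr 2
    field_simp
    ring
  have hsum : ∀ (s : ℝ) ω, ∑ i, s * (Y (X i ω) - m) =
      n * (s * ((1 / (n : ℝ)) * ∑ i, Y (X i ω) - m)) := by
    intro s ω
    rw [← Finset.mul_sum, Finset.sum_sub_distrib]
    simp
    field_simp
  have hsub : {ω | x ≤ |(1 / (n : ℝ)) * ∑ i, Y (X i ω) - m|} ⊆
      {ω | n * (θ * x) ≤ ∑ i, θ * (Y (X i ω) - m)} ∪
      {ω | n * (θ * x) ≤ ∑ i, -θ * (Y (X i ω) - m)} := by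
    intro ω hω
    have hω' : x ≤ |(1 / (n : ℝ)) * ∑ i, Y (X i ω) - m| := hω
    rcases le_abs.1 hω' with h1 | h1
    · left
      change n * (θ * x) ≤ _
      rw [hsum]; gcongr
    · right
      change n * (θ * x) ≤ _
      rw [hsum]
      have : θ * x ≤ -θ * ((1 / (n : ℝ)) * ∑ i, Y (X i ω) - m) := by nlinarith
      gcongr
  refine (measure_mono hsub).trans ((measure_union_le _ _).trans ?_)
  rw [two_mul, ENNReal.ofReal_add (Real.exp_pos _).le (Real.exp_pos _).le]
  exact add_le_add (tail θ (abs_of_nonneg hθ0)) (tail (-θ) (by rw [abs_neg, abs_of_nonneg hθ0]))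

/-! ### Sub-Gaussian distributions -/

/-- The infimum that defines the sub-Gaussian norm need not be attained, hence `K + 1` in place
of `K`. -/
theorem lintegral_exp_sq_le {p : ℕ} {μ : Measure (EuclideanSpace ℝ (Fin p))}
    [IsProbabilityMeasure μ] {K : ℝ} (hK : 0 < K) (hpsi : psi2NormVec μ ≤ ENNReal.ofReal K)
    {u : Fin p → ℝ} {β : ℝ} (hβ : 0 < β) (hu : u ⬝ᵥ u ≤ β ^ 2) :
    ∫⁻ x, ENNReal.ofReal (Real.exp ((∑ k, x k * u k) ^ 2 / ((K + 1) * β) ^ 2)) ∂μ ≤ 2 := by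
  rcases (dot_self_nonneg u).eq_or_lt with h0 | hpos
  · have : u = 0 := dotProduct_self_eq_zero.1 h0.symm
    simp [this]
  obtain ⟨c, hc⟩ : ∃ c, c = √(u ⬝ᵥ u) := ⟨_, rfl⟩
  have hc0 : 0 < c := by rw [hc]; exact Real.sqrt_pos.2 hpos
  have hc2 : c ^ 2 = u ⬝ᵥ u := by rw [hc]; exact Real.sq_sqrt hpos.le
  set z : EuclideanSpace ℝ (Fin p) := WithLp.toLp 2 (fun k => u k / c) with hz
  have hz1 : ‖z‖ = 1 := by
    rw [EuclideanSpace.norm_eq, Real.sqrt_eq_one]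
    simp only [hz, Real.norm_eq_abs, sq_abs, div_pow]
    rw [← Finset.sum_div, ← dot_self_eq, ← hc2, div_self (by positivity)]
  have hlt : psi2Norm (fun x => inner ℝ z x) μ < ENNReal.ofReal (K + 1) :=
    ((le_iSup (fun z : {z : EuclideanSpace ℝ (Fin p) // ‖z‖ = 1} =>
      psi2Norm (fun x => inner ℝ z.1 x) μ) ⟨z, hz1⟩).trans hpsi).trans_lt
      ((ENNReal.ofReal_lt_ofReal_iff (by linarith)).2 (by linarith))
  obtain ⟨_, ⟨t, ht0, rfl, ht⟩, htK⟩ := sInf_lt_iff.1 hlt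
  have htK' : t < K + 1 := (ENNReal.ofReal_lt_ofReal_iff (by linarith)).1 htK
  refine (lintegral_mono fun x => ENNReal.ofReal_le_ofReal (Real.exp_le_exp.2 ?_)).trans ht
  have hlin : ∑ k, x k * u k = c * inner ℝ z x := by
    simp only [PiLp.inner_apply, hz, Finset.mul_sum]
    refine Finset.sum_congr rfl fun k _ => ?_
    simp
    field_simp
  have hcβ : c ≤ β := by
    rw [hc]; exact Real.sqrt_le_iff.2 ⟨hβ.le, hu⟩
  rw [hlin]
  have e : (c * inner ℝ z x) ^ 2 / ((K + 1) * β) ^ 2 =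
      (c / β) ^ 2 * ((inner ℝ z x) ^ 2 / (K + 1) ^ 2) := by
    field_simp
  rw [e]
  have h1 : (c / β) ^ 2 ≤ 1 := pow_le_one₀ (by positivity) ((div_le_one hβ).2 hcβ)
  calc (c / β) ^ 2 * ((inner ℝ z x) ^ 2 / (K + 1) ^ 2) ≤ 1 * ((inner ℝ z x) ^ 2 / t ^ 2) := by
        gcongr
    _ = _ := one_mul _

/-- A product of sub-Gaussian variables is sub-exponential. -/
theorem lintegral_exp_mul_le {E : Type*} [MeasurableSpace E] {μ : Measure E} {f g : E → ℝ}
    (hf : Measurable f) (hg : Measurable g) {L : ℝ} (hL : 0 < L)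
    (h1 : ∫⁻ x, ENNReal.ofReal (Real.exp (f x ^ 2 / L)) ∂μ ≤ 2)
    (h2 : ∫⁻ x, ENNReal.ofReal (Real.exp (g x ^ 2 / L)) ∂μ ≤ 2) :
    ∫⁻ x, ENNReal.ofReal (Real.exp (|f x * g x| / L)) ∂μ ≤ 2 := by
  have hpt : ∀ x, ENNReal.ofReal (Real.exp (|f x * g x| / L)) ≤
      ENNReal.ofReal (1 / 2) * ENNReal.ofReal (Real.exp (f x ^ 2 / L)) +
      ENNReal.ofReal (1 / 2) * ENNReal.ofReal (Real.exp (g x ^ 2 / L)) := by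
    intro x
    rw [← ENNReal.ofReal_mul (by norm_num), ← ENNReal.ofReal_mul (by norm_num),
      ← ENNReal.ofReal_add (by positivity) (by positivity)]
    refine ENNReal.ofReal_le_ofReal ?_
    have h3 : |f x * g x| / L ≤ f x ^ 2 / L / 2 + g x ^ 2 / L / 2 := by
      rw [abs_mul, ← sq_abs (f x), ← sq_abs (g x)]
      have : |f x| * |g x| ≤ |f x| ^ 2 / 2 + |g x| ^ 2 / 2 := by
        nlinarith [sq_nonneg (|f x| - |g x|)]
      calc _ ≤ (|f x| ^ 2 / 2 + |g x| ^ 2 / 2) / L := by gcongr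
        _ = _ := by ring
    refine (Real.exp_le_exp.2 h3).trans ?_
    have e : ∀ s : ℝ, Real.exp s = Real.exp (s / 2) ^ 2 := fun s => by
      rw [← Real.exp_nat_mul]; congr 1; push_cast; ring
    rw [Real.exp_add, e (f x ^ 2 / L), e (g x ^ 2 / L)]
    nlinarith [sq_nonneg (Real.exp (f x ^ 2 / L / 2) - Real.exp (g x ^ 2 / L / 2))]
  refine (lintegral_mono hpt).trans ?_
  rw [lintegral_add_left (by fun_prop), lintegral_const_mul _ (by fun_prop),
    lintegral_const_mul _ (by fun_prop)]
  calc _ ≤ ENNReal.ofReal (1 / 2) * 2 + ENNReal.ofReal (1 / 2) * 2 := by gcongr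
    _ = 2 := by
      rw [← mul_add, ← ENNReal.ofReal_ofNat 2, ← ENNReal.ofReal_add (by norm_num) (by norm_num),
        ← ENNReal.ofReal_mul (by norm_num)]
      norm_num

/-- The data matrix of the sample at `ω`. -/
def dataMatrix {n p : ℕ} {S : Type*} (X : Fin n → S → EuclideanSpace ℝ (Fin p)) (ω : S) :
    Matrix (Fin n) (Fin p) ℝ :=
  Matrix.of fun i j => X i ω j

theorem measurable_lin {p : ℕ} (u : Fin p → ℝ) :
    Measurable fun x : EuclideanSpace ℝ (Fin p) => ∑ k, x k * u k := by
  fun_prop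

section

variable {p : ℕ} {μ : Measure (EuclideanSpace ℝ (Fin p))} [IsProbabilityMeasure μ] {K : ℝ}

theorem lintegral_exp_lin_mul_le (hK : 0 < K) (hpsi : psi2NormVec μ ≤ ENNReal.ofReal K)
    {u w : Fin p → ℝ} {β : ℝ} (hβ : 0 < β) (hu : u ⬝ᵥ u ≤ β ^ 2) (hw : w ⬝ᵥ w ≤ β ^ 2) :
    ∫⁻ x, ENNReal.ofReal (Real.exp (|(∑ k, x k * u k) * (∑ k, x k * w k)| /
      ((K + 1) * β) ^ 2)) ∂μ ≤ 2 :=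
  lintegral_exp_mul_le (measurable_lin u) (measurable_lin w) (by positivity)
    (lintegral_exp_sq_le hK hpsi hβ hu) (lintegral_exp_sq_le hK hpsi hβ hw)

theorem integrable_lin_mul (hK : 0 < K) (hpsi : psi2NormVec μ ≤ ENNReal.ofReal K)
    (u w : Fin p → ℝ) :
    Integrable (fun x : EuclideanSpace ℝ (Fin p) => (∑ k, x k * u k) * (∑ k, x k * w k)) μ := by
  have hu := dot_self_nonneg u
  have hw := dot_self_nonneg w
  refine (lintegral_exp_centered_le (θ := 0) ((measurable_lin u).mul (measurable_lin w))
    (by positivity) (lintegral_exp_lin_mul_le hK hpsi (β := 1 + u ⬝ᵥ u + w ⬝ᵥ w)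
      (by positivity) (by nlinarith) (by nlinarith)) (by rw [abs_zero]; positivity)).1

theorem dot_covMatrix_mulVec (hK : 0 < K) (hpsi : psi2NormVec μ ≤ ENNReal.ofReal K)
    (hmean : ∀ j, ∫ x, x j ∂μ = 0) (u w : Fin p → ℝ) :
    u ⬝ᵥ (covMatrix μ *ᵥ w) = ∫ x, (∑ k, x k * u k) * (∑ k, x k * w k) ∂μ := by
  have hsingle : ∀ (j : Fin p) (x : EuclideanSpace ℝ (Fin p)),
      ∑ k, x k * (Pi.single j (1 : ℝ) : Fin p → ℝ) k = x j := by
    intro j x; simp [Pi.single_apply]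
  have hint : ∀ j k : Fin p, Integrable (fun x : EuclideanSpace ℝ (Fin p) => x j * x k) μ := by
    intro j k
    have := integrable_lin_mul (μ := μ) hK hpsi (Pi.single j 1) (Pi.single k 1)
    simpa only [hsingle] using this
  have hcov : ∀ j k, covMatrix μ j k = ∫ x, x j * x k ∂μ := by
    intro j k
    simp [covMatrix, covariance, hmean]
  have e : ∀ x : EuclideanSpace ℝ (Fin p), (∑ k, x k * u k) * (∑ k, x k * w k) =
      ∑ j, ∑ k, u j * w k * (x j * x k) := by
    intro x
    rw [Finset.sum_mul_sum]
    exact Finset.sum_congr rfl fun j _ => Finset.sum_congr rfl fun k _ => by ring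
  simp only [e]
  rw [integral_finsetSum _ fun j _ => integrable_finsetSum _ fun k _ => (hint j k).const_mul _]
  simp only [dotProduct, Matrix.mulVec, Finset.mul_sum]
  refine Finset.sum_congr rfl fun j _ => ?_
  rw [integral_finsetSum _ fun k _ => (hint j k).const_mul _]
  refine Finset.sum_congr rfl fun k _ => ?_
  rw [integral_const_mul, hcov]; ring

variable {n : ℕ} {S : Type*} [MeasurableSpace S] {P : Measure S} [IsProbabilityMeasure P]
  {X : Fin n → S → EuclideanSpace ℝ (Fin p)}

/-- Bernstein's inequality for the bilinear form of the sample covariance matrix. -/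
theorem form_gram_tail (hn : 1 ≤ n) (hK : 0 < K) (hpsi : psi2NormVec μ ≤ ENNReal.ofReal K)
    (hmean : ∀ j, ∫ x, x j ∂μ = 0) (hX : iIndepFun X P) (hlaw : ∀ i, HasLaw (X i) μ P)
    {u w : Fin p → ℝ} {β x : ℝ} (hβ : 0 < β) (hu : u ⬝ᵥ u ≤ β ^ 2) (hw : w ⬝ᵥ w ≤ β ^ 2)
    (hx : 0 ≤ x) (hxL : x ≤ 16 * ((K + 1) * β) ^ 2) :
    P {ω | x ≤ |u ⬝ᵥ (gram (dataMatrix X ω) *ᵥ w) - u ⬝ᵥ (covMatrix μ *ᵥ w)|} ≤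
      ENNReal.ofReal (2 * Real.exp (-(n * x ^ 2 / (64 * (((K + 1) * β) ^ 2) ^ 2)))) := by
  have := bernstein hn hX hlaw (Y := fun x => (∑ k, x k * u k) * (∑ k, x k * w k))
    ((measurable_lin u).mul (measurable_lin w)) (by positivity)
    (lintegral_exp_lin_mul_le hK hpsi hβ hu hw) hx hxL
  simpa only [form_gram₂, dot_covMatrix_mulVec hK hpsi hmean, dataMatrix, Matrix.of_apply]
    using this

/-- A cruder tail bound, beyond the Gaussian range of Bernstein's inequality: the probability is
small enough for a union bound over exponentially many vectors. -/
theorem form_gram_upper_tail (hn : 1 ≤ n) (hK : 0 < K)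
    (hpsi : psi2NormVec μ ≤ ENNReal.ofReal K)
    (hX : iIndepFun X P) (hlaw : ∀ i, HasLaw (X i) μ P) (u : Fin p → ℝ) :
    P {ω | 6 * (K + 1) ^ 2 * (u ⬝ᵥ u) < u ⬝ᵥ (gram (dataMatrix X ω) *ᵥ u)} ≤
      ENNReal.ofReal ((2 * Real.exp (-6)) ^ n) := by
  have hn' : (0 : ℝ) < n := by exact_mod_cast hn
  rcases (dot_self_nonneg u).eq_or_lt with h0 | hpos
  · have : u = 0 := dotProduct_self_eq_zero.1 h0.symm
    simp [this]
  have hβ : 0 < √(u ⬝ᵥ u) := Real.sqrt_pos.2 hpos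
  have hβ2 : √(u ⬝ᵥ u) ^ 2 = u ⬝ᵥ u := Real.sq_sqrt hpos.le
  have h := measure_le_sum_le hX hlaw
    (f := fun x => (∑ k, x k * u k) ^ 2 / ((K + 1) * √(u ⬝ᵥ u)) ^ 2) (by fun_prop)
    (B := 2) (by norm_num)
    (by simpa using lintegral_exp_sq_le (μ := μ) hK hpsi hβ hβ2.ge) (6 * n)
  refine (measure_mono fun ω hω => ?_).trans (h.trans (le_of_eq ?_))
  · have hω' : 6 * (K + 1) ^ 2 * (u ⬝ᵥ u) < u ⬝ᵥ (gram (dataMatrix X ω) *ᵥ u) := hω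
    change 6 * (n : ℝ) ≤ ∑ i, (∑ k, X i ω k * u k) ^ 2 / ((K + 1) * √(u ⬝ᵥ u)) ^ 2
    rw [← Finset.sum_div, mul_pow, hβ2, le_div_iff₀ (by positivity)]
    rw [form_gram, one_div, inv_mul_eq_div, lt_div_iff₀ hn'] at hω'
    simp only [dataMatrix, Matrix.of_apply] at hω'
    linarith
  · rw [mul_pow, ← Real.exp_nat_mul]
    congr 1
    rw [mul_comm]
    congr 2
    ring

end

/-! ### The population -/

theorem covMatrix_isHermitian {p : ℕ} (μ : Measure (EuclideanSpace ℝ (Fin p))) :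
    (covMatrix μ).IsHermitian := by
  ext j k
  simp [covMatrix, covariance_comm]

section

variable {p : ℕ} {S : Matrix (Fin p) (Fin p) ℝ} {κ : ℝ}

theorem isUnit_det_of_eigenvalue_bounds (hp : 1 ≤ p) (hκ : 0 < κ)
    (heig : ∀ e : ℝ, Module.End.HasEigenvalue (Matrix.toLin' S⁻¹) e → 1 / κ ≤ e ∧ e ≤ κ) :
    IsUnit S.det := by
  by_contra h
  -- The inverse of a singular matrix is the zero matrix, whose eigenvalue `0` is excluded.
  rw [Matrix.nonsing_inv_apply_not_isUnit _ h] at heig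
  have : Module.End.HasEigenvalue (Matrix.toLin' (0 : Matrix (Fin p) (Fin p) ℝ)) 0 := by
    refine Module.End.hasEigenvalue_of_hasEigenvector (x := fun _ => 1) ⟨?_, ?_⟩
    · simp
    · intro h0
      exact one_ne_zero (congrFun h0 ⟨0, hp⟩)
  have := (heig 0 this).1
  have : 0 < 1 / κ := by positivity
  linarith

theorem inv_form_bounds (hS : S.IsHermitian)
    (heig : ∀ e : ℝ, Module.End.HasEigenvalue (Matrix.toLin' S⁻¹) e → 1 / κ ≤ e ∧ e ≤ κ)
    (x : Fin p → ℝ) :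
    1 / κ * (x ⬝ᵥ x) ≤ x ⬝ᵥ (S⁻¹ *ᵥ x) ∧ x ⬝ᵥ (S⁻¹ *ᵥ x) ≤ κ * (x ⬝ᵥ x) := by
  have hΩ : S⁻¹.IsHermitian := hS.inv
  have hspec : ∀ e ∈ spectrum ℝ S⁻¹, 1 / κ ≤ e ∧ e ≤ κ := by
    intro e he
    refine heig e ?_
    rw [Module.End.hasEigenvalue_iff_mem_spectrum, Matrix.spectrum_toLin']
    exact he
  have h1 : (S⁻¹ - algebraMap ℝ _ (1 / κ)).PosSemidef := by
    rw [Matrix.posSemidef_iff_isHermitian_and_spectrum_nonneg]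
    refine ⟨hΩ.sub (by simp [Matrix.algebraMap_eq_diagonal]), ?_⟩
    rw [← spectrum.sub_singleton_eq]
    rintro _ ⟨e, he, _, rfl, rfl⟩
    simpa using (hspec e he).1
  have h2 : (algebraMap ℝ _ κ - S⁻¹).PosSemidef := by
    rw [Matrix.posSemidef_iff_isHermitian_and_spectrum_nonneg]
    refine ⟨Matrix.IsHermitian.sub (by simp [Matrix.algebraMap_eq_diagonal]) hΩ, ?_⟩
    rw [← spectrum.singleton_sub_eq]
    rintro _ ⟨_, rfl, e, he, rfl⟩
    simpa using (hspec e he).2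
  have e : ∀ c : ℝ, x ⬝ᵥ ((algebraMap ℝ (Matrix (Fin p) (Fin p) ℝ) c) *ᵥ x) = c * (x ⬝ᵥ x) := by
    intro c
    rw [Algebra.algebraMap_eq_smul_one, Matrix.smul_mulVec, Matrix.one_mulVec, dotProduct_smul,
      smul_eq_mul]
  have h3 := form_nonneg h1 x
  have h4 := form_nonneg h2 x
  rw [Matrix.sub_mulVec, dotProduct_sub, e] at h3 h4
  constructor <;> linarith

end

section

variable {p : ℕ} {S : Matrix (Fin p) (Fin p) ℝ} {κ : ℝ}

theorem mulVec_inv_mulVec (hS : IsUnit S.det) (x : Fin p → ℝ) : S *ᵥ (S⁻¹ *ᵥ x) = x := by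
  rw [Matrix.mulVec_mulVec, Matrix.mul_nonsing_inv _ hS, Matrix.one_mulVec]

theorem inv_posSemidef (hS : S.IsHermitian) (hκ : 0 < κ)
    (heig : ∀ e : ℝ, Module.End.HasEigenvalue (Matrix.toLin' S⁻¹) e → 1 / κ ≤ e ∧ e ≤ κ) :
    S⁻¹.PosSemidef := by
  refine Matrix.PosSemidef.of_dotProduct_mulVec_nonneg hS.inv fun x => ?_
  have h := (inv_form_bounds hS heig x).1
  have := dot_self_nonneg x
  simp only [star_trivial]
  exact le_trans (by positivity) h

/-- `‖S⁻¹ y‖² ≤ κ ⟨y, S⁻¹ y⟩`, by nonnegativity of the form `S⁻¹` at `S⁻¹ y - κ y`. -/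
theorem inv_mulVec_sq_le (hS : S.IsHermitian) (hκ : 0 < κ)
    (heig : ∀ e : ℝ, Module.End.HasEigenvalue (Matrix.toLin' S⁻¹) e → 1 / κ ≤ e ∧ e ≤ κ)
    (y : Fin p → ℝ) : (S⁻¹ *ᵥ y) ⬝ᵥ (S⁻¹ *ᵥ y) ≤ κ * (y ⬝ᵥ (S⁻¹ *ᵥ y)) := by
  have hpsd := inv_posSemidef hS hκ heig
  obtain ⟨z, hz⟩ : ∃ z, z = S⁻¹ *ᵥ y := ⟨_, rfl⟩
  have h1 := form_nonneg hpsd (z + (-κ) • y)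
  rw [form_add, form_smul, form_symm (transpose_eq_of_posSemidef hpsd) _ z] at h1
  simp only [Matrix.mulVec_smul, dotProduct_smul, smul_dotProduct, smul_eq_mul, ← hz] at h1 ⊢
  have h2 := (inv_form_bounds hS heig z).2
  have h3 : κ * (z ⬝ᵥ z) ≤ κ * (κ * (y ⬝ᵥ z)) := by
    have := form_symm (transpose_eq_of_posSemidef hpsd) z y
    rw [← hz] at this
    nlinarith
  exact le_of_mul_le_mul_left h3 hκ

theorem form_lower_bound (hp : 1 ≤ p) (hS : S.IsHermitian) (hκ : 0 < κ)
    (heig : ∀ e : ℝ, Module.End.HasEigenvalue (Matrix.toLin' S⁻¹) e → 1 / κ ≤ e ∧ e ≤ κ)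
    (x : Fin p → ℝ) : 1 / κ * (x ⬝ᵥ x) ≤ x ⬝ᵥ (S *ᵥ x) := by
  have hu := isUnit_det_of_eigenvalue_bounds hp hκ heig
  have h := inv_mulVec_sq_le hS hκ heig (S *ᵥ x)
  rw [Matrix.mulVec_mulVec, Matrix.nonsing_inv_mul _ hu, Matrix.one_mulVec,
    dotProduct_comm (S *ᵥ x)] at h
  rw [one_div, inv_mul_le_iff₀ hκ]
  exact h

theorem posDef_of_eigenvalue_bounds (hp : 1 ≤ p) (hS : S.IsHermitian) (hκ : 0 < κ)
    (heig : ∀ e : ℝ, Module.End.HasEigenvalue (Matrix.toLin' S⁻¹) e → 1 / κ ≤ e ∧ e ≤ κ) :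
    S.PosDef := by
  refine Matrix.PosDef.of_dotProduct_mulVec_pos hS fun x hx => ?_
  have h := form_lower_bound hp hS hκ heig x
  have h0 : 0 < x ⬝ᵥ x := lt_of_le_of_ne (dot_self_nonneg x) fun h =>
    hx (dotProduct_self_eq_zero.1 h.symm)
  simp only [star_trivial]
  exact lt_of_lt_of_le (by positivity) h

theorem inv_mulVec_single (j : Fin p) :
    S⁻¹ *ᵥ (Pi.single j 1 : Fin p → ℝ) = fun k => S⁻¹ k j := by
  ext k; simp

theorem popBounds_inv (hS : S.IsHermitian) (hκ : 0 < κ)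
    (heig : ∀ e : ℝ, Module.End.HasEigenvalue (Matrix.toLin' S⁻¹) e → 1 / κ ≤ e ∧ e ≤ κ) :
    PopBounds S⁻¹ κ := by
  have hb : ∀ j, 1 / κ ≤ S⁻¹ j j ∧ S⁻¹ j j ≤ κ := by
    intro j
    have := inv_form_bounds hS heig (Pi.single j 1)
    simpa using this
  refine ⟨inv_posSemidef hS hκ heig, fun j => (hb j).1, fun j => (hb j).2, fun j k => ?_⟩
  have h := inv_mulVec_sq_le hS hκ heig (Pi.single k 1)
  rw [inv_mulVec_single, single_one_dotProduct, dot_self_eq] at h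
  have h1 : S⁻¹ j k ^ 2 ≤ ∑ l, S⁻¹ l k ^ 2 :=
    Finset.single_le_sum (f := fun l => S⁻¹ l k ^ 2) (fun _ _ => sq_nonneg _) (Finset.mem_univ j)
  refine abs_le_of_sq_le_sq ?_ hκ.le
  nlinarith [(hb k).2]

theorem popVec_eq (j : Fin p) :
    popVec S⁻¹ j = (1 / S⁻¹ j j) • (S⁻¹ *ᵥ (Pi.single j 1 : Fin p → ℝ)) := by
  ext k
  rw [inv_mulVec_single]
  simp only [popVec, Pi.smul_apply, smul_eq_mul]; ring

theorem popVec_sq_le (hS : S.IsHermitian) (hκ : 0 < κ)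
    (heig : ∀ e : ℝ, Module.End.HasEigenvalue (Matrix.toLin' S⁻¹) e → 1 / κ ≤ e ∧ e ≤ κ)
    (j : Fin p) : popVec S⁻¹ j ⬝ᵥ popVec S⁻¹ j ≤ κ ^ 2 := by
  have hpop := popBounds_inv hS hκ heig
  have h := inv_mulVec_sq_le hS hκ heig (Pi.single j 1)
  have h0 := hpop.diag_pos hκ j
  rw [popVec_eq]
  simp only [smul_dotProduct, dotProduct_smul, smul_eq_mul]
  have e : (Pi.single j 1 : Fin p → ℝ) ⬝ᵥ (S⁻¹ *ᵥ (Pi.single j 1 : Fin p → ℝ)) = S⁻¹ j j := by simp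
  rw [e] at h
  have h1 : 1 / S⁻¹ j j ≤ κ := by rw [one_div_le h0 hκ]; exact hpop.le_diag j
  calc _ ≤ 1 / S⁻¹ j j * (1 / S⁻¹ j j * (κ * S⁻¹ j j)) := by gcongr
    _ = 1 / S⁻¹ j j * κ := by field_simp
    _ ≤ κ * κ := by gcongr
    _ = κ ^ 2 := by ring

/-- The normal equations of the population regressions: `S (e_j - θ⋆_j) = τ_j² e_j`. -/
theorem mulVec_popVec (hS : IsUnit S.det) (j : Fin p) :
    S *ᵥ popVec S⁻¹ j = (1 / S⁻¹ j j) • (Pi.single j 1 : Fin p → ℝ) := by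
  rw [popVec_eq, Matrix.mulVec_smul, mulVec_inv_mulVec hS]

/-- The Schur complement formula for the residual variances. -/
theorem residVar_eq (hS : S.PosDef) (j : Fin p) : residVar S j = 1 / S⁻¹ j j := by
  have hdet : IsUnit S.det := (Matrix.isUnit_iff_isUnit_det _).1 hS.isUnit
  have hΩ : 0 < S⁻¹ j j := hS.inv.diag_pos
  set R := S.submatrix (fun k : {k : Fin p // k ≠ j} => k.1) (fun k : {k : Fin p // k ≠ j} => k.1)
    with hR
  have hRpd : R.PosDef := hS.submatrix Subtype.val_injective
  have hRdet : IsUnit R.det := (Matrix.isUnit_iff_isUnit_det _).1 hRpd.isUnit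
  have hrow : ∀ k, S k j + ∑ l : {l : Fin p // l ≠ j}, S k l.1 * popVec S⁻¹ j l.1 =
      (1 / S⁻¹ j j) * (Pi.single j 1 : Fin p → ℝ) k := by
    intro k
    have h := congrFun (mulVec_popVec hdet j) k
    rw [Matrix.mulVec, dotProduct, Fintype.sum_eq_add_sum_subtype_ne _ j] at h
    have h1 : popVec S⁻¹ j j = 1 := div_self hΩ.ne'
    rw [h1, mul_one] at h
    exact h
  have hsol : R⁻¹ *ᵥ (fun k : {k : Fin p // k ≠ j} => S k j) =
      fun l : {l : Fin p // l ≠ j} => -popVec S⁻¹ j l.1 := by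
    have : (fun k : {k : Fin p // k ≠ j} => S k j) =
        R *ᵥ fun l : {l : Fin p // l ≠ j} => -popVec S⁻¹ j l.1 := by
      ext k
      have h := hrow k.1
      rw [Pi.single_eq_of_ne k.2, mul_zero] at h
      simp only [Matrix.mulVec, dotProduct, hR, Matrix.submatrix_apply, mul_neg,
        Finset.sum_neg_distrib]
      linarith
    rw [this, Matrix.mulVec_mulVec, Matrix.nonsing_inv_mul _ hRdet, Matrix.one_mulVec]
  have h := hrow j
  rw [Pi.single_eq_same, mul_one] at h
  rw [residVar, hsol, ← h]
  simp [dotProduct]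

end

/-- Every edge is counted at both of its ends. -/
theorem sum_card_nbhd {p : ℕ} {Ω : Matrix (Fin p) (Fin p) ℝ} (hΩ : ∀ j k, Ω j k = Ω k j) :
    ∑ j, ((nbhd Ω j).card : ℝ) = 2 * (size Ω : ℝ) := by
  classical
  set T : Finset (Fin p × Fin p) := Finset.univ.filter fun x => Ω x.1 x.2 ≠ 0 ∧ x.2 < x.1 with hT
  have hsize : size Ω = T.card := by
    rw [size, ← Set.ncard_coe_finset]
    congr 1
    ext x; simp [hT]
  have hcard : ∑ j, (nbhd Ω j).card = ∑ j, ((Finset.univ.filter fun k => Ω j k ≠ 0 ∧ k < j).card +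
      (Finset.univ.filter fun k => Ω k j ≠ 0 ∧ j < k).card) := by
    refine Finset.sum_congr rfl fun j _ => ?_
    rw [← Finset.card_union_of_disjoint]
    · congr 1
      ext k
      simp only [nbhd, Finset.mem_filter, Finset.mem_univ, true_and, Finset.mem_union, hΩ k j]
      constructor
      · rintro ⟨h1, h2⟩
        rcases lt_or_gt_of_ne h1 with h | h
        · exact Or.inl ⟨h2, h⟩
        · exact Or.inr ⟨h2, h⟩
      · rintro (⟨h1, h2⟩ | ⟨h1, h2⟩)
        · exact ⟨h2.ne, h1⟩
        · exact ⟨h2.ne', h1⟩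
    · rw [Finset.disjoint_left]
      intro k hk hk'
      simp only [Finset.mem_filter, Finset.mem_univ, true_and] at hk hk'
      exact absurd hk.2 (lt_asymm hk'.2)
  have hT1 : T.card = ∑ j, (Finset.univ.filter fun k => Ω j k ≠ 0 ∧ k < j).card := by
    simp only [Finset.card_filter, hT]
    rw [Fintype.sum_prod_type]
  have hT2 : T.card = ∑ j, (Finset.univ.filter fun k => Ω k j ≠ 0 ∧ j < k).card := by
    simp only [Finset.card_filter, hT]
    rw [Fintype.sum_prod_type_right]
  have : ∑ j, (nbhd Ω j).card = 2 * size Ω := by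
    rw [hcard, Finset.sum_add_distrib, ← hT1, ← hT2, hsize]; ring
  exact_mod_cast this

theorem card_nbhd_le_degree {p : ℕ} (Ω : Matrix (Fin p) (Fin p) ℝ) (j : Fin p) :
    (nbhd Ω j).card ≤ degree Ω := by
  classical
  have h := Finset.le_sup (f := fun j : Fin p => Set.ncard {k : Fin p | k ≠ j ∧ Ω j k ≠ 0})
    (Finset.mem_univ j)
  refine le_trans (le_of_eq ?_) h
  rw [← Set.ncard_coe_finset]
  congr 1
  ext k; simp [nbhd]

theorem frobenius_norm_le {p : ℕ} {D : Matrix (Fin p) (Fin p) ℝ} {B : ℝ}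
    (h : ∑ j, ∑ k, D k j ^ 2 ≤ B) :
    ‖D‖ ≤ √B := by
  rw [Matrix.frobenius_norm_def, ← Real.sqrt_eq_rpow]
  refine Real.sqrt_le_sqrt ?_
  rw [Finset.sum_comm]
  simpa using h

/-! ### Existence of an output -/

theorem exists_isMinOn_lassoObj {n p : ℕ} (X : Matrix (Fin n) (Fin p) ℝ) {lam : ℝ} (hlam : 0 < lam)
    (j : Fin p) : ∃ θ, IsMinOn (lassoObj X lam j) Set.univ θ := by
  have hcont : Continuous (lassoObj X lam j) := by
    unfold lassoObj; fun_prop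
  have hco : Filter.Tendsto (lassoObj X lam j) (Filter.cocompact _) Filter.atTop := by
    refine Filter.tendsto_atTop_mono (fun θ => ?_)
      (Filter.Tendsto.const_mul_atTop hlam (tendsto_norm_cocompact_atTop))
    have h1 : ‖θ‖ ≤ ∑ k, |θ k| := by
      refine (pi_norm_le_iff_of_nonneg (Finset.sum_nonneg fun _ _ => abs_nonneg _)).2 fun k => ?_
      exact Finset.single_le_sum (f := fun k => |θ k|) (fun _ _ => abs_nonneg _) (Finset.mem_univ k)
    have h2 : 0 ≤ (1 / (2 * (n : ℝ))) * ∑ i, (X i j - ∑ k, X i k.1 * θ k) ^ 2 := by positivity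
    unfold lassoObj
    nlinarith
  obtain ⟨θ, hθ⟩ := hcont.exists_forall_le hco
  exact ⟨θ, fun x _ => hθ x⟩

theorem penalty_le_lassoObj {n p : ℕ} (X : Matrix (Fin n) (Fin p) ℝ) (lam : ℝ)
    (j : Fin p) (θ : {k : Fin p // k ≠ j} → ℝ) : lam * ∑ k, |θ k| ≤ lassoObj X lam j θ := by
  unfold lassoObj
  have : 0 ≤ (1 / (2 * (n : ℝ))) * ∑ i, (X i j - ∑ k, X i k.1 * θ k) ^ 2 := by positivity
  linarith

/-- The matrix `W` with `W_jj = 1 / v_j` and `W_{∖j,j} = -θ_j / v_j`. -/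
noncomputable def coefMatrix {p : ℕ} (v : Fin p → ℝ)
    (θ : (j : Fin p) → {k : Fin p // k ≠ j} → ℝ) : Matrix (Fin p) (Fin p) ℝ :=
  Matrix.of fun k j => regVec j (θ j) k / v j

theorem coefMatrix_feasible {p : ℕ} {v : Fin p → ℝ}
    {θ : (j : Fin p) → {k : Fin p // k ≠ j} → ℝ} (h : (coefMatrix v θ).PosSemidef) :
    (coefMatrix v θ, θ) ∈ feasible v := by
  refine ⟨fun j => ?_, fun j k => ?_, h⟩
  · simp [coefMatrix, regVec_self]
  · simp [coefMatrix, regVec_of_ne k.2]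

theorem eq_coefMatrix {p : ℕ} {v : Fin p → ℝ} {W : Matrix (Fin p) (Fin p) ℝ}
    {θ : (j : Fin p) → {k : Fin p // k ≠ j} → ℝ} (h : (W, θ) ∈ feasible v) :
    W = coefMatrix v θ := by
  ext k j
  by_cases hk : k = j
  · subst hk
    have := h.1 k
    simpa [coefMatrix, regVec_self] using this
  · have := h.2.1 j ⟨k, hk⟩
    simpa [coefMatrix, regVec_of_ne hk] using this

/-- The matrix is determined by the coefficients, so the program minimizes a coercive function of
the coefficients over a closed set, which contains `0`. -/
theorem exists_isMinOn_programObj {n p : ℕ} (X : Matrix (Fin n) (Fin p) ℝ) {lam : ℝ}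
    (hlam : 0 < lam) {v : Fin p → ℝ} (hv : ∀ j, 0 < v j) :
    ∃ W θ, (W, θ) ∈ feasible v ∧ IsMinOn (programObj X lam) (feasible v) (W, θ) := by
  set F : ((j : Fin p) → {k : Fin p // k ≠ j} → ℝ) → ℝ :=
    fun θ => ∑ j, lassoObj X lam j (θ j) with hF
  have hFcont : Continuous F := by
    simp only [hF]; unfold lassoObj; fun_prop
  set s : Set ((j : Fin p) → {k : Fin p // k ≠ j} → ℝ) :=
    {θ | (coefMatrix v θ).PosSemidef} with hs
  have hcm : Continuous fun θ : (j : Fin p) → {k : Fin p // k ≠ j} → ℝ => coefMatrix v θ := by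
    refine continuous_matrix fun k j => ?_
    simp only [coefMatrix, Matrix.of_apply, regVec]
    split_ifs <;> fun_prop
  have hclosed : IsClosed s := by
    have e : s = ⋂ (i : Fin p) (k : Fin p) (x : Fin p → ℝ),
        {θ | coefMatrix v θ i k = coefMatrix v θ k i} ∩
        {θ | 0 ≤ x ⬝ᵥ (coefMatrix v θ *ᵥ x)} := by
      ext θ
      simp only [hs, Set.mem_ofPred_eq, Set.mem_iInter, Set.mem_inter_iff]
      constructor
      · intro h i k x
        refine ⟨?_, form_nonneg h x⟩
        have := congrFun (congrFun (transpose_eq_of_posSemidef h) k) i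
        simpa using this
      · intro h
        rcases Nat.eq_zero_or_pos p with rfl | hp
        · refine Matrix.PosSemidef.of_dotProduct_mulVec_nonneg (by ext i; exact i.elim0) fun x => ?_
          simp [dotProduct]
        · refine Matrix.PosSemidef.of_dotProduct_mulVec_nonneg ?_ fun x => ?_
          · ext i k
            simpa using (h k i 0).1
          · simpa using (h ⟨0, hp⟩ ⟨0, hp⟩ x).2
    rw [e]
    refine isClosed_iInter fun i => isClosed_iInter fun k => isClosed_iInter fun x =>
      IsClosed.inter (isClosed_eq ?_ ?_) (isClosed_le continuous_const ?_)
    · exact hcm.matrix_elem i k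
    · exact hcm.matrix_elem k i
    · exact continuous_const.dotProduct (hcm.matrix_mulVec continuous_const)
  have h0 : (0 : (j : Fin p) → {k : Fin p // k ≠ j} → ℝ) ∈ s := by
    have : coefMatrix v 0 = Matrix.diagonal fun j => 1 / v j := by
      ext k j
      by_cases hk : k = j
      · subst hk; simp [coefMatrix, regVec_self]
      · simp [coefMatrix, regVec_of_ne hk, hk]
    change (coefMatrix v 0).PosSemidef
    rw [this]
    exact Matrix.PosSemidef.diagonal fun j => (one_div_pos.2 (hv j)).le
  have hco : Filter.Tendsto F (Filter.cocompact _) Filter.atTop := by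
    refine Filter.tendsto_atTop_mono (fun θ => ?_)
      (Filter.Tendsto.const_mul_atTop hlam (tendsto_norm_cocompact_atTop))
    have h1 : ‖θ‖ ≤ ∑ j, ∑ k, |θ j k| := by
      have hnn : ∀ j, 0 ≤ ∑ k, |θ j k| := fun j => Finset.sum_nonneg fun _ _ => abs_nonneg _
      refine (pi_norm_le_iff_of_nonneg (Finset.sum_nonneg fun j _ => hnn j)).2 fun j => ?_
      refine le_trans ?_ (Finset.single_le_sum (f := fun j => ∑ k, |θ j k|) (fun j _ => hnn j)
        (Finset.mem_univ j))
      refine (pi_norm_le_iff_of_nonneg (hnn j)).2 fun k => ?_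
      exact Finset.single_le_sum (f := fun k => |θ j k|) (fun _ _ => abs_nonneg _)
        (Finset.mem_univ k)
    calc lam * ‖θ‖ ≤ lam * ∑ j, ∑ k, |θ j k| := by gcongr
      _ ≤ F θ := by
        rw [Finset.mul_sum]
        exact Finset.sum_le_sum fun j _ => penalty_le_lassoObj X lam j (θ j)
  obtain ⟨θ, hθs, hθ⟩ := hFcont.continuousOn.exists_isMinOn' hclosed h0
    ((hco.eventually (Filter.eventually_ge_atTop (F 0))).filter_mono inf_le_left)
  refine ⟨coefMatrix v θ, θ, coefMatrix_feasible hθs, ?_⟩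
  rintro ⟨W', θ'⟩ h
  refine hθ (?_ : θ' ∈ s)
  have := h.2.2
  rw [eq_coefMatrix h] at this
  exact this

theorem exists_isOutput {n p : ℕ} (X : Matrix (Fin n) (Fin p) ℝ) {lam : ℝ} (hlam : 0 < lam)
    (hpos : ∀ j θ, IsMinOn (lassoObj X lam j) Set.univ θ → 0 < meanSqResid X j θ) :
    ∃ W Q, IsOutput X lam W Q := by
  choose θ₀ hθ₀ using exists_isMinOn_lassoObj X hlam
  obtain ⟨W, θ, hW, hmin⟩ := exists_isMinOn_programObj X hlam
    (v := fun j => meanSqResid X j (θ₀ j)) fun j => hpos j _ (hθ₀ j)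
  exact ⟨W, _, θ₀, θ, _, hθ₀, fun _ => rfl, fun j => hpos j _ (hθ₀ j), hW, hmin, rfl⟩

/-! ### The good event -/

theorem measure_exists_le {S ι : Type*} [MeasurableSpace S] {P : Measure S} (s : Finset ι)
    {B : ι → Set S} {x : ℝ} (h : ∀ i ∈ s, P (B i) ≤ ENNReal.ofReal x) :
    P {ω | ∃ i ∈ s, ω ∈ B i} ≤ ENNReal.ofReal (s.card * x) := by
  have e : {ω | ∃ i ∈ s, ω ∈ B i} = ⋃ i ∈ s, B i := by ext; simp
  rw [e, ENNReal.ofReal_mul (Nat.cast_nonneg _), ENNReal.ofReal_natCast, ← nsmul_eq_mul,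
    ← Finset.sum_const]
  exact (measure_biUnion_finset_le s B).trans (Finset.sum_le_sum h)

section

variable {p n : ℕ} {μ : Measure (EuclideanSpace ℝ (Fin p))} [IsProbabilityMeasure μ] {K κ : ℝ}
  {S : Type*} [MeasurableSpace S] {P : Measure S} [IsProbabilityMeasure P]
  {X : Fin n → S → EuclideanSpace ℝ (Fin p)}

/-- The union bound over the grid: `48 ^ p` points, each with probability `(2 / e⁶) ^ n`. -/
theorem measure_grid_le (hn : 1 ≤ n) (hp : 1 ≤ p) (hpn : p ≤ n) (hK : 0 < K)
    (hpsi : psi2NormVec μ ≤ ENNReal.ofReal K) (hX : iIndepFun X P)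
    (hlaw : ∀ i, HasLaw (X i) μ P) :
    P {ω | ∃ z ∈ gridBall p, 6 * (K + 1) ^ 2 * ((fun k => (z k : ℝ)) ⬝ᵥ fun k => (z k : ℝ)) <
      (fun k => (z k : ℝ)) ⬝ᵥ (gram (dataMatrix X ω) *ᵥ fun k => (z k : ℝ))} ≤
      ENNReal.ofReal (1 / p) := by
  refine (measure_exists_le (gridBall p) fun z _ =>
    form_gram_upper_tail hn hK hpsi hX hlaw fun k => (z k : ℝ)).trans ?_
  refine ENNReal.ofReal_le_ofReal ?_
  have hp' : (0 : ℝ) < p := by exact_mod_cast hp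
  have h5 : (96 : ℝ) ≤ Real.exp 5 := by
    have h1 : (2.7182818283 : ℝ) < Real.exp 1 := Real.exp_one_gt_d9
    have : Real.exp 5 = Real.exp 1 ^ 5 := by rw [← Real.exp_nat_mul]; norm_num
    rw [this]
    calc (96 : ℝ) ≤ 2.7182818283 ^ 5 := by norm_num
      _ ≤ _ := by gcongr
  have h1 : 96 * Real.exp (-6) ≤ Real.exp (-1) := by
    calc 96 * Real.exp (-6) ≤ Real.exp 5 * Real.exp (-6) := by gcongr
      _ = Real.exp (-1) := by rw [← Real.exp_add]; norm_num
  calc ((gridBall p).card : ℝ) * (2 * Real.exp (-6)) ^ n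
      ≤ 48 ^ n * (2 * Real.exp (-6)) ^ n := by
        gcongr
        exact (card_gridBall_le p).trans (pow_le_pow_right₀ (by norm_num) hpn)
    _ = (96 * Real.exp (-6)) ^ n := by rw [← mul_pow]; ring
    _ ≤ Real.exp (-1) ^ n := by gcongr
    _ = (Real.exp n)⁻¹ := by rw [← Real.exp_nat_mul, ← Real.exp_neg]; congr 1; ring
    _ ≤ 1 / p := by
        rw [one_div]
        gcongr
        have := Real.add_one_le_exp (n : ℝ)
        have : (p : ℝ) ≤ n := by exact_mod_cast hpn
        linarith

/-- The union bound over the `(2p) ^ m` sums of `m` signed basis vectors. -/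
theorem measure_sparse_le (hn : 1 ≤ n) (hp : 2 ≤ p) (hK : 0 < K) (hκ : 1 ≤ κ)
    (hpsi : psi2NormVec μ ≤ ENNReal.ofReal K) (hmean : ∀ j, ∫ x, x j ∂μ = 0)
    (hX : iIndepFun X P) (hlaw : ∀ i, HasLaw (X i) μ P)
    (hlow : ∀ x : Fin p → ℝ, 1 / κ * (x ⬝ᵥ x) ≤ x ⬝ᵥ (covMatrix μ *ᵥ x)) {m : ℕ}
    (hm : (2 * m + 2) * Real.log p ≤ n / (256 * κ ^ 2 * (K + 1) ^ 4)) :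
    P {ω | ∃ f ∈ (Finset.univ : Finset (Fin m → Fin p × Bool)),
      (∑ i, signedBasis (f i)) ⬝ᵥ
        ((gram (dataMatrix X ω) - (1 / 2 : ℝ) • covMatrix μ) *ᵥ ∑ i, signedBasis (f i)) < 0} ≤
      ENNReal.ofReal (1 / p) := by
  have hκ0 : 0 < κ := by linarith
  have hp' : (2 : ℝ) ≤ p := by exact_mod_cast hp
  obtain ⟨N, hN⟩ : ∃ N, N = (n : ℝ) / (256 * κ ^ 2 * (K + 1) ^ 4) := ⟨_, rfl⟩
  refine (measure_exists_le (x := 2 * Real.exp (-N)) Finset.univ fun f _ => ?_).trans ?_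
  · obtain ⟨V, hV⟩ : ∃ V : Fin p → ℝ, V = ∑ i, signedBasis (f i) := ⟨_, rfl⟩
    change P {ω | (∑ i, signedBasis (f i)) ⬝ᵥ
      ((gram (dataMatrix X ω) - (1 / 2 : ℝ) • covMatrix μ) *ᵥ ∑ i, signedBasis (f i)) < 0} ≤ _
    rw [← hV]
    rcases (dot_self_nonneg V).eq_or_lt with h0 | hpos
    · have : V = 0 := dotProduct_self_eq_zero.1 h0.symm
      simp [this]
    have hβ : 0 < √(V ⬝ᵥ V) := Real.sqrt_pos.2 hpos
    have hβ2 : √(V ⬝ᵥ V) ^ 2 = V ⬝ᵥ V := Real.sq_sqrt hpos.le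
    have h := form_gram_tail (x := V ⬝ᵥ V / (2 * κ)) hn hK hpsi hmean hX hlaw hβ hβ2.ge hβ2.ge
      (by positivity) (by
        rw [mul_pow, hβ2]
        have h1 : V ⬝ᵥ V / (2 * κ) ≤ V ⬝ᵥ V := div_le_self hpos.le (by linarith)
        have h2 : 1 ≤ 16 * (K + 1) ^ 2 := by nlinarith
        nlinarith)
    refine (measure_mono fun ω hω => ?_).trans (h.trans (le_of_eq ?_))
    · have hω' : V ⬝ᵥ ((gram (dataMatrix X ω) - (1 / 2 : ℝ) • covMatrix μ) *ᵥ V) < 0 := hω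
      rw [Matrix.sub_mulVec, dotProduct_sub, Matrix.smul_mulVec, dotProduct_smul,
        smul_eq_mul] at hω'
      have hl := hlow V
      have e : V ⬝ᵥ V / (2 * κ) = 1 / 2 * (1 / κ * (V ⬝ᵥ V)) := by field_simp
      change V ⬝ᵥ V / (2 * κ) ≤ _
      rw [e, abs_sub_comm]
      refine le_trans ?_ (le_abs_self _)
      linarith
    · rw [mul_pow, hβ2, hN]
      congr 4
      field_simp
      ring
  · refine ENNReal.ofReal_le_ofReal ?_
    have hlogp : 0 < Real.log p := Real.log_pos (by linarith)
    have hpexp : Real.exp (Real.log p) = p := Real.exp_log (by linarith)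
    have hcard : ((Finset.univ : Finset (Fin m → Fin p × Bool)).card : ℝ) = (p * 2) ^ m := by
      simp
    rw [hcard]
    have h1 : ((p : ℝ) * 2) ^ m ≤ Real.exp (2 * m * Real.log p) := by
      have : (p : ℝ) * 2 ≤ Real.exp (2 * Real.log p) := by
        rw [two_mul, Real.exp_add, hpexp]; gcongr
      calc ((p : ℝ) * 2) ^ m ≤ Real.exp (2 * Real.log p) ^ m := by gcongr
        _ = _ := by rw [← Real.exp_nat_mul]; congr 1; ring
    calc ((p : ℝ) * 2) ^ m * (2 * Real.exp (-N))
        ≤ Real.exp (2 * m * Real.log p) * (Real.exp (Real.log p) * Real.exp (-N)) := by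
          gcongr; rw [hpexp]; exact hp'
      _ = Real.exp ((2 * m + 1) * Real.log p - N) := by
          rw [← Real.exp_add, ← Real.exp_add]; congr 1; ring
      _ ≤ Real.exp (-Real.log p) := by
          refine Real.exp_le_exp.2 ?_
          rw [hN]; linarith
      _ = 1 / p := by rw [Real.exp_neg, hpexp, one_div]

/-- The constant `14` makes the exponent in Bernstein's inequality at least `3 log p`. -/
theorem measure_pair_le (hn : 1 ≤ n) (hp : 1 ≤ p) (hK : 0 < K) (hκ : 1 ≤ κ)
    (hpsi : psi2NormVec μ ≤ ENNReal.ofReal K) (hmean : ∀ j, ∫ x, x j ∂μ = 0)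
    (hX : iIndepFun X P) (hlaw : ∀ i, HasLaw (X i) μ P) {r : ℝ} (hr0 : 0 ≤ r) (hr1 : r ≤ 1)
    (hr : n * r ^ 2 = Real.log p) {u w : Fin p → ℝ} (hu : u ⬝ᵥ u ≤ κ ^ 2) (hw : w ⬝ᵥ w ≤ κ ^ 2) :
    P {ω | 14 * ((K + 1) * κ) ^ 2 * r ≤
      |u ⬝ᵥ (gram (dataMatrix X ω) *ᵥ w) - u ⬝ᵥ (covMatrix μ *ᵥ w)|} ≤
      ENNReal.ofReal (2 / p ^ 3) := by
  have hp' : (1 : ℝ) ≤ p := by exact_mod_cast hp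
  have hL : 0 < ((K + 1) * κ) ^ 2 := by positivity
  refine (form_gram_tail hn hK hpsi hmean hX hlaw (by linarith) hu hw (by positivity)
    (by nlinarith)).trans ?_
  refine ENNReal.ofReal_le_ofReal ?_
  have e : (n : ℝ) * (14 * ((K + 1) * κ) ^ 2 * r) ^ 2 / (64 * (((K + 1) * κ) ^ 2) ^ 2) =
      49 / 16 * Real.log p := by
    rw [← hr]; field_simp; ring
  have h3 : Real.exp (3 * Real.log p) = p ^ 3 := by
    have := Real.exp_nat_mul (Real.log p) 3
    push_cast at this
    rw [this, Real.exp_log (by linarith)]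
  have hlog := Real.log_nonneg hp'
  rw [e, ← h3, div_eq_mul_inv 2, ← Real.exp_neg]
  gcongr
  linarith

end

theorem log_pow_five_le {x : ℝ} (hx : 1 ≤ x) : Real.log x ^ 5 ≤ 3125 * x := by
  have hl := Real.log_nonneg hx
  have h1 : Real.log x / 5 ≤ Real.exp (Real.log x / 5) := by
    linarith [Real.add_one_le_exp (Real.log x / 5)]
  have h2 : (Real.log x / 5) ^ 5 ≤ Real.exp (Real.log x / 5) ^ 5 := by gcongr
  have h3 : Real.exp (Real.log x / 5) ^ 5 = x := by
    rw [← Real.exp_nat_mul]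
    have : ((5 : ℕ) : ℝ) * (Real.log x / 5) = Real.log x := by push_cast; ring
    rw [this, Real.exp_log (by linarith)]
  rw [h3, div_pow] at h2
  linarith

/-- The bound uses `p ≤ n`: `r³ p ≤ r log p`, and `√r log p` is bounded because
`r² ≤ log p / p`. -/
theorem rate_cube_le {n p : ℕ} (hp : 1 ≤ p) (hpn : p ≤ n) {r : ℝ} (hr : 0 ≤ r)
    (hr2 : n * r ^ 2 = Real.log p) : r ^ 3 * p ≤ 8 * √r := by
  have hp' : (1 : ℝ) ≤ p := by exact_mod_cast hp
  have hpn' : (p : ℝ) ≤ n := by exact_mod_cast hpn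
  have hlog := Real.log_nonneg hp'
  have h1 : r ^ 2 * p ≤ Real.log p := by rw [← hr2, mul_comm]; gcongr
  have hs := Real.sq_sqrt hr
  have hs0 := Real.sqrt_nonneg r
  have h2 : √r * Real.log p ≤ 8 := by
    refine le_of_pow_le_pow_left₀ (n := 4) (by norm_num) (by norm_num) ?_
    have e : (√r * Real.log p) ^ 4 = r ^ 2 * Real.log p ^ 4 := by
      have : √r ^ 4 = (√r ^ 2) ^ 2 := by ring
      rw [mul_pow, this, hs]
    have h3 : (p : ℝ) * (r ^ 2 * Real.log p ^ 4) ≤ p * 3125 := by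
      calc (p : ℝ) * (r ^ 2 * Real.log p ^ 4) = (r ^ 2 * p) * Real.log p ^ 4 := by ring
        _ ≤ Real.log p * Real.log p ^ 4 := by gcongr
        _ = Real.log p ^ 5 := by ring
        _ ≤ p * 3125 := by linarith [log_pow_five_le hp']
    have h4 := le_of_mul_le_mul_left h3 (by linarith)
    rw [e]; linarith
  calc r ^ 3 * p = r * (r ^ 2 * p) := by ring
    _ ≤ r * Real.log p := by gcongr
    _ = √r * (√r * Real.log p) := by rw [← mul_assoc, Real.mul_self_sqrt hr]
    _ ≤ √r * 8 := by gcongr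
    _ = _ := by ring

/-- The finitely many inequalities that define the good event imply `SampleBounds`. -/
theorem sampleBounds_of_finite {p : ℕ} {H S : Matrix (Fin p) (Fin p) ℝ} {κ A b x r : ℝ} {m : ℕ}
    (hp : 1 ≤ p) (hH : H.PosSemidef) (hS : S.IsHermitian) (hκ : 1 ≤ κ) (hA : 0 ≤ A)
    (heig : ∀ e : ℝ, Module.End.HasEigenvalue (Matrix.toLin' S⁻¹) e → 1 / κ ≤ e ∧ e ≤ κ)
    (hm : 2 ≤ m) (hb : 4 * A ≤ (m - 1) * (b * r ^ 2))
    (h1 : ∀ z ∈ gridBall p, (fun k => (z k : ℝ)) ⬝ᵥ (H *ᵥ fun k => (z k : ℝ)) ≤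
      A * ((fun k => (z k : ℝ)) ⬝ᵥ fun k => (z k : ℝ)))
    (h2 : ∀ f : Fin m → Fin p × Bool, 0 ≤ (∑ i, signedBasis (f i)) ⬝ᵥ
        ((H - (1 / 2 : ℝ) • S) *ᵥ ∑ i, signedBasis (f i)))
    (h3 : ∀ j k, |(Pi.single k 1 : Fin p → ℝ) ⬝ᵥ (H *ᵥ popVec S⁻¹ j) -
      (Pi.single k 1 : Fin p → ℝ) ⬝ᵥ (S *ᵥ popVec S⁻¹ j)| ≤ x * r)
    (h4 : ∀ j, |popVec S⁻¹ j ⬝ᵥ (H *ᵥ popVec S⁻¹ j) -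
      popVec S⁻¹ j ⬝ᵥ (S *ᵥ popVec S⁻¹ j)| ≤ x * r) :
    SampleBounds H S⁻¹ (4 * A) (1 / (2 * κ)) b (2 * x) x r := by
  have hκ0 : 0 < κ := by linarith
  have hdet := isUnit_det_of_eigenvalue_bounds hp hκ0 heig
  have hpop := popBounds_inv hS hκ0 heig
  have hlow := form_lower_bound hp hS hκ0 heig
  have hupper : ∀ u : Fin p → ℝ, u ⬝ᵥ (H *ᵥ u) ≤ 4 * A * (u ⬝ᵥ u) := by
    refine form_le_of_grid hp hH hA fun z hz => ?_
    rw [← dot_self_eq (fun k => (z k : ℝ))]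
    exact h1 z (mem_gridBall.2 hz)
  refine ⟨hupper, fun u => ?_, fun j k hk => ?_, fun j => ?_⟩
  · have hdiag : ∀ k, (H - (1 / 2 : ℝ) • S) k k ≤ 4 * A := by
      intro k
      have i1 := hupper (Pi.single k 1)
      have i2 := hlow (Pi.single k 1)
      simp only [Matrix.mulVec_single_one, single_one_dotProduct, Matrix.col_apply,
        Pi.single_eq_same, mul_one] at i1 i2
      have i3 : 0 < 1 / κ := by positivity
      simp only [Matrix.sub_apply, Matrix.smul_apply, smul_eq_mul]
      linarith
    have h := form_ge_of_sparse (H - (1 / 2 : ℝ) • S) (by omega) h2 hdiag u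
    have hm1 : (0 : ℝ) < m - 1 := by
      have : (2 : ℝ) ≤ m := by exact_mod_cast hm
      linarith
    have hN : 0 ≤ (∑ k, |u k|) ^ 2 := sq_nonneg _
    have h5 : 0 ≤ ((m : ℝ) - 1) * (u ⬝ᵥ ((H - (1 / 2 : ℝ) • S) *ᵥ u) +
        b * r ^ 2 * (∑ k, |u k|) ^ 2) := by
      nlinarith [mul_le_mul_of_nonneg_right hb hN]
    have h6 := nonneg_of_mul_nonneg_right h5 hm1
    rw [Matrix.sub_mulVec, dotProduct_sub, Matrix.smul_mulVec, dotProduct_smul, smul_eq_mul] at h6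
    have e : 1 / (2 * κ) * (u ⬝ᵥ u) = 1 / 2 * (1 / κ * (u ⬝ᵥ u)) := by field_simp
    rw [e]
    linarith [hlow u]
  · have h := h3 j k
    rw [mulVec_popVec hdet, single_one_dotProduct, single_one_dotProduct, Pi.smul_apply,
      Pi.single_eq_of_ne hk, smul_zero, sub_zero] at h
    linarith
  · have h := h4 j
    rw [mulVec_popVec hdet, dotProduct_smul, dotProduct_single_one, popVec_self hpop hκ0,
      smul_eq_mul, mul_one] at h
    exact h

/-- `SampleBounds` holds on an event of probability at least `1 - 6 / p`: the bounds on the grid and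
on the sparse vectors fail with probability at most `1 / p` each, those on the noise and on the
variances with probability at most `2 / p` each. -/
theorem exists_good_event {p n : ℕ} {μ : Measure (EuclideanSpace ℝ (Fin p))}
    [IsProbabilityMeasure μ] {K κ : ℝ} {S : Type*} [MeasurableSpace S] {P : Measure S}
    [IsProbabilityMeasure P] {X : Fin n → S → EuclideanSpace ℝ (Fin p)} (hp : 2 ≤ p) (hpn : p ≤ n)
    (hK : 0 < K) (hκ : 1 ≤ κ) (hpsi : psi2NormVec μ ≤ ENNReal.ofReal K)
    (hmean : ∀ j, ∫ x, x j ∂μ = 0) (hX : iIndepFun X P) (hlaw : ∀ i, HasLaw (X i) μ P)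
    (heig : ∀ e : ℝ, Module.End.HasEigenvalue (Matrix.toLin' (precMatrix μ)) e →
      1 / κ ≤ e ∧ e ≤ κ) {r : ℝ} (hr0 : 0 < r) (hr1 : r ≤ 1) (hr : n * r ^ 2 = Real.log p)
    (hrs : r ^ 2 * (8 * (256 * κ ^ 2 * (K + 1) ^ 4)) ≤ 1) :
    ∃ E : Set S, MeasurableSet E ∧ 1 - 6 / (p : ℝ) ≤ P.real E ∧ ∀ ω ∈ E,
      SampleBounds (gram (dataMatrix X ω)) (precMatrix μ) (4 * (6 * (K + 1) ^ 2)) (1 / (2 * κ))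
        (16 * (256 * κ ^ 2 * (K + 1) ^ 4) * (4 * (6 * (K + 1) ^ 2)))
        (2 * (14 * ((K + 1) * κ) ^ 2)) (14 * ((K + 1) * κ) ^ 2) r := by
  have hp1 : 1 ≤ p := by omega
  have hn : 1 ≤ n := hp1.trans hpn
  have hκ0 : 0 < κ := by linarith
  have hp' : (2 : ℝ) ≤ p := by exact_mod_cast hp
  have hS := covMatrix_isHermitian μ
  obtain ⟨D, hD⟩ : ∃ D, D = 256 * κ ^ 2 * (K + 1) ^ 4 := ⟨_, rfl⟩
  have hD0 : 0 < D := by rw [hD]; positivity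
  rw [← hD] at hrs ⊢
  -- The sparsity level: as large as the union bound over sums of `m` signed basis vectors permits.
  obtain ⟨m, hmdef⟩ : ∃ m : ℕ, m = ⌊1 / (4 * D * r ^ 2)⌋₊ := ⟨_, rfl⟩
  have hq : 0 < 4 * D * r ^ 2 := by positivity
  have hfl : (2 : ℝ) ≤ 1 / (4 * D * r ^ 2) := by
    rw [le_div_iff₀ hq]; linarith
  have hm2 : 2 ≤ m := by rw [hmdef]; exact Nat.le_floor (by exact_mod_cast hfl)
  have hm2' : (2 : ℝ) ≤ m := by exact_mod_cast hm2
  have hmle : (m : ℝ) ≤ 1 / (4 * D * r ^ 2) := by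
    rw [hmdef]; exact Nat.floor_le (by positivity)
  have hmge : 1 / (4 * D * r ^ 2) < m + 1 := by rw [hmdef]; exact Nat.lt_floor_add_one _
  have hsparse : (2 * m + 2) * Real.log p ≤ n / D := by
    rw [← hr, le_div_iff₀ hD0]
    rw [le_div_iff₀ hq] at hmle
    calc (2 * (m : ℝ) + 2) * (n * r ^ 2) * D ≤ (4 * m) * (n * r ^ 2) * D := by gcongr; linarith
      _ = n * (m * (4 * D * r ^ 2)) := by ring
      _ ≤ n * 1 := by gcongr
      _ = n := mul_one _
  have hb : ∀ A : ℝ, 0 ≤ A → 4 * A ≤ (m - 1) * (16 * D * (4 * A) * r ^ 2) := by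
    intro A hA
    rw [div_lt_iff₀ hq] at hmge
    have : 1 ≤ (m - 1) * (16 * D * r ^ 2) := by nlinarith
    nlinarith
  have hlow := form_lower_bound hp1 hS hκ0 heig
  have hpopsq := popVec_sq_le hS hκ0 heig
  have hsingle : ∀ k, (Pi.single k 1 : Fin p → ℝ) ⬝ᵥ Pi.single k 1 ≤ κ ^ 2 := by
    intro k
    rw [single_one_dotProduct, Pi.single_eq_same]
    exact one_le_pow₀ hκ
  have m1 := measure_grid_le hn hp1 hpn hK hpsi hX hlaw
  have m2 := measure_sparse_le (m := m) hn hp hK hκ hpsi hmean hX hlaw hlow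
    (by rw [← hD]; exact hsparse)
  have m3 := measure_exists_le (P := P) (Finset.univ : Finset (Fin p × Fin p)) fun jk _ =>
    measure_pair_le hn hp1 hK hκ hpsi hmean hX hlaw hr0.le hr1 hr (hsingle jk.2) (hpopsq jk.1)
  have m4 := measure_exists_le (P := P) (Finset.univ : Finset (Fin p)) fun j _ =>
    measure_pair_le hn hp1 hK hκ hpsi hmean hX hlaw hr0.le hr1 hr (hpopsq j) (hpopsq j)
  set B₁ := {ω | ∃ z ∈ gridBall p,
    6 * (K + 1) ^ 2 * ((fun k => (z k : ℝ)) ⬝ᵥ fun k => (z k : ℝ)) <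
      (fun k => (z k : ℝ)) ⬝ᵥ (gram (dataMatrix X ω) *ᵥ fun k => (z k : ℝ))}
  set B₂ := {ω | ∃ f ∈ (Finset.univ : Finset (Fin m → Fin p × Bool)),
      (∑ i, signedBasis (f i)) ⬝ᵥ
        ((gram (dataMatrix X ω) - (1 / 2 : ℝ) • covMatrix μ) *ᵥ ∑ i, signedBasis (f i)) < 0}
  set B₃ := {ω | ∃ jk ∈ (Finset.univ : Finset (Fin p × Fin p)),
    ω ∈ {ω | 14 * ((K + 1) * κ) ^ 2 * r ≤
      |(Pi.single jk.2 1 : Fin p → ℝ) ⬝ᵥ (gram (dataMatrix X ω) *ᵥ popVec (covMatrix μ)⁻¹ jk.1) -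
        (Pi.single jk.2 1 : Fin p → ℝ) ⬝ᵥ (covMatrix μ *ᵥ popVec (covMatrix μ)⁻¹ jk.1)|}}
  set B₄ := {ω | ∃ j ∈ (Finset.univ : Finset (Fin p)), ω ∈ {ω | 14 * ((K + 1) * κ) ^ 2 * r ≤
      |popVec (covMatrix μ)⁻¹ j ⬝ᵥ (gram (dataMatrix X ω) *ᵥ popVec (covMatrix μ)⁻¹ j) -
        popVec (covMatrix μ)⁻¹ j ⬝ᵥ (covMatrix μ *ᵥ popVec (covMatrix μ)⁻¹ j)|}}
  have hbad : P (B₁ ∪ B₂ ∪ B₃ ∪ B₄) ≤ ENNReal.ofReal (6 / p) := by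
    have e3 : ((Finset.univ : Finset (Fin p × Fin p)).card : ℝ) * (2 / (p : ℝ) ^ 3) ≤ 2 / p := by
      refine le_of_eq ?_
      simp only [Finset.card_univ, Fintype.card_prod, Fintype.card_fin]
      push_cast
      field_simp
    have e4 : ((Finset.univ : Finset (Fin p)).card : ℝ) * (2 / (p : ℝ) ^ 3) ≤ 2 / p := by
      simp only [Finset.card_univ, Fintype.card_fin]
      have : (p : ℝ) * (2 / (p : ℝ) ^ 3) = 2 / p * (1 / p) := by field_simp
      rw [this]
      have : 1 / (p : ℝ) ≤ 1 := by rw [div_le_one (by linarith)]; linarith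
      exact mul_le_of_le_one_right (by positivity) this
    have m3' := m3.trans (ENNReal.ofReal_le_ofReal e3)
    have m4' := m4.trans (ENNReal.ofReal_le_ofReal e4)
    calc P (B₁ ∪ B₂ ∪ B₃ ∪ B₄) ≤ P B₁ + P B₂ + P B₃ + P B₄ := by
          refine (measure_union_le _ _).trans (add_le_add_left ?_ _)
          refine (measure_union_le _ _).trans (add_le_add_left ?_ _)
          exact measure_union_le _ _
      _ ≤ ENNReal.ofReal (1 / p) + ENNReal.ofReal (1 / p) + ENNReal.ofReal (2 / p) +
          ENNReal.ofReal (2 / p) := by gcongr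
      _ = ENNReal.ofReal (6 / p) := by
          rw [← ENNReal.ofReal_add (by positivity) (by positivity),
            ← ENNReal.ofReal_add (by positivity) (by positivity),
            ← ENNReal.ofReal_add (by positivity) (by positivity)]
          congr 1; ring
  -- The bad event need not be measurable, so the good event is the complement of a measurable hull.
  refine ⟨(toMeasurable P (B₁ ∪ B₂ ∪ B₃ ∪ B₄))ᶜ, (measurableSet_toMeasurable _ _).compl, ?_, ?_⟩
  · rw [probReal_compl_eq_one_sub (measurableSet_toMeasurable _ _)]
    have : P.real (toMeasurable P (B₁ ∪ B₂ ∪ B₃ ∪ B₄)) ≤ 6 / p := by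
      rw [Measure.real, measure_toMeasurable]
      exact ENNReal.toReal_le_of_le_ofReal (by positivity) hbad
    linarith
  · intro ω hω
    have hω' : ω ∉ B₁ ∪ B₂ ∪ B₃ ∪ B₄ := fun h => hω (subset_toMeasurable _ _ h)
    simp only [Set.mem_union, not_or] at hω'
    obtain ⟨⟨⟨n1, n2⟩, n3⟩, n4⟩ := hω'
    refine sampleBounds_of_finite hp1 (gram_posSemidef _) hS hκ (by positivity) heig hm2
      (hb _ (by positivity)) ?_ ?_ ?_ ?_
    · intro z hz
      by_contra h
      exact n1 ⟨z, hz, not_le.1 h⟩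
    · intro f
      by_contra h
      exact n2 ⟨f, Finset.mem_univ _, not_le.1 h⟩
    · intro j k
      by_contra h
      exact n3 ⟨(j, k), Finset.mem_univ _, (not_le.1 h).le⟩
    · intro j
      by_contra h
      exact n4 ⟨j, Finset.mem_univ _, (not_le.1 h).le⟩

end JPR

theorem theorem1 (δ M K κ : ℝ) (hδ₀ : 0 < δ) (hδ₁ : δ < 1) (hM : 0 < M) (hK : 0 < K)
    (hκ : 1 < κ) :
    ∃ c C₁ C₂ ε₀ : ℝ, 0 < c ∧ 0 < C₁ ∧ 0 < C₂ ∧ 0 < ε₀ ∧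
      ∀ (n p : ℕ) (_hn : 1 ≤ n) (_hp : 1 ≤ p)
        -- the dimensionality
        (_hdim : (p : ℝ) / n ≤ 1 - δ)
        (_hsmall : Real.log p / n ≤ ε₀)
        -- the common distribution of the rows: mean zero and sub-Gaussian
        (μ : Measure (EuclideanSpace ℝ (Fin p)))
        (_hmean : ∀ j, ∫ x, x j ∂μ = 0)
        (_hpsi : JPR.psi2NormVec μ ≤ ENNReal.ofReal K)
        -- all eigenvalues of the precision matrix lie in `[1/κ, κ]`
        (_heig : ∀ e : ℝ, Module.End.HasEigenvalue (Matrix.toLin' (JPR.precMatrix μ)) e →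
          1 / κ ≤ e ∧ e ≤ κ)
        -- the degree
        (_hdeg : (JPR.degree (JPR.precMatrix μ) : ℝ) * Real.sqrt (Real.log p / n) ≤ M)
        -- the i.i.d. rows `X 0, …, X (n - 1)` of the data matrix
        (S : Type*) [MeasurableSpace S] (P : Measure S) [IsProbabilityMeasure P]
        (X : Fin n → S → EuclideanSpace ℝ (Fin p))
        (_hindep : iIndepFun X P) (_hlaw : ∀ i, HasLaw (X i) μ P),
      -- an event of probability at least `1 - 6/p` on which the procedure has an output
      -- and every output satisfies both bounds
      ∃ E : Set S, MeasurableSet E ∧ 1 - 6 / (p : ℝ) ≤ P.real E ∧ ∀ ω ∈ E,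
        (∃ W Q, JPR.IsOutput (Matrix.of fun i j => X i ω j) (c * Real.sqrt (Real.log p / n)) W Q) ∧
        ∀ W Q, JPR.IsOutput (Matrix.of fun i j => X i ω j) (c * Real.sqrt (Real.log p / n)) W Q →
          ‖Q - JPR.partialCorrMatrix μ‖ ≤
            C₁ * Real.sqrt ((JPR.size (JPR.precMatrix μ) : ℝ) * Real.log p / n) ∧
          ‖W - JPR.precMatrix μ‖ ≤
            C₂ * Real.sqrt (((JPR.size (JPR.precMatrix μ) : ℝ) + p) * Real.log p / n) := by
  obtain ⟨A, hA⟩ : ∃ A, A = 4 * (6 * (K + 1) ^ 2) := ⟨_, rfl⟩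
  obtain ⟨D, hD⟩ : ∃ D, D = 256 * κ ^ 2 * (K + 1) ^ 4 := ⟨_, rfl⟩
  obtain ⟨x, hx⟩ : ∃ x, x = 14 * ((K + 1) * κ) ^ 2 := ⟨_, rfl⟩
  have hκ0 : 0 < κ := by linarith
  have hA0 : 0 < A := by rw [hA]; positivity
  have hD0 : 0 < D := by rw [hD]; positivity
  have hx0 : 0 < x := by rw [hx]; positivity
  obtain ⟨r₀, hr₀, C, hC, hmain⟩ := JPR.deterministic_bounds (κ := κ) (M := M) (A := A)
    (a := 1 / (2 * κ)) (b := 16 * D * A) (c := 2 * x) (C := x) hκ.le hM hA0.le (by positivity)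
    (by positivity) (by positivity) hx0.le
  refine ⟨2 * x, √(2 * C), √(2 * C), min (r₀ ^ 2) (min 1 (1 / (8 * D))), by positivity,
    by positivity, by positivity, by positivity, ?_⟩
  intro n p hn hp hdim hsmall μ hmean hpsi heig hdeg S _ P _ X hindep hlaw
  rcases Nat.lt_or_ge p 2 with hp2 | hp2
  · -- For `p = 1` the claimed probability `1 - 6 / p` is negative.
    refine ⟨∅, MeasurableSet.empty, ?_, fun ω hω => absurd hω (Set.notMem_empty ω)⟩
    obtain rfl : p = 1 := by omega
    simp
  have hn' : (0 : ℝ) < n := by exact_mod_cast hn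
  have hpn : p ≤ n := by
    rw [div_le_iff₀ hn'] at hdim
    have : (p : ℝ) ≤ n := by nlinarith
    exact_mod_cast this
  have hlog : 0 < Real.log p := Real.log_pos (by exact_mod_cast hp2)
  obtain ⟨r, hr⟩ : ∃ r, r = √(Real.log p / n) := ⟨_, rfl⟩
  have hr0 : 0 < r := by rw [hr]; positivity
  have hr2 : r ^ 2 = Real.log p / n := by rw [hr]; exact Real.sq_sqrt (by positivity)
  have hnr : n * r ^ 2 = Real.log p := by rw [hr2]; field_simp
  rw [← hr2] at hsmall
  have hrr₀ : r ≤ r₀ :=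
    le_of_sq_le_sq (hsmall.trans (min_le_left _ _)) hr₀.le
  have hr1 : r ≤ 1 := by
    have := hsmall.trans ((min_le_right _ _).trans (min_le_left _ _))
    nlinarith
  have hrD : r ^ 2 * (8 * D) ≤ 1 := by
    rw [← le_div_iff₀ (by positivity)]
    exact hsmall.trans ((min_le_right _ _).trans (min_le_right _ _))
  have hμ : IsProbabilityMeasure μ := by
    rw [← (hlaw ⟨0, hn⟩).map_eq]
    exact Measure.isProbabilityMeasure_map (hlaw ⟨0, hn⟩).aemeasurable
  obtain ⟨E, hE, hPE, hgood⟩ := JPR.exists_good_event hp2 hpn hK hκ.le hpsi hmean hindep hlaw heig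
    hr0 hr1 hnr (by rw [← hD]; exact hrD)
  rw [← hA, ← hD, ← hx] at hgood
  rw [← hr] at hdeg ⊢
  refine ⟨E, hE, hPE, fun ω hω => ?_⟩
  have hcov := JPR.covMatrix_isHermitian μ
  have hpop : JPR.PopBounds (JPR.precMatrix μ) κ := JPR.popBounds_inv hcov hκ0 heig
  have hpd := JPR.posDef_of_eigenvalue_bounds hp hcov hκ0 heig
  obtain ⟨hpos, hout⟩ := hmain n p (JPR.dataMatrix X ω) (JPR.precMatrix μ) r hr0 hrr₀ hpop
    (hgood ω hω) (fun j => le_trans (by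
      gcongr; exact_mod_cast JPR.card_nbhd_le_degree (JPR.precMatrix μ) j) hdeg)
    (JPR.rate_cube_le hp hpn hr0.le hnr)
  refine ⟨JPR.exists_isOutput _ (by positivity) hpos, fun W Q hWQ => ?_⟩
  obtain ⟨hQ, hW⟩ := hout W Q hWQ
  rw [JPR.sum_card_nbhd hpop.symm] at hQ hW
  have hres : JPR.residVar (JPR.covMatrix μ) = fun j => 1 / JPR.precMatrix μ j j :=
    funext fun j => JPR.residVar_eq hpd j
  constructor
  · rw [← Real.sqrt_mul (by positivity), JPR.partialCorrMatrix, hres]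
    refine JPR.frobenius_norm_le (le_trans hQ (le_of_eq ?_))
    rw [hr2]; ring
  · rw [← Real.sqrt_mul (by positivity)]
    refine JPR.frobenius_norm_le (le_trans hW ?_)
    rw [hr2]
    have : 0 ≤ C * (Real.log p / n * p) := by positivity
    calc C * (Real.log p / n * (2 * (JPR.size (JPR.precMatrix μ) : ℝ) + p))
        ≤ C * (Real.log p / n * (2 * (JPR.size (JPR.precMatrix μ) : ℝ) + p)) +
          C * (Real.log p / n * p) := le_add_of_nonneg_right this
      _ = _ := by ring
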